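/- Let $V\in C^\infty(\mathbb R)$ be real-valued with $V=V_{\rm per}+V_{\rm def}$, where $V_{\rm per}(x+1)=V_{\rm per}(x)$ for all $x$ and $V_{\rm def}(x)=0$ for $|x|>\rho$, for some $\rho\ge 0$; no parity of $V$ is assumed. Let $E>0$ and let $0\neq\Phi\in L^2(\mathbb R)$ satisfy $-\Phi''+V\Phi=E\Phi$. Normalize $\Phi$ so that $\Phi(0)=1$ if $\Phi(0)\ne0$, and $\Phi'(0)=1$ if $\Phi(0)=0$. For $\zeta=(w,z)\in\mathbb C^2$ let $u_\zeta$ be the solution of $-u''+Vu=zu$ with $(u,u')(0)=(1,w)$ if $\Phi(0)\neq0$, and $(u,u')(0)=(-w,1)$ if $\Phi(0)=0$. Let $\eta=(\Phi'(0),E)$ if $\Phi(0)\ne0$ and $\eta=(0,E)$ if $\Phi(0)=0$. For $M>0$ put $$\Theta^\pm(\zeta)=u_\zeta'(\pm M)\mp i\sqrt z\,u_\zeta(\pm M),\qquad \vec\Theta=(\Theta^+,\Theta^-),$$ with the principal square root; the equations $\Theta^\pm(\zeta)=0$ are the outgoing conditions at $\pm M$. Let $\mathcal N=\partial_w\Theta^+\partial_z\Theta^--\partial_z\Theta^+\partial_w\Theta^-$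 and $$\Xi=\frac1{\mathcal N(\eta)}\begin{pmatrix}\partial_z\Theta^-(\eta)&-\partial_z\Theta^+(\eta)\\-\partial_w\Theta^-(\eta)&\partial_w\Theta^+(\eta)\end{pmatrix},$$ the inverse of the Jacobian matrix of $\vec\Theta$ at $\eta$. Let $H_{\rm trunc}=-\frac{d^2}{dx^2}+V_{\rm trunc}$ with $V_{\rm trunc}=V$ on $[-M,M]$ and $V_{\rm trunc}=0$ elsewhere. A number $z$ with $\operatorname{Re}z>0$, $\operatorname{Im}z<0$ is called a resonance of $H_{\rm trunc}$ if $-\psi''+V_{\rm trunc}\psi=z\psi$ has a nonzero $C^1$ solution $\psi$ (equation in the integrated, equivalently almost everywhere, sense) that is a multiple of $e^{i\sqrt z\,x}$ for all large $x$ and a multiple of $e^{-i\sqrt z\,x}$ for all large $-x$. Then the equation $-\psi''+V_{\rm per}\psi=E\psi$ has a real characteristic multiplier $\lambda$ with $|\lambda|=e^{\kappa}$, $\kappa>0$, and for every $k\in(0,\kappa]$ there are $M_0>\rho$ and $C>0$ such that for all $M\ge M_0$: 1. $\vec\Theta$ is differentiable at $\eta$, $\mathcal N(\eta)\neq0$,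 and $\vec\Theta$ has a unique root $\zeta^*=(w^*,z^*)$ in the ball $\Omega_M=\{\zeta\in\mathbb C^2: |\zeta-\eta|\le M^{-2}e^{-kM}\}$; 2. if $k<\kappa$, then $|\zeta^*-(\eta-\Xi\,\vec\Theta(\eta))|\le C e^{-4kM}$; moreover, for every $k\in(0,\kappa]$, $|\zeta^*-(\eta-\Xi\,\vec\Theta(\eta))|\le C M e^{-4\kappa M}$; 3. $z^*$ is a resonance of $H_{\rm trunc}$ (in particular $\operatorname{Re}z^*>0$ and $\operatorname{Im}z^*<0$). -/

import Mathlib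

open MeasureTheory

noncomputable section

namespace TruncatedDefect

/-- Points `ζ = (w, z)` of `ℂ²`, with the Euclidean norm: `ζ 0 = w`, `ζ 1 = z`. -/
abbrev C2 : Type := EuclideanSpace ℂ (Fin 2)

/-- Eventually periodic potentials: `V` is smooth, `V = Vper + Vdef`, `Vper` has period `1`
and `Vdef` vanishes for `|x| > ρ`. -/
structure IsEventuallyPeriodic (V Vper Vdef : ℝ → ℝ) (ρ : ℝ) : Prop where
  smooth : ContDiff ℝ ((⊤ : ℕ∞) : WithTop ℕ∞) V
  decomp : ∀ x, V x = Vper x + Vdef x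
  periodic : ∀ x, Vper (x + 1) = Vper x
  supp : ∀ x, ρ < |x| → Vdef x = 0

/-- `u` is a (classical, complex-valued) solution on `ℝ` of `-u'' + V u = z u`. -/
def IsSolution (V : ℝ → ℝ) (z : ℂ) (u : ℝ → ℂ) : Prop :=
  ContDiff ℝ 2 u ∧ ∀ x, -deriv (deriv u) x + (V x : ℂ) * u x = z * u x

/-- A bound state of `H = -d²/dx² + V` with eigenvalue `E`: a nonzero square integrable
solution of `H Φ = E Φ`. -/
structure IsBoundState (V : ℝ → ℝ) (E : ℝ) (Φ : ℝ → ℂ) : Prop where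
  sol : IsSolution V (E : ℂ) Φ
  memLp : MemLp Φ 2 volume
  ne_zero : Φ ≠ 0

/-- The solution of `-u'' + V u = z u`, `u 0 = a`, `u' 0 = b`
(for continuous `V` it exists on all of `ℝ` and is unique). -/
def ivp (V : ℝ → ℝ) (z a b : ℂ) : ℝ → ℂ :=
  Classical.epsilon fun u : ℝ → ℂ => IsSolution V z u ∧ u 0 = a ∧ deriv u 0 = b

open scoped Classical in
/-- The solution `u_ζ`, `ζ = (w, z)`, of `-u'' + V u = z u` with initial data
`(u, u')(0) = (1, w)` if `Φ 0 ≠ 0` and `(u, u')(0) = (-w, 1)` if `Φ 0 = 0`. -/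
def uSol (V : ℝ → ℝ) (Φ : ℝ → ℂ) (ζ : C2) : ℝ → ℂ :=
  if Φ 0 ≠ 0 then ivp V (ζ 1) 1 (ζ 0) else ivp V (ζ 1) (-(ζ 0)) 1

open scoped Classical in
/-- The base point `η = (w₀, E)`. If `Φ 0 ≠ 0` then `w₀ = Φ'(0) / Φ(0)`, which is `Φ'(0)` after
normalizing `Φ 0 = 1`; if `Φ 0 = 0` then `w₀ = 0`. -/
def eta (Φ : ℝ → ℂ) (E : ℝ) : C2 :=
  !₂[if Φ 0 ≠ 0 then deriv Φ 0 / Φ 0 else 0, (E : ℂ)]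

/-- `Θ⁺(ζ) = u_ζ'(M) - i √z u_ζ(M)`; `Complex.sqrt` is the principal branch. -/
def ThetaPlus (V : ℝ → ℝ) (Φ : ℝ → ℂ) (M : ℝ) (ζ : C2) : ℂ :=
  deriv (uSol V Φ ζ) M - Complex.I * Complex.sqrt (ζ 1) * uSol V Φ ζ M

/-- `Θ⁻(ζ) = u_ζ'(-M) + i √z u_ζ(-M)`. -/
def ThetaMinus (V : ℝ → ℝ) (Φ : ℝ → ℂ) (M : ℝ) (ζ : C2) : ℂ :=
  deriv (uSol V Φ ζ) (-M) + Complex.I * Complex.sqrt (ζ 1) * uSol V Φ ζ (-M)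

/-- `Θ = (Θ⁺, Θ⁻) : ℂ² → ℂ²`. -/
def Theta (V : ℝ → ℝ) (Φ : ℝ → ℂ) (M : ℝ) (ζ : C2) : C2 :=
  !₂[ThetaPlus V Φ M ζ, ThetaMinus V Φ M ζ]

/-- The partial derivative `∂_w F` at `ζ`. -/
def dw (F : C2 → ℂ) (ζ : C2) : ℂ := deriv (fun w : ℂ => F !₂[w, ζ 1]) (ζ 0)

/-- The partial derivative `∂_z F` at `ζ`. -/
def dz (F : C2 → ℂ) (ζ : C2) : ℂ := deriv (fun z : ℂ => F !₂[ζ 0, z]) (ζ 1)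

/-- The Jacobian determinant `𝒩(ζ) = ∂_w Θ⁺ ∂_z Θ⁻ - ∂_z Θ⁺ ∂_w Θ⁻`. -/
def jacDet (V : ℝ → ℝ) (Φ : ℝ → ℂ) (M : ℝ) (ζ : C2) : ℂ :=
  dw (ThetaPlus V Φ M) ζ * dz (ThetaMinus V Φ M) ζ -
    dz (ThetaPlus V Φ M) ζ * dw (ThetaMinus V Φ M) ζ

/-- The matrix `Ξ`, the inverse of the Jacobian matrix of `Θ` at `ζ`. -/
def Xi (V : ℝ → ℝ) (Φ : ℝ → ℂ) (M : ℝ) (ζ : C2) : Matrix (Fin 2) (Fin 2) ℂ :=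
  (jacDet V Φ M ζ)⁻¹ •
    !![dz (ThetaMinus V Φ M) ζ, -dz (ThetaPlus V Φ M) ζ;
       -dw (ThetaMinus V Φ M) ζ, dw (ThetaPlus V Φ M) ζ]

/-- The first approximation `η - Ξ Θ(η)` of the root. -/
def newtonPoint (V : ℝ → ℝ) (Φ : ℝ → ℂ) (M : ℝ) (η : C2) : C2 :=
  η - WithLp.toLp 2 ((Xi V Φ M η).mulVec (WithLp.ofLp (Theta V Φ M η)))

/-- The closed ball `Ω_M` of radius `M⁻² e^{-k M}` about `η`. -/
def Omega (k M : ℝ) (η : C2) : Set C2 :=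
  Metric.closedBall η (1 / M ^ 2 * Real.exp (-(k * M)))

/-- `l` is a characteristic (Floquet) multiplier of `-ψ'' + Vper ψ = E ψ`. -/
def IsCharacteristicMultiplier (Vper : ℝ → ℝ) (E : ℝ) (l : ℝ) : Prop :=
  ∃ ψ : ℝ → ℂ, IsSolution Vper (E : ℂ) ψ ∧ ψ ≠ 0 ∧ ∀ x, ψ (x + 1) = (l : ℂ) * ψ x

/-- `κ` is positive and is the logarithm of the modulus of a real characteristic multiplier; the
product of the two multipliers is `1`, so this is the larger of the two moduli. -/
def IsFloquetExponent (Vper : ℝ → ℝ) (E κ : ℝ) : Prop :=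
  0 < κ ∧ ∃ l : ℝ, IsCharacteristicMultiplier Vper E l ∧ |l| = Real.exp κ

open scoped Classical in
/-- The truncated potential. -/
def Vtrunc (V : ℝ → ℝ) (M : ℝ) (x : ℝ) : ℝ := if |x| ≤ M then V x else 0

/-- `z` (with `Re z > 0`, `Im z < 0`) is a resonance of `-d²/dx² + W`, where `W` is bounded,
measurable and compactly supported: there is a resonant state, i.e. a nonzero outgoing solution
`ψ` of `-ψ'' + W ψ = z ψ`. As `W` may jump, `ψ` is `C¹` and the equation is written in integrated
form (equivalently, `ψ'` is locally absolutely continuous and the equation holds almost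
everywhere). -/
def IsResonance (W : ℝ → ℝ) (z : ℂ) : Prop :=
  0 < z.re ∧ z.im < 0 ∧
    ∃ ψ : ℝ → ℂ, ContDiff ℝ 1 ψ ∧ ψ ≠ 0 ∧
      (∀ x, deriv ψ x = deriv ψ 0 + ∫ t in (0 : ℝ)..x, ((W t : ℂ) - z) * ψ t) ∧
      ∃ (R : ℝ) (a b : ℂ),
        (∀ x, R < x → ψ x = a * Complex.exp (Complex.I * Complex.sqrt z * x)) ∧
        (∀ x, x < -R → ψ x = b * Complex.exp (-(Complex.I * Complex.sqrt z * x)))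

end TruncatedDefect

end

/-!
Let `φ` and `ψ` be real solutions for the energy `E`, where `φ` is a multiple of `Φ` and the
Wronskian is `1`. Square integrability and asymptotic periodicity give an exponential dichotomy:
`|φ|` decays and `|ψ|` grows like `e^{∓κ|x|}`. Variation of parameters about this pair, for the
solution `u_ζ` at energy `E + ε` with the data of `φ + s ψ` at `0`, shows that `Θ⁺` is
`θ⁺ (g₀(ε) + s g₁(ε))` with `θ⁺` of size `e^{κM}`, `g₁(0) = 1`, `g₀(0) = O(e^{-2κM})` and
`g₀'(0) ≈ -∫₀^∞ φ²`. By reflection `Θ⁻` has the same form, with `+∫_{-∞}^0 φ²` in place of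
`-∫₀^∞ φ²`. The two slopes have opposite signs, so the linear part of `(Θ⁺ / θ⁺, Θ⁻ / θ⁻)` is
invertible uniformly in `M`. The derivatives of `g₀` and `g₁` grow at most polynomially in `M`, so
Newton's method converges in a ball of radius `M⁻² e^{-kM}`; its first step has size `O(e^{-2κM})`,
and the error is quadratic in it, namely `O(M e^{-4κM})`. The root is a resonance because `u_ζ`
extends to an outgoing solution.
-/

noncomputable section

namespace TruncatedDefect

/-! ### Dyson series -/

theorem norm_integral_le_of_norm_le_pow {X : Type*} [NormedAddCommGroup X] [NormedSpace ℝ X]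
    {f : ℝ → X} {C : ℝ} {n : ℕ} {x : ℝ} (h : ∀ t, |t| ≤ |x| → ‖f t‖ ≤ C * |t| ^ n) :
    ‖∫ t in (0 : ℝ)..x, f t‖ ≤ C * (|x| ^ (n + 1) / (n + 1)) := by
  have hpow : ∫ t in Set.uIoc 0 x, C * |t| ^ n = C * (|x| ^ (n + 1) / (n + 1)) := by
    have := integral_pow_abs_sub_uIoc (a := (0 : ℝ)) (b := x) n
    simp only [sub_zero] at this
    rw [integral_const_mul, this]
  have hint : IntegrableOn (fun t : ℝ => C * |t| ^ n) (Set.uIoc 0 x) :=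
    (Continuous.integrableOn_uIcc (by fun_prop)).mono_set Set.uIoc_subset_uIcc
  rw [intervalIntegral.norm_intervalIntegral_eq, ← hpow]
  refine norm_integral_le_of_norm_le hint ?_
  filter_upwards [ae_restrict_mem measurableSet_uIoc] with t ht
  exact h t (by simpa using Set.abs_sub_left_of_mem_uIcc (Set.uIoc_subset_uIcc ht))

section Dyson

variable {𝕜 X : Type*} [RCLike 𝕜] [NormedAddCommGroup X] [NormedSpace 𝕜 X] [NormedSpace ℝ X]

/-- The iterated integrals `∫ A(t₁) ∫ A(t₂) ⋯ y₀`: the coefficient of `ε ^ n` in the solution of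
`y' = ε A y`, `y 0 = y₀`. -/
def dysonTerm (A : ℝ → X →L[𝕜] X) (y₀ : X) : ℕ → ℝ → X
  | 0, _ => y₀
  | n + 1, x => ∫ t in (0 : ℝ)..x, A t (dysonTerm A y₀ n t)

/-- The Dyson series: the solution of `y' = ε A y`, `y 0 = y₀`, as a power series in `ε`. -/
def dysonSeries (A : ℝ → X →L[𝕜] X) (y₀ : X) (ε : 𝕜) (x : ℝ) : X :=
  ∑' n, ε ^ n • dysonTerm A y₀ n x

variable {A : ℝ → X →L[𝕜] X} {y₀ : X}

theorem dysonTerm_at_zero {n : ℕ} (hn : n ≠ 0) : dysonTerm A y₀ n 0 = 0 := by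
  obtain ⟨n, rfl⟩ := Nat.exists_eq_succ_of_ne_zero hn
  exact intervalIntegral.integral_same

theorem dysonSeries_at_zero (ε : 𝕜) : dysonSeries A y₀ ε 0 = y₀ := by
  rw [dysonSeries, tsum_eq_single 0 fun n hn => by rw [dysonTerm_at_zero hn, smul_zero]]
  simp [dysonTerm]

theorem dysonSeries_zero (x : ℝ) : dysonSeries A y₀ (0 : 𝕜) x = y₀ := by
  rw [dysonSeries, tsum_eq_single 0 fun n hn => by simp [hn]]
  simp [dysonTerm]

theorem norm_dysonTerm_le {R L : ℝ} (hL : ∀ t, |t| ≤ R → ‖A t‖ ≤ L) (n : ℕ) {x : ℝ}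
    (hx : |x| ≤ R) : ‖dysonTerm A y₀ n x‖ ≤ ‖y₀‖ * ((L * |x|) ^ n / n.factorial) := by
  induction n generalizing x with
  | zero => simp [dysonTerm]
  | succ n ih =>
    have hrhs : ‖y₀‖ * ((L * |x|) ^ (n + 1) / (n + 1).factorial) =
        L * (‖y₀‖ * (L ^ n / n.factorial)) * (|x| ^ (n + 1) / (n + 1)) := by
      rw [Nat.factorial_succ]; push_cast; field_simp; ring
    rw [hrhs]
    refine norm_integral_le_of_norm_le_pow fun t ht => ?_
    have hL0 : 0 ≤ L := (norm_nonneg _).trans (hL t (ht.trans hx))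
    calc ‖A t (dysonTerm A y₀ n t)‖ ≤ ‖A t‖ * ‖dysonTerm A y₀ n t‖ := (A t).le_opNorm _
      _ ≤ L * (‖y₀‖ * ((L * |t|) ^ n / n.factorial)) := by
        gcongr
        exacts [hL t (ht.trans hx), ih (ht.trans hx)]
      _ = L * (‖y₀‖ * (L ^ n / n.factorial)) * |t| ^ n := by rw [mul_pow]; ring

theorem exists_norm_le_of_continuous {Y : Type*} [SeminormedAddCommGroup Y] {f : ℝ → Y}
    (hf : Continuous f) (R : ℝ) : ∃ L, ∀ t, |t| ≤ R → ‖f t‖ ≤ L := by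
  obtain ⟨L, hL⟩ := (isCompact_Icc (a := -R) (b := R)).exists_bound_of_continuousOn hf.continuousOn
  exact ⟨L, fun t ht => hL t (abs_le.1 ht)⟩

theorem exists_summable_norm_dysonTerm_le (hA : Continuous A) (y₀ : X) (R r : ℝ) :
    ∃ b : ℕ → ℝ, Summable b ∧ ∀ n x (ε : 𝕜), |x| ≤ R → ‖ε‖ ≤ r →
      ‖ε ^ n • dysonTerm A y₀ n x‖ ≤ b n := by
  obtain ⟨L, hL⟩ := exists_norm_le_of_continuous hA R
  refine ⟨fun n => ‖y₀‖ * ((r * (L * R)) ^ n / n.factorial),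
    (Real.summable_pow_div_factorial _).mul_left _, fun n x ε hx hε => ?_⟩
  have hL0 : 0 ≤ L := (norm_nonneg _).trans (hL x hx)
  have hr0 : 0 ≤ r := (norm_nonneg _).trans hε
  calc ‖ε ^ n • dysonTerm A y₀ n x‖ = ‖ε‖ ^ n * ‖dysonTerm A y₀ n x‖ := by
        rw [norm_smul, norm_pow]
    _ ≤ r ^ n * (‖y₀‖ * ((L * R) ^ n / n.factorial)) := by
        gcongr
        refine (norm_dysonTerm_le hL n hx).trans ?_
        gcongr
    _ = ‖y₀‖ * ((r * (L * R)) ^ n / n.factorial) := by rw [mul_pow r]; ring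

variable [CompleteSpace X]

theorem continuous_dysonTerm (hA : Continuous A) (n : ℕ) : Continuous (dysonTerm A y₀ n) := by
  induction n with
  | zero => exact continuous_const
  | succ n ih =>
    exact continuous_iff_continuousAt.2 fun x =>
      ((hA.clm_apply ih).integral_hasStrictDerivAt 0 x).hasDerivAt.continuousAt

theorem hasDerivAt_dysonTerm_succ (hA : Continuous A) (n : ℕ) (x : ℝ) :
    HasDerivAt (dysonTerm A y₀ (n + 1)) (A x (dysonTerm A y₀ n x)) x :=
  ((hA.clm_apply (continuous_dysonTerm hA n)).integral_hasStrictDerivAt 0 x).hasDerivAt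

theorem summable_dysonTerm (hA : Continuous A) (y₀ : X) (ε : 𝕜) (x : ℝ) :
    Summable fun n => ε ^ n • dysonTerm A y₀ n x := by
  obtain ⟨b, hb, h⟩ := exists_summable_norm_dysonTerm_le hA y₀ |x| ‖ε‖
  exact .of_norm_bounded hb fun n => h n x ε le_rfl le_rfl

theorem dysonSeries_eq_add_smul_tsum (hA : Continuous A) (y₀ : X) (ε : 𝕜) (x : ℝ) :
    dysonSeries A y₀ ε x = y₀ + ε • ∑' n, ε ^ n • dysonTerm A y₀ (n + 1) x := by
  rw [dysonSeries, (summable_dysonTerm hA y₀ ε x).tsum_eq_zero_add, ← tsum_const_smul'']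
  simp only [pow_zero, one_smul, pow_succ', mul_smul]
  rfl

theorem tsum_pow_smul_clm_apply_dysonTerm (hA : Continuous A) (y₀ : X) (ε : 𝕜) (x : ℝ) :
    ∑' n, ε ^ n • A x (dysonTerm A y₀ n x) = A x (dysonSeries A y₀ ε x) := by
  rw [dysonSeries, (A x).map_tsum (summable_dysonTerm hA y₀ ε x)]
  simp only [map_smul]

theorem hasDerivAt_dysonSeries [SMulCommClass ℝ 𝕜 X] (hA : Continuous A) (y₀ : X) (ε : 𝕜)
    (x : ℝ) : HasDerivAt (dysonSeries A y₀ ε) (ε • A x (dysonSeries A y₀ ε x)) x := by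
  obtain ⟨b, hb, hterm⟩ := exists_summable_norm_dysonTerm_le hA y₀ (|x| + 1) ‖ε‖
  obtain ⟨L, hL⟩ := exists_norm_le_of_continuous hA (|x| + 1)
  have htail : HasDerivAt (fun x => ∑' n, ε ^ n • dysonTerm A y₀ (n + 1) x)
      (∑' n, ε ^ n • A x (dysonTerm A y₀ n x)) x := by
    refine hasDerivAt_tsum_of_isPreconnected (t := Metric.ball 0 (|x| + 1)) (y₀ := 0)
      (hb.mul_left L) Metric.isOpen_ball (convex_ball _ _).isPreconnected
      (fun n y _ => (hasDerivAt_dysonTerm_succ hA n y).const_smul _) (fun n y hy => ?_)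
      (Metric.mem_ball_self (by positivity)) (by simp [dysonTerm_at_zero, summable_zero]) (by simp)
    have hy' : |y| ≤ |x| + 1 := by simpa using (Metric.mem_ball.1 hy).le
    rw [← map_smul]
    exact (A y).le_of_opNorm_le_of_le (hL y hy') (hterm n y ε hy' le_rfl)
  rw [← tsum_pow_smul_clm_apply_dysonTerm hA]
  exact ((htail.const_smul ε).const_add y₀).congr_of_eventuallyEq
    (.of_forall fun x => dysonSeries_eq_add_smul_tsum hA y₀ ε x)

end Dyson

section DysonAnalytic

variable {X : Type*} [NormedAddCommGroup X] [NormedSpace ℂ X] [CompleteSpace X]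
  {A : ℝ → X →L[ℂ] X}

theorem differentiable_dysonSeries (hA : Continuous A) (y₀ : X) (x : ℝ) :
    Differentiable ℂ fun ε => dysonSeries A y₀ ε x := by
  intro ε₀
  obtain ⟨b, hb, h⟩ := exists_summable_norm_dysonTerm_le hA y₀ |x| (‖ε₀‖ + 1)
  refine (Complex.differentiableOn_tsum_of_summable_norm hb (fun n => by fun_prop)
    (Metric.isOpen_ball (x := 0) (ε := ‖ε₀‖ + 1)) fun n ε hε => ?_).differentiableAt
    (Metric.isOpen_ball.mem_nhds (by simp))
  exact h n x ε le_rfl (by simpa using (Metric.mem_ball.1 hε).le)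

theorem hasDerivAt_dysonSeries_at_zero (hA : Continuous A) (y₀ : X) (x : ℝ) :
    HasDerivAt (fun ε => dysonSeries A y₀ ε x) (dysonTerm A y₀ 1 x) 0 := by
  obtain ⟨b, hb, h⟩ := exists_summable_norm_dysonTerm_le hA y₀ |x| (1 : ℝ)
  have hball : Metric.ball (0 : ℂ) 1 ∈ nhds 0 := Metric.ball_mem_nhds _ one_pos
  have htail : DifferentiableAt ℂ (fun ε : ℂ => ∑' n, ε ^ n • dysonTerm A y₀ (n + 1) x) 0 := by
    refine (Complex.differentiableOn_tsum_of_summable_norm ((summable_nat_add_iff 1).2 hb)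
      (fun n => by fun_prop) Metric.isOpen_ball fun n ε hε => ?_).differentiableAt hball
    have hε' : ‖ε‖ ≤ 1 := by simpa using (Metric.mem_ball.1 hε).le
    calc ‖ε ^ n • dysonTerm A y₀ (n + 1) x‖
        ≤ 1 * ‖dysonTerm A y₀ (n + 1) x‖ := by
          rw [norm_smul, norm_pow]; gcongr; exact pow_le_one₀ (norm_nonneg _) hε'
      _ ≤ b (n + 1) := by simpa using h (n + 1) x 1 le_rfl (by simp)
  have hvalue : ∑' n, (0 : ℂ) ^ n • dysonTerm A y₀ (n + 1) x = dysonTerm A y₀ 1 x := by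
    rw [tsum_eq_single 0 fun n hn => by simp [hn]]; simp
  simp only [dysonSeries_eq_add_smul_tsum hA]
  exact (((hasDerivAt_id' (0 : ℂ)).smul htail.hasDerivAt).const_add y₀).congr_deriv (by
    simp [hvalue])

end DysonAnalytic

/-! ### The equation `u'' = Q u` -/

/-- The first order form `u' = v`, `v' = Q u` of the equation `u'' = Q u` on the set `S`. The
derivative `v` is carried along so that initial data can be read off at a point. -/
def IsSolOn {𝕜 : Type*} [RCLike 𝕜] (S : Set ℝ) (Q u v : ℝ → 𝕜) : Prop :=
  ∀ x ∈ S, HasDerivAt u (v x) x ∧ HasDerivAt v (Q x * u x) x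

section IsSolOn

variable {𝕜 : Type*} [RCLike 𝕜] {Q u v f g : ℝ → 𝕜} {S : Set ℝ} {x₀ : ℝ}

theorem IsSolOn.mono {T : Set ℝ} (h : IsSolOn S Q u v) (hT : T ⊆ S) : IsSolOn T Q u v :=
  fun x hx => h x (hT hx)

theorem IsSolOn.congr {Q' : ℝ → 𝕜} (h : IsSolOn S Q u v) (hQ : Set.EqOn Q Q' S) :
    IsSolOn S Q' u v := fun x hx => hQ hx ▸ h x hx

theorem IsSolOn.continuous_fst (h : IsSolOn Set.univ Q u v) : Continuous u :=
  continuous_iff_continuousAt.2 fun x => (h x trivial).1.continuousAt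

theorem IsSolOn.continuous_snd (h : IsSolOn Set.univ Q u v) : Continuous v :=
  continuous_iff_continuousAt.2 fun x => (h x trivial).2.continuousAt

theorem IsSolOn.linearCombination (h : IsSolOn S Q u v) (h' : IsSolOn S Q f g) (a b : 𝕜) :
    IsSolOn S Q (fun x => a * u x + b * f x) (fun x => a * v x + b * g x) := fun x hx =>
  ⟨((h x hx).1.const_mul a).add ((h' x hx).1.const_mul b),
    (((h x hx).2.const_mul a).add ((h' x hx).2.const_mul b)).congr_deriv (by ring)⟩

theorem IsSolOn.const_mul (h : IsSolOn S Q u v) (a : 𝕜) :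
    IsSolOn S Q (fun x => a * u x) (fun x => a * v x) := by
  simpa using h.linearCombination h a 0

theorem IsSolOn.comp_add_const {T : Set ℝ} {Q' : ℝ → 𝕜} (h : IsSolOn S Q u v) (c : ℝ)
    (hT : ∀ x ∈ T, x + c ∈ S ∧ Q (x + c) = Q' x) :
    IsSolOn T Q' (fun x => u (x + c)) (fun x => v (x + c)) := fun x hx => by
  obtain ⟨hu, hv⟩ := h (x + c) (hT x hx).1
  exact ⟨hu.comp_add_const x c, by simpa [(hT x hx).2] using hv.comp_add_const x c⟩

theorem IsSolOn.comp_neg (h : IsSolOn Set.univ Q u v) :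
    IsSolOn Set.univ (fun x => Q (-x)) (fun x => u (-x)) (fun x => -v (-x)) := fun x _ => by
  obtain ⟨hu, hv⟩ := h (-x) trivial
  exact ⟨(hu.scomp x (hasDerivAt_neg x)).congr_deriv (by simp),
    (hv.scomp x (hasDerivAt_neg x)).neg.congr_deriv (by simp)⟩

theorem IsSolOn.wronskian_eq (h : IsSolOn S Q u v) (h' : IsSolOn S Q f g) (hS : IsOpen S)
    (hS' : IsPreconnected S) {x y : ℝ} (hx : x ∈ S) (hy : y ∈ S) :
    u x * g x - v x * f x = u y * g y - v y * f y := by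
  have hderiv : ∀ x ∈ S, HasDerivAt (fun x => u x * g x - v x * f x) 0 x := fun x hx =>
    (((h x hx).1.mul (h' x hx).2).sub ((h x hx).2.mul (h' x hx).1)).congr_deriv (by ring)
  exact hS.is_const_of_deriv_eq_zero hS'
    (fun x hx => (hderiv x hx).differentiableAt.differentiableWithinAt)
    (fun x hx => (hderiv x hx).deriv) hx hy

theorem exists_isSolOn (hQ : Continuous Q) (x₀ : ℝ) (a b : 𝕜) :
    ∃ u v : ℝ → 𝕜, IsSolOn Set.univ Q u v ∧ u x₀ = a ∧ v x₀ = b := by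
  set A : ℝ → 𝕜 × 𝕜 →L[𝕜] 𝕜 × 𝕜 := fun x =>
    (ContinuousLinearMap.snd 𝕜 𝕜 𝕜).prod (Q (x + x₀) • ContinuousLinearMap.fst 𝕜 𝕜 𝕜) with hA
  have hAcont : Continuous A := by
    refine continuous_clm_apply.2 fun y => ?_
    simp only [hA, ContinuousLinearMap.prod_apply, smul_apply]
    fun_prop
  have hsol : IsSolOn Set.univ (fun x => Q (x + x₀)) (fun x => (dysonSeries A (a, b) 1 x).1)
      (fun x => (dysonSeries A (a, b) 1 x).2) := fun x _ => by
    have h := hasDerivAt_dysonSeries hAcont (a, b) 1 x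
    rw [one_smul] at h
    exact ⟨h.fst, h.snd⟩
  exact ⟨_, _, hsol.comp_add_const (-x₀) fun x _ => ⟨trivial, by simp⟩,
    by simp [dysonSeries_at_zero], by simp [dysonSeries_at_zero]⟩

theorem IsSolOn.eq_of_eq_at (hQ : Continuous Q) (h : IsSolOn S Q u v) (h' : IsSolOn S Q f g)
    (hS : IsOpen S) (hS' : IsPreconnected S) (hx₀ : x₀ ∈ S) (hu : u x₀ = f x₀)
    (hv : v x₀ = g x₀) {x : ℝ} (hx : x ∈ S) : u x = f x ∧ v x = g x := by
  have hdiff := h.linearCombination h' 1 (-1)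
  have hwronskian : ∀ a b, (u x - f x) * b - (v x - g x) * a = 0 := fun a b => by
    obtain ⟨c, d, hcd, hc, hd⟩ := exists_isSolOn hQ x a b
    have := hdiff.wronskian_eq (hcd.mono (Set.subset_univ _)) hS hS' hx hx₀
    simp only [hc, hd, hu, hv] at this
    linear_combination this
  exact ⟨by linear_combination hwronskian 0 1, by linear_combination -hwronskian 1 0⟩

theorem IsSolOn.ne_zero (hQ : Continuous Q) (h : IsSolOn Set.univ Q u v)
    (h0 : u x₀ ≠ 0 ∨ v x₀ ≠ 0) (x : ℝ) : u x ≠ 0 ∨ v x ≠ 0 := by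
  by_contra! hx
  have := h.eq_of_eq_at hQ (h.const_mul 0) isOpen_univ isPreconnected_univ (Set.mem_univ x)
    (by simp [hx.1]) (by simp [hx.2]) (Set.mem_univ x₀)
  simp only [zero_mul] at this
  exact h0.elim (· this.1) (· this.2)

theorem IsSolOn.exists_ne_zero (h : IsSolOn S Q u v) (hS : IsOpen S) (hx₀ : x₀ ∈ S)
    (h0 : u x₀ ≠ 0 ∨ v x₀ ≠ 0) : ∃ x ∈ S, u x ≠ 0 := by
  by_contra! hzero
  have hev : u =ᶠ[nhds x₀] fun _ => 0 := by
    filter_upwards [hS.mem_nhds hx₀] with x hx using hzero x hx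
  have hv : v x₀ = 0 :=
    ((h x₀ hx₀).1.congr_of_eventuallyEq hev.symm).unique (hasDerivAt_const _ _)
  exact h0.elim (· (hzero x₀ hx₀)) (· hv)

theorem IsSolOn.exists_eq_const_mul (hQ : Continuous Q) (h : IsSolOn S Q u v)
    (h' : IsSolOn S Q f g) (hS : IsOpen S) (hS' : IsPreconnected S) (hx₀ : x₀ ∈ S)
    (hW : u x₀ * g x₀ - v x₀ * f x₀ = 0) (h0 : u x₀ ≠ 0 ∨ v x₀ ≠ 0) :
    ∃ c, ∀ x ∈ S, f x = c * u x ∧ g x = c * v x := by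
  obtain ⟨c, hf, hg⟩ : ∃ c, f x₀ = c * u x₀ ∧ g x₀ = c * v x₀ := by
    rcases h0 with hu | hv
    · exact ⟨f x₀ / u x₀, by field_simp, by field_simp; linear_combination hW⟩
    · exact ⟨g x₀ / v x₀, by field_simp; linear_combination -hW, by field_simp⟩
  exact ⟨c, fun x hx => h'.eq_of_eq_at hQ (h.const_mul c) hS hS' hx₀ hf hg hx⟩

end IsSolOn

section RealAndComplex

variable {Q : ℝ → ℝ} {S : Set ℝ}

theorem IsSolOn.re {u v : ℝ → ℂ} (h : IsSolOn S (fun x => (Q x : ℂ)) u v) :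
    IsSolOn S Q (fun x => (u x).re) (fun x => (v x).re) := fun x hx =>
  ⟨Complex.reCLM.hasFDerivAt.comp_hasDerivAt x (h x hx).1,
    (Complex.reCLM.hasFDerivAt.comp_hasDerivAt x (h x hx).2).congr_deriv (by simp)⟩

theorem IsSolOn.im {u v : ℝ → ℂ} (h : IsSolOn S (fun x => (Q x : ℂ)) u v) :
    IsSolOn S Q (fun x => (u x).im) (fun x => (v x).im) := fun x hx =>
  ⟨Complex.imCLM.hasFDerivAt.comp_hasDerivAt x (h x hx).1,
    (Complex.imCLM.hasFDerivAt.comp_hasDerivAt x (h x hx).2).congr_deriv (by simp)⟩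

theorem IsSolOn.ofReal {u v : ℝ → ℝ} (h : IsSolOn S Q u v) :
    IsSolOn S (fun x => (Q x : ℂ)) (fun x => (u x : ℂ)) (fun x => (v x : ℂ)) := fun x hx =>
  ⟨(h x hx).1.ofReal_comp, by simpa using (h x hx).2.ofReal_comp⟩

end RealAndComplex

section IsSolution

variable {V : ℝ → ℝ} {z : ℂ}

theorem IsSolution.isSolOn {u : ℝ → ℂ} (h : IsSolution V z u) :
    IsSolOn Set.univ (fun x => (V x : ℂ) - z) u (deriv u) := fun x _ => by
  obtain ⟨hu, heq⟩ := h
  have hu' : ContDiff ℝ 1 (deriv u) :=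
    (contDiff_succ_iff_deriv.1 (by simpa [one_add_one_eq_two] using hu)).2.2
  exact ⟨(hu.differentiable (by norm_num) x).hasDerivAt,
    ((hu'.differentiable (by norm_num) x).hasDerivAt).congr_deriv (by
      linear_combination -heq x)⟩

theorem IsSolOn.deriv_fst {u v : ℝ → ℂ} {Q : ℝ → ℂ} (h : IsSolOn Set.univ Q u v) :
    deriv u = v := funext fun x => (h x trivial).1.deriv

theorem IsSolOn.isSolution {u v : ℝ → ℂ} (hV : Continuous V)
    (h : IsSolOn Set.univ (fun x => (V x : ℂ) - z) u v) : IsSolution V z u := by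
  have hv' : deriv v = fun x => ((V x : ℂ) - z) * u x := funext fun x => (h x trivial).2.deriv
  have hu := h.continuous_fst
  have hv : ContDiff ℝ 1 v := by
    rw [contDiff_one_iff_deriv, hv']
    exact ⟨fun x => (h x trivial).2.differentiableAt, by fun_prop⟩
  refine ⟨?_, fun x => by rw [h.deriv_fst, hv']; ring⟩
  rw [← one_add_one_eq_two, contDiff_succ_iff_deriv, h.deriv_fst]
  exact ⟨fun x => (h x trivial).1.differentiableAt, by simp, hv⟩

theorem ivp_spec (hV : Continuous V) (z a b : ℂ) :
    IsSolution V z (ivp V z a b) ∧ ivp V z a b 0 = a ∧ deriv (ivp V z a b) 0 = b := by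
  obtain ⟨u, v, h, ha, hb⟩ := exists_isSolOn (Q := fun x => (V x : ℂ) - z) (by fun_prop) 0 a b
  exact Classical.epsilon_spec
    (p := fun u : ℝ → ℂ => IsSolution V z u ∧ u 0 = a ∧ deriv u 0 = b)
    ⟨u, h.isSolution hV, ha, by rw [h.deriv_fst, hb]⟩

theorem isSolOn_ivp (hV : Continuous V) (z a b : ℂ) :
    IsSolOn Set.univ (fun x => (V x : ℂ) - z) (ivp V z a b) (deriv (ivp V z a b)) :=
  (ivp_spec hV z a b).1.isSolOn

end IsSolution

/-! ### Square integrable solutions on a half line -/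

theorem integrableOn_Ioi_comp_add_const {f : ℝ → ℝ} {R c : ℝ} (hc : 0 ≤ c)
    (hf : IntegrableOn f (Set.Ioi R)) : IntegrableOn (fun x => f (x + c)) (Set.Ioi R) := by
  have h := (measurePreserving_add_right volume c).integrableOn_comp_preimage
    (measurableEmbedding_addRight c) (f := f) (s := Set.Ioi (R + c))
  simpa [Function.comp_def] using h.2 (hf.mono_set (Set.Ioi_subset_Ioi (by linarith)))

theorem setIntegral_Ioi_comp_add_const (f : ℝ → ℝ) (R c : ℝ) :
    ∫ x in Set.Ioi R, f (x + c) = ∫ x in Set.Ioi (R + c), f x := by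
  have h := (measurePreserving_add_right volume c).setIntegral_preimage_emb
    (measurableEmbedding_addRight c) f (Set.Ioi (R + c))
  simpa using h

theorem exists_abs_lt_of_integrableOn_sq {ι : Type*} [Finite ι] {f : ι → ℝ → ℝ} {R δ : ℝ}
    (hf : ∀ i, IntegrableOn (fun x => f i x ^ 2) (Set.Ioi R)) (hδ : 0 < δ) :
    ∃ x, R < x ∧ ∀ i, |f i x| < δ := by
  cases nonempty_fintype ι
  by_contra! hcon
  have hle : ∀ x ∈ Set.Ioi R, δ ^ 2 ≤ ∑ i, f i x ^ 2 := fun x hx => by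
    obtain ⟨i, hi⟩ := hcon x hx
    calc δ ^ 2 ≤ |f i x| ^ 2 := by gcongr
      _ = f i x ^ 2 := sq_abs _
      _ ≤ ∑ i, f i x ^ 2 :=
        Finset.single_le_sum (f := fun i => f i x ^ 2) (fun i _ => sq_nonneg _)
          (Finset.mem_univ i)
  have hconst : IntegrableOn (fun _ : ℝ => δ ^ 2) (Set.Ioi R) := by
    refine Integrable.mono' (integrable_finsetSum Finset.univ fun i _ => hf i)
      aestronglyMeasurable_const <|
      (ae_restrict_iff' measurableSet_Ioi).2 (.of_forall fun x hx => ?_)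
    rw [Real.norm_of_nonneg (sq_nonneg δ)]
    exact hle x hx
  rw [integrableOn_const_iff] at hconst
  simp [hδ.ne'] at hconst

section HalfLine

variable {Q f f' g g' : ℝ → ℝ} {S : Set ℝ} {R B : ℝ}

theorem IsSolOn.eq_add_integral (h : IsSolOn S Q f f') (hQ : ContinuousOn Q S) {x y : ℝ}
    (hxy : Set.uIcc x y ⊆ S) :
    f y = f x + (y - x) * f' x + ∫ t in x..y, (y - t) * (Q t * f t) := by
  have hf : ContinuousOn f (Set.uIcc x y) := fun t ht =>
    (h t (hxy ht)).1.continuousAt.continuousWithinAt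
  have hderiv : ∀ t ∈ Set.uIcc x y,
      HasDerivAt (fun t => f t + (y - t) * f' t) ((y - t) * (Q t * f t)) t := fun t ht =>
    ((h t (hxy ht)).1.add (((hasDerivAt_id t).const_sub y).mul (h t (hxy ht)).2)).congr_deriv
      (by simp)
  rw [intervalIntegral.integral_eq_sub_of_hasDerivAt hderiv
    (ContinuousOn.mul (by fun_prop) ((hQ.mono hxy).mul hf)).intervalIntegrable]
  ring

theorem abs_integral_mul_le_of_sq_integrable (hB : ∀ x, R < x → |Q x| ≤ B)
    (hi : IntegrableOn (fun x => f x ^ 2) (Set.Ioi R)) {x : ℝ} (hx : R < x) :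
    |∫ t in x..(x + 1), (x + 1 - t) * (Q t * f t)| ≤ B + B * ∫ t in Set.Ioi R, f t ^ 2 := by
  have hB0 : 0 ≤ B := (abs_nonneg _).trans (hB x hx)
  have hsub : Set.Ioc x (x + 1) ⊆ Set.Ioi R := fun t ht => hx.trans ht.1
  have hsq : IntervalIntegrable (fun t => f t ^ 2) volume x (x + 1) :=
    (intervalIntegrable_iff_integrableOn_Ioc_of_le (by linarith)).2 (hi.mono_set hsub)
  have hpoint : ∀ t ∈ Set.Ioc x (x + 1),
      ‖(x + 1 - t) * (Q t * f t)‖ ≤ B + B * f t ^ 2 := fun t ht => by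
    have h1 : |x + 1 - t| ≤ 1 := abs_le.2 ⟨by linarith [ht.2], by linarith [ht.1]⟩
    have h2 : |f t| ≤ 1 + f t ^ 2 := by
      rw [← sq_abs (f t)]
      nlinarith [sq_nonneg (|f t| - 1), abs_nonneg (f t)]
    rw [Real.norm_eq_abs, abs_mul, abs_mul]
    calc |x + 1 - t| * (|Q t| * |f t|) ≤ 1 * (B * (1 + f t ^ 2)) := by
          gcongr
          exact hB t (hsub ht)
      _ = B + B * f t ^ 2 := by ring
  calc |∫ t in x..(x + 1), (x + 1 - t) * (Q t * f t)|
      ≤ ∫ t in x..(x + 1), (B + B * f t ^ 2) :=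
        intervalIntegral.norm_integral_le_of_norm_le (by linarith) (.of_forall hpoint)
          (intervalIntegrable_const.add (hsq.const_mul B))
    _ = B + B * ∫ t in Set.Ioc x (x + 1), f t ^ 2 := by
        rw [intervalIntegral.integral_add intervalIntegrable_const (hsq.const_mul B),
          intervalIntegral.integral_const_mul, intervalIntegral.integral_const,
          intervalIntegral.integral_of_le (by linarith), add_sub_cancel_left, one_smul]
    _ ≤ B + B * ∫ t in Set.Ioi R, f t ^ 2 := by
        have := setIntegral_mono_set hi (.of_forall fun t => sq_nonneg _) hsub.eventuallyLE
        gcongr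

theorem IsSolOn.abs_snd_le_of_sq_integrable (h : IsSolOn (Set.Ioi R) Q f f')
    (hQ : ContinuousOn Q (Set.Ioi R)) (hB : ∀ x, R < x → |Q x| ≤ B)
    (hi : IntegrableOn (fun x => f x ^ 2) (Set.Ioi R)) {x : ℝ} (hx : R < x) :
    |f' x| ≤ |f (x + 1)| + |f x| + (B + B * ∫ t in Set.Ioi R, f t ^ 2) := by
  have hsub : Set.uIcc x (x + 1) ⊆ Set.Ioi R := fun t ht => by
    rw [Set.uIcc_of_le (by linarith)] at ht
    exact hx.trans_le ht.1
  have htaylor := h.eq_add_integral hQ hsub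
  have hint := abs_integral_mul_le_of_sq_integrable hB hi hx
  calc |f' x| = |f (x + 1) - f x - ∫ t in x..(x + 1), (x + 1 - t) * (Q t * f t)| := by
        congr 1
        linear_combination -htaylor
    _ ≤ |f (x + 1)| + |f x| + |∫ t in x..(x + 1), (x + 1 - t) * (Q t * f t)| :=
        (abs_sub _ _).trans (add_le_add_left (abs_sub _ _) _)
    _ ≤ _ := by gcongr

theorem IsSolOn.wronskian_eq_zero_of_sq_integrable (hf : IsSolOn (Set.Ioi R) Q f f')
    (hg : IsSolOn (Set.Ioi R) Q g g') (hQ : ContinuousOn Q (Set.Ioi R))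
    (hB : ∀ x, R < x → |Q x| ≤ B) (hfi : IntegrableOn (fun x => f x ^ 2) (Set.Ioi R))
    (hgi : IntegrableOn (fun x => g x ^ 2) (Set.Ioi R)) {x : ℝ} (hx : R < x) :
    f x * g' x - f' x * g x = 0 := by
  obtain ⟨C, hCf, hCg⟩ : ∃ C, (B + B * ∫ t in Set.Ioi R, f t ^ 2) ≤ C ∧
    (B + B * ∫ t in Set.Ioi R, g t ^ 2) ≤ C := ⟨_, le_max_left _ _, le_max_right _ _⟩
  have hC : 0 ≤ C :=
    (abs_nonneg _).trans ((abs_integral_mul_le_of_sq_integrable hB hfi hx).trans hCf)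
  refine abs_nonpos_iff.1 (le_of_forall_pos_le_add fun ε hε => ?_)
  set δ := min 1 (ε / (2 * (2 + C)))
  have hδ : 0 < δ := by positivity
  obtain ⟨y, hy, hsmall⟩ := exists_abs_lt_of_integrableOn_sq
    (f := ![f, g, fun x => f (x + 1), fun x => g (x + 1)]) (R := R) (by
      simp only [Fin.forall_fin_succ, Matrix.cons_val_zero, Matrix.cons_val_succ,
        IsEmpty.forall_iff, and_true]
      exact ⟨hfi, hgi, integrableOn_Ioi_comp_add_const zero_le_one hfi,
        integrableOn_Ioi_comp_add_const zero_le_one hgi⟩) hδ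
  simp only [Fin.forall_fin_succ, Matrix.cons_val_zero, Matrix.cons_val_succ, IsEmpty.forall_iff,
    and_true] at hsmall
  obtain ⟨hfy, hgy, hfy₁, hgy₁⟩ := hsmall
  have hδ1 : δ ≤ 1 := min_le_left _ _
  have hf'y := hf.abs_snd_le_of_sq_integrable hQ hB hfi hy
  have hg'y := hg.abs_snd_le_of_sq_integrable hQ hB hgi hy
  rw [hf.wronskian_eq hg isOpen_Ioi isPreconnected_Ioi hx hy, zero_add]
  calc |f y * g' y - f' y * g y| ≤ |f y| * |g' y| + |f' y| * |g y| := by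
        rw [← abs_mul, ← abs_mul]
        exact abs_sub _ _
    _ ≤ δ * (2 + C) + (2 + C) * δ := by
        gcongr
        exacts [by linarith, by linarith]
    _ = δ * (2 * (2 + C)) := by ring
    _ ≤ ε / (2 * (2 + C)) * (2 * (2 + C)) := by
        gcongr
        exact min_le_right _ _
    _ = ε := by field_simp

end HalfLine

/-! ### Floquet solutions -/

/-- The Floquet condition with multiplier `μ` and period `1`, required only for `x ∈ S` so that
it can be imposed near infinity. -/
def IsFloquetOn (S : Set ℝ) (μ : ℝ) (f : ℝ → ℝ) : Prop := ∀ x ∈ S, f (x + 1) = μ * f x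

section IsFloquetOn

variable {f : ℝ → ℝ} {μ R : ℝ}

theorem IsFloquetOn.add_natCast (h : IsFloquetOn (Set.Ioi R) μ f) {x : ℝ} (hx : R < x) (n : ℕ) :
    f (x + n) = μ ^ n * f x := by
  induction n with
  | zero => simp
  | succ n ih =>
    have hxn : R < x + n := hx.trans_le (by simp)
    rw [Nat.cast_succ, ← add_assoc, h _ hxn, ih, pow_succ]
    ring

theorem IsFloquetOn.isBigO_exp (h : IsFloquetOn (Set.Ioi R) μ f) (hf : Continuous f) (hμ : μ ≠ 0)
    (a : ℝ) : f =O[Filter.principal (Set.Ici a)] fun x => Real.exp (x * Real.log |μ|) := by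
  set b := max a R + 1
  obtain ⟨C, hC⟩ := (isCompact_Icc (a := a) (b := b + 1)).exists_bound_of_continuousOn
    (f := fun y => f y * Real.exp (-(y * Real.log |μ|))) (by fun_prop)
  refine Asymptotics.isBigO_principal.2 ⟨C, fun x hx => ?_⟩
  obtain ⟨n, y, hy, hxy, hfx⟩ : ∃ (n : ℕ) (y : ℝ), y ∈ Set.Icc a (b + 1) ∧ x = y + n ∧
      f x = μ ^ n * f y := by
    have ha : a < b := by simp only [b]; linarith [le_max_left a R]
    have hR : R < b := by simp only [b]; linarith [le_max_right a R]
    rcases le_or_gt x b with hxb | hxb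
    · exact ⟨0, x, ⟨hx, by linarith⟩, by simp, by simp⟩
    · have hle := Nat.floor_le (sub_nonneg.2 hxb.le)
      have hlt := Nat.lt_floor_add_one (x - b)
      refine ⟨⌊x - b⌋₊, x - ⌊x - b⌋₊, ⟨by linarith, by linarith⟩, by ring, ?_⟩
      rw [← h.add_natCast (by linarith), sub_add_cancel]
  have hexp : Real.exp (x * Real.log |μ|) = |μ| ^ n * Real.exp (y * Real.log |μ|) := by
    rw [hxy, add_mul, Real.exp_add, Real.exp_nat_mul, Real.exp_log (abs_pos.2 hμ), mul_comm]
  have hy := hC y hy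
  rw [norm_mul, Real.norm_of_nonneg (Real.exp_pos _).le, Real.exp_neg,
    mul_inv_le_iff₀ (Real.exp_pos _)] at hy
  rw [Real.norm_of_nonneg (Real.exp_pos _).le, hexp, hfx, norm_mul, norm_pow, Real.norm_eq_abs μ]
  calc |μ| ^ n * ‖f y‖ ≤ |μ| ^ n * (C * Real.exp (y * Real.log |μ|)) := by gcongr
    _ = _ := by ring

theorem exists_abs_le_of_eventually_periodic (hf : Continuous f)
    (hper : ∀ x, R < x → f (x + 1) = f x) : ∃ B, ∀ x, R < x → |f x| ≤ B := by
  have h : IsFloquetOn (Set.Ioi R) 1 f := fun x hx => by rw [hper x hx, one_mul]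
  obtain ⟨B, hB⟩ := Asymptotics.isBigO_principal.1 (h.isBigO_exp hf one_ne_zero R)
  exact ⟨B, fun x hx => by simpa using hB x (Set.mem_Ici.2 (le_of_lt hx))⟩

theorem IsFloquetOn.abs_lt_one_of_sq_integrable (h : IsFloquetOn (Set.Ioi R) μ f)
    (hf : Continuous f) (hi : IntegrableOn (fun x => f x ^ 2) (Set.Ioi R)) {x₀ : ℝ}
    (hx₀ : x₀ ∈ Set.Ioo R (R + 1)) (h0 : f x₀ ≠ 0) : |μ| < 1 := by
  have hscale : ∫ x in Set.Ioi (R + 1), f x ^ 2 = μ ^ 2 * ∫ x in Set.Ioi R, f x ^ 2 := by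
    rw [← setIntegral_Ioi_comp_add_const, ← integral_const_mul]
    exact setIntegral_congr_fun measurableSet_Ioi fun x hx => by simp only [h x hx, mul_pow]
  have hsplit := intervalIntegral.integral_interval_add_Ioi hi
    (hi.mono_set (Set.Ioi_subset_Ioi (le_add_of_nonneg_right zero_le_one)))
  have hpos : 0 < ∫ x in R..(R + 1), f x ^ 2 :=
    intervalIntegral.integral_pos (by linarith) (by fun_prop) (fun x _ => sq_nonneg _)
      ⟨x₀, Set.Ioo_subset_Icc_self hx₀, by positivity⟩
  have hnonneg : 0 ≤ ∫ x in Set.Ioi R, f x ^ 2 := integral_nonneg fun x => sq_nonneg _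
  rw [hscale] at hsplit
  rw [← sq_lt_one_iff_abs_lt_one]
  by_contra! hμ
  nlinarith

theorem IsFloquetOn.comp_neg (h : IsFloquetOn Set.univ μ f) (hμ : μ ≠ 0) :
    IsFloquetOn Set.univ μ⁻¹ fun x => f (-x) := fun x _ => by
  have hx := h (-(x + 1)) trivial
  rw [show -(x + 1) + 1 = -x by ring] at hx
  simp only [hx, inv_mul_cancel_left₀ hμ]

end IsFloquetOn

section Multipliers

variable {Q F F' G G' : ℝ → ℝ} {S : Set ℝ} {μ ν ρ : ℝ}

theorem IsSolOn.isFloquetOn_snd (h : IsSolOn S Q F F') (hS : IsOpen S)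
    (hS1 : ∀ x ∈ S, x + 1 ∈ S) (hF : IsFloquetOn S μ F) : IsFloquetOn S μ F' := fun x hx => by
  have hev : (fun x => F (x + 1)) =ᶠ[nhds x] fun x => μ * F x := by
    filter_upwards [hS.mem_nhds hx] with y hy using hF y hy
  exact ((h (x + 1) (hS1 x hx)).1.comp_add_const x 1).unique
    (((h x hx).1.const_mul μ).congr_of_eventuallyEq hev)

theorem IsSolOn.isBigO_exp (h : IsSolOn Set.univ Q F F') (hF : IsFloquetOn (Set.Ioi ρ) μ F)
    (hμ : μ ≠ 0) (a : ℝ) : (fun x => (F x, F' x)) =O[Filter.principal (Set.Ici a)]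
      fun x => Real.exp (x * Real.log |μ|) :=
  (hF.isBigO_exp h.continuous_fst hμ a).prod_left
    (((h.mono (Set.subset_univ _)).isFloquetOn_snd isOpen_Ioi
      (fun x hx => lt_trans hx (lt_add_one x)) hF).isBigO_exp h.continuous_snd hμ a)

theorem IsSolOn.mul_eq_one_of_isFloquetOn (hF : IsSolOn Set.univ Q F F')
    (hG : IsSolOn Set.univ Q G G') (hQ : Continuous Q) {x₀ : ℝ} (hF0 : F x₀ ≠ 0 ∨ F' x₀ ≠ 0)
    (hG0 : G ≠ 0) (hμ : IsFloquetOn Set.univ μ F) (hν : IsFloquetOn Set.univ ν G)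
    (hne : μ ≠ ν) : μ * ν = 1 := by
  have hμ' := hF.isFloquetOn_snd isOpen_univ (fun _ _ => trivial) hμ x₀ trivial
  have hν' := hG.isFloquetOn_snd isOpen_univ (fun _ _ => trivial) hν x₀ trivial
  have hW := hF.wronskian_eq hG isOpen_univ isPreconnected_univ (x := x₀ + 1) (y := x₀) trivial
    trivial
  rw [hμ x₀ trivial, hμ', hν x₀ trivial, hν'] at hW
  suffices F x₀ * G' x₀ - F' x₀ * G x₀ ≠ 0 from
    mul_right_cancel₀ this (by linear_combination hW)
  intro hW0
  obtain ⟨c, hc⟩ := hF.exists_eq_const_mul hQ hG isOpen_univ isPreconnected_univ trivial hW0 hF0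
  obtain ⟨x, hx⟩ := Function.ne_iff.1 hG0
  refine hne (mul_right_cancel₀ hx ?_)
  rw [← hν x trivial, (hc (x + 1) trivial).1, hμ x trivial, (hc x trivial).1]
  ring

theorem IsSolOn.exists_floquet_extension {f f' : ℝ → ℝ} (hf : IsSolOn (Set.Ioi ρ) Q f f')
    (hQ : Continuous Q) (hper : ∀ x, Q (x + 1) = Q x) (hμ : IsFloquetOn (Set.Ioi ρ) μ f) :
    ∃ F F' : ℝ → ℝ, IsSolOn Set.univ Q F F' ∧ IsFloquetOn Set.univ μ F ∧
      Set.EqOn F f (Set.Ioi ρ) := by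
  have hx₀ : ρ + 1 ∈ Set.Ioi ρ := lt_add_one ρ
  have hstep : ∀ x ∈ Set.Ioi ρ, x + 1 ∈ Set.Ioi ρ := fun x hx => lt_trans hx (lt_add_one x)
  have hμ' := hf.isFloquetOn_snd isOpen_Ioi hstep hμ
  obtain ⟨F, F', hF, hFx₀, hF'x₀⟩ := exists_isSolOn hQ (ρ + 1) (f (ρ + 1)) (f' (ρ + 1))
  have heq : ∀ x ∈ Set.Ioi ρ, F x = f x ∧ F' x = f' x := fun x hx =>
    (hF.mono (Set.subset_univ _)).eq_of_eq_at hQ hf isOpen_Ioi isPreconnected_Ioi hx₀ hFx₀ hF'x₀ hx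
  have hF1 : IsSolOn Set.univ Q (fun x => F (x + 1)) (fun x => F' (x + 1)) :=
    hF.comp_add_const 1 fun x _ => ⟨trivial, hper x⟩
  refine ⟨F, F', hF, fun x _ => ?_, fun x hx => (heq x hx).1⟩
  refine (hF1.eq_of_eq_at hQ (hF.const_mul μ) isOpen_univ isPreconnected_univ
    (Set.mem_univ (ρ + 1)) ?_ ?_ (Set.mem_univ x)).1
  · rw [(heq _ (hstep _ hx₀)).1, hFx₀, hμ _ hx₀]
  · rw [(heq _ (hstep _ hx₀)).2, hF'x₀, hμ' _ hx₀]

theorem IsSolOn.exists_isFloquetOn_of_sq_integrable (h : IsSolOn Set.univ Q F F')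
    (hQ : Continuous Q) (hper : ∀ x, ρ < x → Q (x + 1) = Q x)
    (h0 : ∀ x, F x ≠ 0 ∨ F' x ≠ 0) (hi : IntegrableOn (fun x => F x ^ 2) (Set.Ioi ρ)) :
    ∃ l, l ≠ 0 ∧ |l| < 1 ∧ IsFloquetOn (Set.Ioi ρ) l F := by
  obtain ⟨B, hB⟩ := exists_abs_le_of_eventually_periodic hQ hper
  have hI : IsSolOn (Set.Ioi ρ) Q F F' := h.mono (Set.subset_univ _)
  have hI1 : IsSolOn (Set.Ioi ρ) Q (fun x => F (x + 1)) (fun x => F' (x + 1)) :=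
    h.comp_add_const 1 fun x hx => ⟨trivial, hper x hx⟩
  have hx₀ : ρ + 1 ∈ Set.Ioi ρ := lt_add_one ρ
  obtain ⟨l, hl⟩ := hI.exists_eq_const_mul hQ hI1 isOpen_Ioi isPreconnected_Ioi hx₀
    (hI.wronskian_eq_zero_of_sq_integrable hI1 hQ.continuousOn hB hi
      (integrableOn_Ioi_comp_add_const zero_le_one hi) hx₀) (h0 _)
  have hfloquet : IsFloquetOn (Set.Ioi ρ) l F := fun x hx => (hl x hx).1
  have hIoo : IsSolOn (Set.Ioo ρ (ρ + 1)) Q F F' := h.mono (Set.subset_univ _)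
  obtain ⟨x, hx, hFx⟩ := hIoo.exists_ne_zero isOpen_Ioo
    (x₀ := ρ + 1 / 2) ⟨by linarith, by linarith⟩ (h0 _)
  refine ⟨l, ?_, hfloquet.abs_lt_one_of_sq_integrable h.continuous_fst hi hx hFx, hfloquet⟩
  rintro rfl
  obtain ⟨y, hy, hFy⟩ := (h.mono (Set.subset_univ (Set.Ioi (ρ + 1)))).exists_ne_zero isOpen_Ioi
    (Set.mem_Ioi.2 (lt_add_one (ρ + 1))) (h0 _)
  have hFy0 := hfloquet (y - 1) (Set.mem_Ioi.2 (lt_sub_iff_add_lt.2 hy))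
  rw [sub_add_cancel, zero_mul] at hFy0
  exact hFy hFy0

end Multipliers

/-! ### Exponential dichotomies -/

/-- A pair of solutions of `u'' = Q u` on `ℝ`, given with their derivatives, of Wronskian `1`. -/
structure IsFundamentalPair (Q φ φ' ψ ψ' : ℝ → ℝ) : Prop where
  fst : IsSolOn Set.univ Q φ φ'
  snd : IsSolOn Set.univ Q ψ ψ'
  wronskian : ∀ x, φ x * ψ' x - φ' x * ψ x = 1

/-- A fundamental pair whose first member decays like `e^{-κ x}` and whose second member grows at
most like `e^{κ x}` on `[0, ∞)`, both together with their derivatives. -/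
structure IsDichotomy (Q φ φ' ψ ψ' : ℝ → ℝ) (κ C : ℝ) : Prop
    extends IsFundamentalPair Q φ φ' ψ ψ' where
  pos : 0 < C
  abs_fst_le : ∀ x, 0 ≤ x → |φ x| ≤ C * Real.exp (-(κ * x))
  abs_fst_deriv_le : ∀ x, 0 ≤ x → |φ' x| ≤ C * Real.exp (-(κ * x))
  abs_snd_le : ∀ x, 0 ≤ x → |ψ x| ≤ C * Real.exp (κ * x)
  abs_snd_deriv_le : ∀ x, 0 ≤ x → |ψ' x| ≤ C * Real.exp (κ * x)

section Dichotomy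

variable {Q φ φ' ψ ψ' : ℝ → ℝ} {κ C ρ l d : ℝ}

theorem IsFundamentalPair.of_eq_at (hφ : IsSolOn Set.univ Q φ φ') (hψ : IsSolOn Set.univ Q ψ ψ')
    {x₀ : ℝ} (h : φ x₀ * ψ' x₀ - φ' x₀ * ψ x₀ = 1) : IsFundamentalPair Q φ φ' ψ ψ' where
  fst := hφ
  snd := hψ
  wronskian _ := (hφ.wronskian_eq hψ isOpen_univ isPreconnected_univ trivial trivial).trans h

theorem IsFundamentalPair.fst_ne_zero (h : IsFundamentalPair Q φ φ' ψ ψ') (x : ℝ) :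
    φ x ≠ 0 ∨ φ' x ≠ 0 := by
  by_contra! h0
  simpa [h0.1, h0.2] using h.wronskian x

theorem IsFundamentalPair.reflect (h : IsFundamentalPair Q φ φ' ψ ψ') :
    IsFundamentalPair (fun x => Q (-x)) (fun x => φ (-x)) (fun x => -φ' (-x)) (fun x => -ψ (-x))
      (fun x => ψ' (-x)) where
  fst := h.fst.comp_neg
  snd := by simpa using h.snd.comp_neg.const_mul (-1)
  wronskian x := by linear_combination h.wronskian (-x)

theorem IsFundamentalPair.exists_isFloquetOn_snd (h : IsFundamentalPair Q φ φ' ψ ψ')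
    (hQ : Continuous Q) (hper : ∀ x, ρ < x → Q (x + 1) = Q x) (hl0 : l ≠ 0) (hl1 : |l| < 1)
    (hφ : IsFloquetOn (Set.Ioi ρ) l φ) :
    ∃ d, IsFloquetOn (Set.Ioi ρ) l⁻¹ fun x => ψ x + d * φ x := by
  have hφI : IsSolOn (Set.Ioi ρ) Q φ φ' := h.fst.mono (Set.subset_univ _)
  have hφ' := hφI.isFloquetOn_snd isOpen_Ioi (fun x hx => lt_trans hx (lt_add_one x)) hφ
  have hψ1 : IsSolOn (Set.Ioi ρ) Q (fun x => ψ (x + 1)) (fun x => ψ' (x + 1)) :=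
    h.snd.comp_add_const 1 fun x hx => ⟨trivial, hper x hx⟩
  have hdiff := hψ1.linearCombination (h.snd.mono (Set.subset_univ _)) 1 (-l⁻¹)
  have hx₀ : ρ + 1 ∈ Set.Ioi ρ := lt_add_one ρ
  obtain ⟨c, hc⟩ := hφI.exists_eq_const_mul hQ hdiff isOpen_Ioi isPreconnected_Ioi hx₀ (by
    have h1 := h.wronskian (ρ + 1 + 1)
    rw [hφ _ hx₀, hφ' _ hx₀] at h1
    field_simp
    linear_combination h1 - h.wronskian (ρ + 1)) (h.fst_ne_zero _)
  have hll : l⁻¹ - l ≠ 0 := fun hll => by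
    have hsq : l ^ 2 = 1 := by
      field_simp at hll
      linear_combination -hll
    exact (sq_lt_one_iff_abs_lt_one l).2 hl1 |>.ne hsq
  refine ⟨c / (l⁻¹ - l), fun x hx => ?_⟩
  have hcd : c / (l⁻¹ - l) * (l⁻¹ - l) = c := div_mul_cancel₀ c hll
  simp only [hφ x hx]
  linear_combination (hc x hx).1 - φ x * hcd

theorem IsFundamentalPair.exists_isDichotomy_of_isBigO (h : IsFundamentalPair Q φ φ' ψ ψ')
    (hφ : (fun x => (φ x, φ' x)) =O[Filter.principal (Set.Ici 0)] fun x => Real.exp (-(κ * x)))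
    (hψ : (fun x => (ψ x, ψ' x)) =O[Filter.principal (Set.Ici 0)] fun x => Real.exp (κ * x)) :
    ∃ C, IsDichotomy Q φ φ' ψ ψ' κ C := by
  obtain ⟨A, hA, hφA⟩ := hφ.exists_pos
  obtain ⟨B, -, hψB⟩ := hψ.exists_pos
  have hdecay : ∀ x, 0 ≤ x → ‖(φ x, φ' x)‖ ≤ max A B * Real.exp (-(κ * x)) := fun x hx => by
    refine (Asymptotics.isBigOWith_principal.1 hφA x hx).trans ?_
    rw [Real.norm_of_nonneg (Real.exp_pos _).le]
    gcongr
    exact le_max_left _ _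
  have hgrowth : ∀ x, 0 ≤ x → ‖(ψ x, ψ' x)‖ ≤ max A B * Real.exp (κ * x) := fun x hx => by
    refine (Asymptotics.isBigOWith_principal.1 hψB x hx).trans ?_
    rw [Real.norm_of_nonneg (Real.exp_pos _).le]
    gcongr
    exact le_max_right _ _
  exact ⟨max A B, h, hA.trans_le (le_max_left _ _), fun x hx => (norm_fst_le _).trans (hdecay x hx),
    fun x hx => (norm_snd_le _).trans (hdecay x hx),
    fun x hx => (norm_fst_le _).trans (hgrowth x hx),
    fun x hx => (norm_snd_le _).trans (hgrowth x hx)⟩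

theorem IsFundamentalPair.exists_isDichotomy (h : IsFundamentalPair Q φ φ' ψ ψ') (hl0 : l ≠ 0)
    (hl1 : |l| < 1) (hφ : IsFloquetOn (Set.Ioi ρ) l φ)
    (hψ : IsFloquetOn (Set.Ioi ρ) l⁻¹ fun x => ψ x + d * φ x) :
    ∃ C, IsDichotomy Q φ φ' ψ ψ' (-Real.log |l|) C := by
  have hχ : IsSolOn Set.univ Q (fun x => ψ x + d * φ x) fun x => ψ' x + d * φ' x := by
    simpa using h.snd.linearCombination h.fst 1 d
  have hdecay : (fun x => (φ x, φ' x)) =O[Filter.principal (Set.Ici 0)]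
      fun x => Real.exp (-(-Real.log |l| * x)) := by
    simpa [mul_comm] using h.fst.isBigO_exp hφ hl0 0
  have hgrowth : (fun x => (ψ x + d * φ x, ψ' x + d * φ' x)) =O[Filter.principal (Set.Ici 0)]
      fun x => Real.exp (-Real.log |l| * x) := by
    simpa [mul_comm] using hχ.isBigO_exp hψ (inv_ne_zero hl0) 0
  have hle : (fun x => Real.exp (-(-Real.log |l| * x))) =O[Filter.principal (Set.Ici 0)]
      fun x => Real.exp (-Real.log |l| * x) := by
    have hlog : Real.log |l| < 0 := Real.log_neg (abs_pos.2 hl0) hl1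
    refine Asymptotics.isBigO_principal.2 ⟨1, fun x hx => ?_⟩
    rw [Real.norm_of_nonneg (Real.exp_pos _).le, Real.norm_of_nonneg (Real.exp_pos _).le, one_mul,
      Real.exp_le_exp]
    nlinarith [Set.mem_Ici.1 hx]
  refine h.exists_isDichotomy_of_isBigO hdecay ?_
  simpa using hgrowth.sub ((hdecay.trans hle).const_smul_left d)

theorem IsFundamentalPair.exists_isDichotomy_of_sq_integrable
    (h : IsFundamentalPair Q φ φ' ψ ψ') (hQ : Continuous Q)
    (hper : ∀ x, ρ < x → Q (x + 1) = Q x) (hi : IntegrableOn (fun x => φ x ^ 2) (Set.Ioi ρ)) :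
    ∃ l C, l ≠ 0 ∧ |l| < 1 ∧ IsFloquetOn (Set.Ioi ρ) l φ ∧
      IsDichotomy Q φ φ' ψ ψ' (-Real.log |l|) C := by
  obtain ⟨l, hl0, hl1, hφ⟩ := h.fst.exists_isFloquetOn_of_sq_integrable hQ hper h.fst_ne_zero hi
  obtain ⟨d, hψ⟩ := h.exists_isFloquetOn_snd hQ hper hl0 hl1 hφ
  obtain ⟨C, hC⟩ := h.exists_isDichotomy hl0 hl1 hφ hψ
  exact ⟨l, C, hl0, hl1, hφ, hC⟩

theorem IsDichotomy.mono {D : ℝ} (h : IsDichotomy Q φ φ' ψ ψ' κ C) (hCD : C ≤ D) :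
    IsDichotomy Q φ φ' ψ ψ' κ D where
  toIsFundamentalPair := h.toIsFundamentalPair
  pos := h.pos.trans_le hCD
  abs_fst_le x hx := (h.abs_fst_le x hx).trans (by gcongr)
  abs_fst_deriv_le x hx := (h.abs_fst_deriv_le x hx).trans (by gcongr)
  abs_snd_le x hx := (h.abs_snd_le x hx).trans (by gcongr)
  abs_snd_deriv_le x hx := (h.abs_snd_deriv_le x hx).trans (by gcongr)

end Dichotomy

/-! ### Bound states of asymptotically periodic potentials -/

/-- A continuous potential `V` which coincides with the `1`-periodic potential `Vper` outside
`[-ρ, ρ]`: what `IsEventuallyPeriodic` says about `V` and `Vper`, without smoothness. -/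
structure IsAsymptoticallyPeriodic (V Vper : ℝ → ℝ) (ρ : ℝ) : Prop where
  continuous : Continuous V
  periodic : ∀ x, Vper (x + 1) = Vper x
  eq_per : ∀ x, ρ < |x| → V x = Vper x

theorem IsEventuallyPeriodic.isAsymptoticallyPeriodic {V Vper Vdef : ℝ → ℝ} {ρ : ℝ}
    (h : IsEventuallyPeriodic V Vper Vdef ρ) : IsAsymptoticallyPeriodic V Vper ρ where
  continuous := h.smooth.continuous
  periodic := h.periodic
  eq_per x hx := by rw [h.decomp, h.supp x hx, add_zero]

section Potential

variable {V Vper : ℝ → ℝ} {ρ E : ℝ} {Φ : ℝ → ℂ}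

theorem IsAsymptoticallyPeriodic.continuous_per (hV : IsAsymptoticallyPeriodic V Vper ρ) :
    Continuous Vper := by
  refine continuous_iff_continuousAt.2 fun x => ?_
  obtain ⟨n, hn⟩ := exists_nat_gt (ρ + 1 - x)
  have heq : (fun y => V (y + n)) =ᶠ[nhds x] Vper := by
    filter_upwards [Ioi_mem_nhds (sub_one_lt x)] with y hy
    have hρ : ρ < y + n := by linarith [Set.mem_Ioi.1 hy]
    rw [hV.eq_per _ (hρ.trans_le (le_abs_self _))]
    simpa using Function.Periodic.nat_mul hV.periodic n y
  exact ContinuousAt.congr (hV.continuous.comp (continuous_add_const _)).continuousAt heq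

theorem IsAsymptoticallyPeriodic.reflect (hV : IsAsymptoticallyPeriodic V Vper ρ) :
    IsAsymptoticallyPeriodic (fun x => V (-x)) (fun x => Vper (-x)) ρ where
  continuous := hV.continuous.comp continuous_neg
  periodic x := by rw [← hV.periodic (-(x + 1))]; congr 1; ring
  eq_per x hx := hV.eq_per _ (by rwa [abs_neg])

theorem IsAsymptoticallyPeriodic.add_one_eq (hV : IsAsymptoticallyPeriodic V Vper ρ) {x : ℝ}
    (hx : ρ < x) : V (x + 1) = V x := by
  rw [hV.eq_per _ (hx.trans_le (le_abs_self x)), hV.eq_per, hV.periodic]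
  exact (hx.trans (lt_add_one x)).trans_le (le_abs_self _)

theorem IsBoundState.integrable_sq (hΦ : IsBoundState V E Φ) : Integrable fun x => ‖Φ x‖ ^ 2 :=
  (memLp_two_iff_integrable_sq_norm hΦ.memLp.1).1 hΦ.memLp

theorem IsBoundState.isSolOn (hΦ : IsBoundState V E Φ) :
    IsSolOn Set.univ (fun x => ((V x - E : ℝ) : ℂ)) Φ (deriv Φ) := by
  simpa using hΦ.sol.isSolOn

theorem IsBoundState.deriv_ne_zero (hΦ : IsBoundState V E Φ) (hV : Continuous V) {x : ℝ}
    (h0 : Φ x = 0) : deriv Φ x ≠ 0 := by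
  obtain ⟨y, hy⟩ := Function.ne_iff.1 hΦ.ne_zero
  exact (hΦ.isSolOn.ne_zero (by fun_prop) (.inl hy) x).resolve_left (· h0)

theorem IsBoundState.re_mul_im_deriv_sub (hΦ : IsBoundState V E Φ)
    (hV : IsAsymptoticallyPeriodic V Vper ρ) (x : ℝ) :
    (Φ x).re * (deriv Φ x).im - (deriv Φ x).re * (Φ x).im = 0 := by
  have hQ : Continuous fun x => V x - E := hV.continuous.sub continuous_const
  obtain ⟨B, hB⟩ := exists_abs_le_of_eventually_periodic hQ (R := ρ) fun x hx => by
    rw [hV.add_one_eq hx]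
  have hΦc := hΦ.isSolOn.continuous_fst
  have hre : Integrable fun x => (Φ x).re ^ 2 := hΦ.integrable_sq.mono' (by fun_prop)
    (.of_forall fun x => by
      rw [norm_pow, Real.norm_eq_abs]
      gcongr
      exact Complex.abs_re_le_norm _)
  have him : Integrable fun x => (Φ x).im ^ 2 := hΦ.integrable_sq.mono' (by fun_prop)
    (.of_forall fun x => by
      rw [norm_pow, Real.norm_eq_abs]
      gcongr
      exact Complex.abs_im_le_norm _)
  rw [hΦ.isSolOn.re.wronskian_eq hΦ.isSolOn.im isOpen_univ isPreconnected_univ (y := ρ + 1)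
    trivial trivial]
  exact (hΦ.isSolOn.re.mono (Set.subset_univ _)).wronskian_eq_zero_of_sq_integrable
    (hΦ.isSolOn.im.mono (Set.subset_univ _)) hQ.continuousOn hB hre.integrableOn him.integrableOn
    (lt_add_one ρ)

theorem IsBoundState.ofReal_re_deriv_div (hΦ : IsBoundState V E Φ)
    (hV : IsAsymptoticallyPeriodic V Vper ρ) (x : ℝ) :
    (((deriv Φ x / Φ x).re : ℝ) : ℂ) = deriv Φ x / Φ x := by
  apply Complex.ext
  · simp
  · rw [Complex.ofReal_im, Complex.div_im, ← sub_div, eq_comm, div_eq_zero_iff]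
    exact .inl (by linear_combination hΦ.re_mul_im_deriv_sub hV x)

theorem IsBoundState.integrable_sq_of_eq_const_mul (hΦ : IsBoundState V E Φ) (hV : Continuous V)
    {φ φ' : ℝ → ℝ} {c : ℂ} (hφ : IsSolOn Set.univ (fun x => V x - E) φ φ') (hc : c ≠ 0)
    {x₀ : ℝ} (h0 : Φ x₀ = c * φ x₀) (h1 : deriv Φ x₀ = c * φ' x₀) :
    Integrable fun x => φ x ^ 2 := by
  refine (hΦ.integrable_sq.const_mul (‖c‖ ^ 2)⁻¹).congr (.of_forall fun x => ?_)
  have heq := (hΦ.isSolOn.eq_of_eq_at (by fun_prop) (hφ.ofReal.const_mul c) isOpen_univ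
    isPreconnected_univ (Set.mem_univ x₀) h0 h1 (Set.mem_univ x)).1
  have := norm_ne_zero_iff.2 hc
  simp only [heq, norm_mul, mul_pow, Complex.norm_real, Real.norm_eq_abs, sq_abs]
  field_simp

theorem IsBoundState.exists_isFundamentalPair_of_eq_zero (hΦ : IsBoundState V E Φ)
    (hV : Continuous V) (h0 : Φ 0 = 0) :
    ∃ φ φ' ψ ψ' : ℝ → ℝ, IsFundamentalPair (fun x => V x - E) φ φ' ψ ψ' ∧
      Integrable (fun x => φ x ^ 2) ∧
      ∀ ζ, uSol V Φ ζ = ivp V (ζ 1) (φ 0 + (ζ 0 - eta Φ E 0) * ψ 0)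
        (φ' 0 + (ζ 0 - eta Φ E 0) * ψ' 0) := by
  have hQ : Continuous fun x => V x - E := by fun_prop
  obtain ⟨φ, φ', hφ, hφ0, hφ'0⟩ := exists_isSolOn hQ 0 0 1
  obtain ⟨ψ, ψ', hψ, hψ0, hψ'0⟩ := exists_isSolOn hQ 0 (-1) 0
  refine ⟨φ, φ', ψ, ψ', .of_eq_at hφ hψ (x₀ := 0) (by simp [hφ0, hφ'0, hψ0]), ?_, fun ζ => ?_⟩
  · exact hΦ.integrable_sq_of_eq_const_mul hV hφ (hΦ.deriv_ne_zero hV h0) (x₀ := 0)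
      (by simp [h0, hφ0]) (by simp [hφ'0])
  · simp [uSol, eta, h0, hφ0, hφ'0, hψ0, hψ'0]

theorem IsBoundState.exists_isFundamentalPair_of_ne_zero (hΦ : IsBoundState V E Φ)
    (hV : IsAsymptoticallyPeriodic V Vper ρ) (h0 : Φ 0 ≠ 0) :
    ∃ φ φ' ψ ψ' : ℝ → ℝ, IsFundamentalPair (fun x => V x - E) φ φ' ψ ψ' ∧
      Integrable (fun x => φ x ^ 2) ∧
      ∀ ζ, uSol V Φ ζ = ivp V (ζ 1) (φ 0 + (ζ 0 - eta Φ E 0) * ψ 0)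
        (φ' 0 + (ζ 0 - eta Φ E 0) * ψ' 0) := by
  have hQ : Continuous fun x => V x - E := hV.continuous.sub continuous_const
  obtain ⟨φ, φ', hφ, hφ0, hφ'0⟩ := exists_isSolOn hQ 0 1 (deriv Φ 0 / Φ 0).re
  obtain ⟨ψ, ψ', hψ, hψ0, hψ'0⟩ := exists_isSolOn hQ 0 0 1
  have hreal := hΦ.ofReal_re_deriv_div hV 0
  refine ⟨φ, φ', ψ, ψ', .of_eq_at hφ hψ (x₀ := 0) (by simp [hφ0, hψ0, hψ'0]), ?_, fun ζ => ?_⟩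
  · exact hΦ.integrable_sq_of_eq_const_mul hV.continuous hφ h0 (x₀ := 0) (by simp [hφ0])
      (by rw [hφ'0, hreal]; field_simp)
  · simp [uSol, eta, h0, hφ0, hφ'0, hψ0, hψ'0, hreal]

theorem IsBoundState.exists_isFundamentalPair (hΦ : IsBoundState V E Φ)
    (hV : IsAsymptoticallyPeriodic V Vper ρ) :
    ∃ φ φ' ψ ψ' : ℝ → ℝ, IsFundamentalPair (fun x => V x - E) φ φ' ψ ψ' ∧
      Integrable (fun x => φ x ^ 2) ∧
      ∀ ζ, uSol V Φ ζ = ivp V (ζ 1) (φ 0 + (ζ 0 - eta Φ E 0) * ψ 0)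
        (φ' 0 + (ζ 0 - eta Φ E 0) * ψ' 0) := by
  by_cases h0 : Φ 0 = 0
  · exact hΦ.exists_isFundamentalPair_of_eq_zero hV.continuous h0
  · exact hΦ.exists_isFundamentalPair_of_ne_zero hV h0

theorem IsSolOn.isCharacteristicMultiplier {F F' : ℝ → ℝ} {μ : ℝ}
    (hF : IsSolOn Set.univ (fun x => Vper x - E) F F') (hVper : Continuous Vper) (h0 : F ≠ 0)
    (hμ : IsFloquetOn Set.univ μ F) : IsCharacteristicMultiplier Vper E μ := by
  have hFc : IsSolOn Set.univ (fun x => (Vper x : ℂ) - (E : ℂ)) (fun x => (F x : ℂ))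
      (fun x => (F' x : ℂ)) := by simpa using hF.ofReal
  refine ⟨fun x => F x, hFc.isSolution hVper, fun hz => h0 ?_, fun x => by simp [hμ x trivial]⟩
  exact funext fun x => by simpa using congrFun hz x

theorem IsSolOn.exists_floquet_extension_ne_zero {φ φ' : ℝ → ℝ} {l : ℝ}
    (hφ : IsSolOn Set.univ (fun x => V x - E) φ φ') (hV : IsAsymptoticallyPeriodic V Vper ρ)
    (h0 : ∀ x, φ x ≠ 0 ∨ φ' x ≠ 0) (hl : IsFloquetOn (Set.Ioi ρ) l φ) :
    ∃ F F' : ℝ → ℝ, IsSolOn Set.univ (fun x => Vper x - E) F F' ∧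
      IsFloquetOn Set.univ l F ∧ F ≠ 0 := by
  have hVper := hV.continuous_per
  have hφI := hφ.mono (Set.subset_univ (Set.Ioi ρ))
  obtain ⟨x, hx, hφx⟩ :=
    hφI.exists_ne_zero isOpen_Ioi (Set.mem_Ioi.2 (lt_add_one ρ)) (h0 _)
  obtain ⟨F, F', hF, hFl, hFφ⟩ := (hφI.congr (Q' := fun x => Vper x - E) fun x hx => by
      simp only [hV.eq_per x (lt_of_lt_of_le hx (le_abs_self x))]).exists_floquet_extension
    (by fun_prop) (fun x => by rw [hV.periodic]) hl
  exact ⟨F, F', hF, hFl, Function.ne_iff.2 ⟨x, by rwa [hFφ hx]⟩⟩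

theorem IsFundamentalPair.exists_isFloquetExponent {φ φ' ψ ψ' : ℝ → ℝ}
    (h : IsFundamentalPair (fun x => V x - E) φ φ' ψ ψ')
    (hV : IsAsymptoticallyPeriodic V Vper ρ) (hi : Integrable fun x => φ x ^ 2) :
    ∃ κ C, IsFloquetExponent Vper E κ ∧ IsDichotomy (fun x => V x - E) φ φ' ψ ψ' κ C ∧
      IsDichotomy (fun x => V (-x) - E) (fun x => φ (-x)) (fun x => -φ' (-x))
        (fun x => -ψ (-x)) (fun x => ψ' (-x)) κ C := by
  have hVc := hV.continuous
  have hVper := hV.continuous_per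
  obtain ⟨l, C, hl0, hl1, hφ, hC⟩ := h.exists_isDichotomy_of_sq_integrable (by fun_prop)
    (fun x hx => by rw [hV.add_one_eq hx]) hi.integrableOn
  obtain ⟨m, D, hm0, hm1, hφn, hD⟩ := h.reflect.exists_isDichotomy_of_sq_integrable (by fun_prop)
    (fun x hx => by rw [hV.reflect.add_one_eq hx]) hi.comp_neg.integrableOn
  obtain ⟨F, F', hF, hFl, hF0⟩ := h.fst.exists_floquet_extension_ne_zero hV h.fst_ne_zero hφ
  obtain ⟨G, G', hG, hGm, hG0⟩ := IsSolOn.exists_floquet_extension_ne_zero h.reflect.fst hV.reflect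
    h.reflect.fst_ne_zero hφn
  have hH : IsSolOn Set.univ (fun x => Vper x - E) (fun x => G (-x)) (fun x => -G' (-x)) := by
    simpa using hG.comp_neg
  have hHm := hGm.comp_neg hm0
  obtain ⟨x₀, hx₀⟩ := Function.ne_iff.1 hF0
  have hH0 : (fun x => G (-x)) ≠ 0 := fun h0 =>
    hG0 (funext fun x => by simpa using congrFun h0 (-x))
  have hne : l ≠ m⁻¹ := fun h => by
    rw [h, abs_inv] at hl1
    exact absurd hl1 ((one_lt_inv₀ (abs_pos.2 hm0)).2 hm1).not_gt
  obtain rfl : l = m := by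
    have := hF.mul_eq_one_of_isFloquetOn hH (by fun_prop) (.inl hx₀) hH0 hFl hHm hne
    rwa [← div_eq_mul_inv, div_eq_one_iff_eq hm0] at this
  refine ⟨_, max C D, ⟨neg_pos.2 (Real.log_neg (abs_pos.2 hl0) hl1), l⁻¹,
    hH.isCharacteristicMultiplier hVper hH0 hHm, ?_⟩, hC.mono (le_max_left _ _),
    hD.mono (le_max_right _ _)⟩
  rw [Real.exp_neg, Real.exp_log (abs_pos.2 hl0), abs_inv]

end Potential

/-! ### Variation of parameters about a dichotomy -/

/-- The generator of variation of parameters: if `φ`, `ψ` solve `u'' = Q u` with Wronskian `1`, then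
`u = a φ + b ψ` solves `u'' = (Q - ε) u` as soon as `(a, b)' = ε (ψ u, -φ u)`. -/
def paramGenerator (φ ψ : ℝ → ℝ) (t : ℝ) : ℂ × ℂ →L[ℂ] ℂ × ℂ :=
  ((φ t : ℂ) • ContinuousLinearMap.fst ℂ ℂ ℂ + (ψ t : ℂ) • ContinuousLinearMap.snd ℂ ℂ ℂ).smulRight
    ((ψ t : ℂ), -(φ t : ℂ))

/-- The coefficients `(a, b)` of the solution `u = a φ + b ψ` of `u'' = (Q - ε) u`, with value `y₀`
at `0`. -/
def paramCoeff (φ ψ : ℝ → ℝ) (y₀ : ℂ × ℂ) (ε : ℂ) (x : ℝ) : ℂ × ℂ :=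
  dysonSeries (paramGenerator φ ψ) y₀ ε x

theorem paramGenerator_apply (φ ψ : ℝ → ℝ) (t : ℝ) (y : ℂ × ℂ) :
    paramGenerator φ ψ t y =
      ((φ t * y.1 + ψ t * y.2) * ψ t, -((φ t * y.1 + ψ t * y.2) * φ t)) := by
  simp [paramGenerator]

theorem continuous_paramGenerator {φ ψ : ℝ → ℝ} (hφ : Continuous φ) (hψ : Continuous ψ) :
    Continuous (paramGenerator φ ψ) := by
  refine continuous_clm_apply.2 fun y => ?_
  simp only [paramGenerator_apply]
  fun_prop

/-- The bound `|a| ≤ P e^{2κx}`, `|b| ≤ P` on the coefficients of `a φ + b ψ`, under which both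
terms are `O(e^{κx})` for a dichotomy `φ`, `ψ`. -/
structure IsParamBound (κ x P : ℝ) (y : ℂ × ℂ) : Prop where
  norm_fst_le : ‖y.1‖ ≤ P * Real.exp (2 * κ * x)
  norm_snd_le : ‖y.2‖ ≤ P

section Param

variable {Q φ φ' ψ ψ' : ℝ → ℝ} {κ C x P : ℝ} {ε : ℂ} {y y₀ : ℂ × ℂ}

theorem IsParamBound.mono {P' : ℝ} (h : IsParamBound κ x P y) (hP : P ≤ P') :
    IsParamBound κ x P' y :=
  ⟨h.norm_fst_le.trans (by gcongr), h.norm_snd_le.trans hP⟩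

theorem IsParamBound.of_norm_le (hκx : 0 ≤ κ * x) (h : ‖y‖ ≤ P) : IsParamBound κ x P y where
  norm_fst_le := by
    have hexp : 1 ≤ Real.exp (2 * κ * x) := Real.one_le_exp (by linarith)
    exact ((_root_.norm_fst_le y).trans h).trans
      (le_mul_of_one_le_right ((norm_nonneg _).trans h) hexp)
  norm_snd_le := (_root_.norm_snd_le y).trans h

theorem IsParamBound.smul (h : IsParamBound κ x P y) (ε : ℂ) :
    IsParamBound κ x (‖ε‖ * P) (ε • y) where
  norm_fst_le := by
    rw [Prod.smul_fst, norm_smul, mul_assoc]; gcongr; exact h.norm_fst_le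
  norm_snd_le := by
    rw [Prod.smul_snd, norm_smul]; gcongr; exact h.norm_snd_le

theorem IsParamBound.norm_le (h : IsParamBound κ x P y) (hκx : 0 ≤ κ * x) :
    ‖y‖ ≤ P * Real.exp (2 * κ * x) := by
  have hexp : 1 ≤ Real.exp (2 * κ * x) := Real.one_le_exp (by linarith)
  have hP : 0 ≤ P := (norm_nonneg _).trans h.norm_snd_le
  exact norm_prod_le_iff.2
    ⟨h.norm_fst_le, h.norm_snd_le.trans (le_mul_of_one_le_right hP hexp)⟩

theorem norm_pow_smul_le {𝕜 X : Type*} [NormedField 𝕜] [NormedAddCommGroup X]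
    [NormedSpace 𝕜 X] {c : X} {ε : 𝕜} {P b : ℝ} {n : ℕ} (hc : ‖c‖ ≤ P * b ^ n) (hP : 0 ≤ P)
    (hε : ‖ε‖ * b ≤ 1 / 2) (hb : 0 ≤ b) : ‖ε ^ n • c‖ ≤ P * (1 / 2) ^ n := by
  rw [norm_smul, norm_pow]
  calc ‖ε‖ ^ n * ‖c‖ ≤ ‖ε‖ ^ n * (P * b ^ n) := by gcongr
    _ = P * (‖ε‖ * b) ^ n := by rw [mul_pow]; ring
    _ ≤ P * (1 / 2) ^ n := by gcongr

theorem norm_tsum_pow_smul_le {𝕜 X : Type*} [NormedField 𝕜] [NormedAddCommGroup X]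
    [NormedSpace 𝕜 X] {c : ℕ → X} {ε : 𝕜} {P b : ℝ} (hc : ∀ n, ‖c n‖ ≤ P * b ^ n)
    (hε : ‖ε‖ * b ≤ 1 / 2) (hb : 0 ≤ b) : ‖∑' n, ε ^ n • c n‖ ≤ 2 * P := by
  have hP : 0 ≤ P := by simpa using (norm_nonneg _).trans (hc 0)
  have hs : HasSum (fun n : ℕ => P * (1 / 2 : ℝ) ^ n) (2 * P) := by
    simpa only [mul_comm] using hasSum_geometric_two.mul_left P
  exact tsum_of_norm_bounded hs fun n => norm_pow_smul_le (hc n) hP hε hb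

theorem IsParamBound.tsum {c : ℕ → ℂ × ℂ} {b : ℝ} (hκx : 0 ≤ κ * x)
    (hc : ∀ n, IsParamBound κ x (P * b ^ n) (c n)) (hε : ‖ε‖ * b ≤ 1 / 2) (hb : 0 ≤ b) :
    IsParamBound κ x (2 * P) (∑' n, ε ^ n • c n) := by
  have hP : 0 ≤ P := by simpa using (norm_nonneg _).trans (hc 0).norm_snd_le
  have hs : Summable fun n => ε ^ n • c n :=
    .of_norm_bounded (summable_geometric_two.mul_left (P * Real.exp (2 * κ * x))) fun n =>
      norm_pow_smul_le (((hc n).norm_le hκx).trans_eq (by ring)) (by positivity) hε hb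
  constructor
  · rw [show (∑' n, ε ^ n • c n).1 = ∑' n, ε ^ n • (c n).1 from
      (ContinuousLinearMap.fst ℂ ℂ ℂ).map_tsum hs, mul_assoc]
    exact norm_tsum_pow_smul_le (fun n => ((hc n).norm_fst_le).trans_eq (by ring)) hε hb
  · rw [show (∑' n, ε ^ n • c n).2 = ∑' n, ε ^ n • (c n).2 from
      (ContinuousLinearMap.snd ℂ ℂ ℂ).map_tsum hs]
    exact norm_tsum_pow_smul_le (fun n => (hc n).norm_snd_le) hε hb

theorem IsFundamentalPair.continuous_paramGenerator (h : IsFundamentalPair Q φ φ' ψ ψ') :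
    Continuous (paramGenerator φ ψ) :=
  TruncatedDefect.continuous_paramGenerator h.fst.continuous_fst h.snd.continuous_fst

theorem IsFundamentalPair.isSolOn_paramCoeff (h : IsFundamentalPair Q φ φ' ψ ψ') (y₀ : ℂ × ℂ)
    (ε : ℂ) :
    IsSolOn Set.univ (fun x => (Q x : ℂ) - ε)
      (fun x => (paramCoeff φ ψ y₀ ε x).1 * φ x + (paramCoeff φ ψ y₀ ε x).2 * ψ x)
      (fun x => (paramCoeff φ ψ y₀ ε x).1 * φ' x + (paramCoeff φ ψ y₀ ε x).2 * ψ' x) := by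
  intro x _
  have hder := hasDerivAt_dysonSeries h.continuous_paramGenerator y₀ ε x
  change HasDerivAt (paramCoeff φ ψ y₀ ε) (ε • paramGenerator φ ψ x (paramCoeff φ ψ y₀ ε x)) x
    at hder
  rw [paramGenerator_apply] at hder
  have ha := (ContinuousLinearMap.fst ℝ ℂ ℂ).hasFDerivAt.comp_hasDerivAt x hder
  have hb := (ContinuousLinearMap.snd ℝ ℂ ℂ).hasFDerivAt.comp_hasDerivAt x hder
  obtain ⟨hφ, hφ'⟩ := h.fst.ofReal x trivial
  obtain ⟨hψ, hψ'⟩ := h.snd.ofReal x trivial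
  have hW : (φ x * ψ' x - φ' x * ψ x : ℂ) = 1 := by exact_mod_cast h.wronskian x
  refine ⟨((ha.mul hφ).add (hb.mul hψ)).congr_deriv ?_,
    ((ha.mul hφ').add (hb.mul hψ')).congr_deriv ?_⟩ <;>
    simp only [Function.comp_apply, ContinuousLinearMap.coe_fst', ContinuousLinearMap.coe_snd',
      Prod.smul_fst, Prod.smul_snd, smul_eq_mul]
  · ring
  · linear_combination -ε * (φ x * (paramCoeff φ ψ y₀ ε x).1 + ψ x * (paramCoeff φ ψ y₀ ε x).2) * hW

theorem IsDichotomy.norm_mul_fst_add_mul_snd_le (h : IsDichotomy Q φ φ' ψ ψ' κ C) (hx : 0 ≤ x)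
    (hy : IsParamBound κ x P y) :
    ‖φ x * y.1 + ψ x * y.2‖ ≤ 2 * C * P * Real.exp (κ * x) := by
  have hexp : Real.exp (-(κ * x)) * Real.exp (2 * κ * x) = Real.exp (κ * x) := by
    rw [← Real.exp_add]; ring_nf
  have hC := h.pos
  calc ‖φ x * y.1 + ψ x * y.2‖ ≤ |φ x| * ‖y.1‖ + |ψ x| * ‖y.2‖ := by
        simpa using norm_add_le (φ x * y.1 : ℂ) (ψ x * y.2)
    _ ≤ C * Real.exp (-(κ * x)) * (P * Real.exp (2 * κ * x)) + C * Real.exp (κ * x) * P := by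
        gcongr
        exacts [h.abs_fst_le x hx, hy.norm_fst_le, h.abs_snd_le x hx, hy.norm_snd_le]
    _ = 2 * C * P * Real.exp (κ * x) := by linear_combination C * P * hexp

theorem IsDichotomy.isParamBound_paramGenerator (h : IsDichotomy Q φ φ' ψ ψ' κ C) (hx : 0 ≤ x)
    (hy : IsParamBound κ x P y) :
    IsParamBound κ x (2 * C ^ 2 * P) (paramGenerator φ ψ x y) := by
  have hu := h.norm_mul_fst_add_mul_snd_le hx hy
  have hu0 := (norm_nonneg _).trans hu
  rw [paramGenerator_apply]
  constructor
  · have hexp : Real.exp (κ * x) * Real.exp (κ * x) = Real.exp (2 * κ * x) := by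
      rw [← Real.exp_add]; ring_nf
    calc ‖(φ x * y.1 + ψ x * y.2) * ψ x‖ = ‖φ x * y.1 + ψ x * y.2‖ * |ψ x| := by simp
      _ ≤ 2 * C * P * Real.exp (κ * x) * (C * Real.exp (κ * x)) := by
        gcongr; exact h.abs_snd_le x hx
      _ = 2 * C ^ 2 * P * Real.exp (2 * κ * x) := by rw [← hexp]; ring
  · have hexp : Real.exp (κ * x) * Real.exp (-(κ * x)) = 1 := by rw [← Real.exp_add]; simp
    calc ‖-((φ x * y.1 + ψ x * y.2) * φ x)‖ = ‖φ x * y.1 + ψ x * y.2‖ * |φ x| := by simp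
      _ ≤ 2 * C * P * Real.exp (κ * x) * (C * Real.exp (-(κ * x))) := by
        gcongr; exact h.abs_fst_le x hx
      _ = 2 * C ^ 2 * P := by linear_combination 2 * C ^ 2 * P * hexp

theorem norm_integral_le_of_norm_le_of_nonneg {X : Type*} [NormedAddCommGroup X] [NormedSpace ℝ X]
    {f : ℝ → X} {K x : ℝ} (hx : 0 ≤ x) (h : ∀ t, 0 ≤ t → t ≤ x → ‖f t‖ ≤ K) :
    ‖∫ t in (0 : ℝ)..x, f t‖ ≤ K * x := by
  have := intervalIntegral.norm_integral_le_of_norm_le_const (a := 0) (b := x) (f := f) (C := K)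
    fun t ht => by
      rw [Set.uIoc_of_le hx] at ht
      exact h t ht.1.le ht.2
  rwa [sub_zero, abs_of_nonneg hx] at this

theorem IsParamBound.intervalIntegral {f : ℝ → ℂ × ℂ} (hκ : 0 ≤ κ) (hP : 0 ≤ P)
    (hf : Continuous f) (hx : 0 ≤ x) (h : ∀ t, 0 ≤ t → t ≤ x → IsParamBound κ t P (f t)) :
    IsParamBound κ x (P * x) (∫ t in (0 : ℝ)..x, f t) := by
  have hint := hf.intervalIntegrable (μ := volume) 0 x
  constructor
  · rw [← ContinuousLinearMap.coe_fst' (R := ℂ),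
      ← ContinuousLinearMap.intervalIntegral_comp_comm _ hint, mul_right_comm]
    refine norm_integral_le_of_norm_le_of_nonneg hx fun t ht htx => ?_
    refine (h t ht htx).norm_fst_le.trans ?_
    gcongr
  · rw [← ContinuousLinearMap.coe_snd' (R := ℂ),
      ← ContinuousLinearMap.intervalIntegral_comp_comm _ hint]
    exact norm_integral_le_of_norm_le_of_nonneg hx fun t ht htx => (h t ht htx).norm_snd_le

theorem IsDichotomy.isParamBound_dysonTerm_add (h : IsDichotomy Q φ φ' ψ ψ' κ C) (hκ : 0 ≤ κ)
    (hP : 0 ≤ P) {m : ℕ} {M : ℝ}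
    (hm : ∀ t, 0 ≤ t → t ≤ M → IsParamBound κ t P (dysonTerm (paramGenerator φ ψ) y₀ m t)) (n : ℕ)
    (hx : 0 ≤ x) (hxM : x ≤ M) :
    IsParamBound κ x (P * (2 * C ^ 2 * M) ^ n)
      (dysonTerm (paramGenerator φ ψ) y₀ (n + m) x) := by
  have hM : 0 ≤ M := hx.trans hxM
  induction n generalizing x with
  | zero => simpa using hm x hx hxM
  | succ n ih =>
    have hA := h.continuous_paramGenerator
    have hbound := IsParamBound.intervalIntegral hκ
      (P := 2 * C ^ 2 * (P * (2 * C ^ 2 * M) ^ n)) (by positivity)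
      (hA.clm_apply (continuous_dysonTerm hA (n + m))) hx
      fun t ht htx => h.isParamBound_paramGenerator ht (ih ht (htx.trans hxM))
    rw [Nat.add_right_comm]
    refine hbound.mono ?_
    calc 2 * C ^ 2 * (P * (2 * C ^ 2 * M) ^ n) * x
        ≤ 2 * C ^ 2 * (P * (2 * C ^ 2 * M) ^ n) * M := by gcongr
      _ = P * (2 * C ^ 2 * M) ^ (n + 1) := by ring

theorem IsDichotomy.isParamBound_paramCoeff (h : IsDichotomy Q φ φ' ψ ψ' κ C) (hκ : 0 ≤ κ)
    (hx : 0 ≤ x) (hε : ‖ε‖ * (2 * C ^ 2 * x) ≤ 1 / 2) (hy₀ : ‖y₀‖ ≤ P) :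
    IsParamBound κ x (2 * P) (paramCoeff φ ψ y₀ ε x) :=
  .tsum (by positivity) (fun n => h.isParamBound_dysonTerm_add (m := 0) hκ
    ((norm_nonneg _).trans hy₀) (fun _ ht _ => .of_norm_le (by positivity) hy₀) n hx le_rfl)
    hε (by positivity)

theorem IsDichotomy.integral_sq_le (h : IsDichotomy Q φ φ' ψ ψ' κ C) (hκ : 0 < κ) (hx : 0 ≤ x) :
    ∫ t in (0 : ℝ)..x, φ t ^ 2 ≤ C ^ 2 / (2 * κ) := by
  have hφ := h.fst.continuous_fst
  calc ∫ t in (0 : ℝ)..x, φ t ^ 2 ≤ ∫ t in (0 : ℝ)..x, C ^ 2 * Real.exp (-(2 * κ) * t) := by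
        refine intervalIntegral.integral_mono_on hx
          (Continuous.intervalIntegrable (by fun_prop) _ _)
          (Continuous.intervalIntegrable (by fun_prop) _ _) fun t ht => ?_
        calc φ t ^ 2 = |φ t| ^ 2 := (sq_abs _).symm
          _ ≤ (C * Real.exp (-(κ * t))) ^ 2 := by gcongr; exact h.abs_fst_le t ht.1
          _ = C ^ 2 * Real.exp (-(2 * κ) * t) := by
            rw [mul_pow, ← Real.exp_nat_mul]; push_cast; ring_nf
    _ = C ^ 2 / (2 * κ) * (1 - Real.exp (-(2 * κ) * x)) := by
        rw [intervalIntegral.integral_const_mul,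
          intervalIntegral.integral_comp_mul_left Real.exp (by simp [hκ.ne']), integral_exp]
        simp only [mul_zero, Real.exp_zero, smul_eq_mul]
        field_simp
        ring
    _ ≤ C ^ 2 / (2 * κ) := mul_le_of_le_one_right (by positivity) (by simp [Real.exp_nonneg])

theorem IsFundamentalPair.dysonTerm_one_fst (h : IsFundamentalPair Q φ φ' ψ ψ') :
    (dysonTerm (paramGenerator φ ψ) (1, 0) 1 x).1 = ∫ t in (0 : ℝ)..x, (φ t * ψ t : ℂ) := by
  have hint := (h.continuous_paramGenerator.clm_apply
    (continuous_const (y := ((1 : ℂ), (0 : ℂ))))).intervalIntegrable (μ := volume) 0 x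
  have := (ContinuousLinearMap.fst ℂ ℂ ℂ).intervalIntegral_comp_comm hint
  simpa [paramGenerator_apply, dysonTerm] using this.symm

theorem IsFundamentalPair.dysonTerm_one_snd (h : IsFundamentalPair Q φ φ' ψ ψ') :
    (dysonTerm (paramGenerator φ ψ) (1, 0) 1 x).2 = -(∫ t in (0 : ℝ)..x, φ t ^ 2 : ℝ) := by
  have hint := (h.continuous_paramGenerator.clm_apply
    (continuous_const (y := ((1 : ℂ), (0 : ℂ))))).intervalIntegrable (μ := volume) 0 x
  have := (ContinuousLinearMap.snd ℂ ℂ ℂ).intervalIntegral_comp_comm hint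
  rw [← intervalIntegral.integral_ofReal]
  simpa [paramGenerator_apply, dysonTerm, sq] using this.symm

theorem IsDichotomy.norm_dysonTerm_one_fst_le (h : IsDichotomy Q φ φ' ψ ψ' κ C) (hx : 0 ≤ x) :
    ‖(dysonTerm (paramGenerator φ ψ) (1, 0) 1 x).1‖ ≤ C ^ 2 * x := by
  have hC := h.pos
  rw [h.dysonTerm_one_fst]
  refine norm_integral_le_of_norm_le_of_nonneg hx fun t ht _ => ?_
  have hexp : Real.exp (-(κ * t)) * Real.exp (κ * t) = 1 := by rw [← Real.exp_add]; simp
  calc ‖(φ t * ψ t : ℂ)‖ = |φ t| * |ψ t| := by simp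
    _ ≤ C * Real.exp (-(κ * t)) * (C * Real.exp (κ * t)) := by
      gcongr
      exacts [h.abs_fst_le t ht, h.abs_snd_le t ht]
    _ = C ^ 2 := by linear_combination C ^ 2 * hexp

theorem IsDichotomy.isParamBound_dysonTerm_one (h : IsDichotomy Q φ φ' ψ ψ' κ C) (hκ : 0 < κ)
    (hx : 0 ≤ x) :
    IsParamBound κ x (C ^ 2 / (2 * κ)) (dysonTerm (paramGenerator φ ψ) (1, 0) 1 x) where
  norm_fst_le := by
    have hexp : 2 * κ * x ≤ Real.exp (2 * κ * x) := by linarith [Real.add_one_le_exp (2 * κ * x)]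
    calc _ ≤ C ^ 2 * x := h.norm_dysonTerm_one_fst_le hx
      _ = C ^ 2 / (2 * κ) * (2 * κ * x) := by field_simp
      _ ≤ C ^ 2 / (2 * κ) * Real.exp (2 * κ * x) := by gcongr
  norm_snd_le := by
    rw [h.dysonTerm_one_snd, norm_neg, Complex.norm_real,
      Real.norm_of_nonneg (intervalIntegral.integral_nonneg hx fun t _ => sq_nonneg (φ t))]
    exact h.integral_sq_le hκ hx

theorem IsDichotomy.isParamBound_paramCoeff_sub (h : IsDichotomy Q φ φ' ψ ψ' κ C) (hκ : 0 < κ)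
    (hx : 0 ≤ x) (hε : ‖ε‖ * (2 * C ^ 2 * x) ≤ 1 / 2) :
    IsParamBound κ x (‖ε‖ * (C ^ 2 / κ)) (paramCoeff φ ψ (1, 0) ε x - (1, 0)) := by
  have htail := IsParamBound.tsum (by positivity)
    (fun n => h.isParamBound_dysonTerm_add hκ.le (by positivity)
      (fun _ ht _ => h.isParamBound_dysonTerm_one hκ ht) n hx le_rfl) hε (by positivity)
  rw [paramCoeff, dysonSeries_eq_add_smul_tsum h.continuous_paramGenerator, add_sub_cancel_left]
  exact (htail.smul ε).mono (le_of_eq (by ring))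

end Param

/-! ### Outgoing boundary values -/

theorem norm_sqrt_sq (z : ℂ) : ‖Complex.sqrt z‖ ^ 2 = ‖z‖ := by
  rw [← norm_pow, Complex.sqrt, Complex.cpow_ofNat_inv_pow]

theorem add_mem_slitPlane {E : ℝ} {ε : ℂ} (hε : ‖ε‖ < E) : (E : ℂ) + ε ∈ Complex.slitPlane := by
  left
  have := (abs_lt.1 ((Complex.abs_re_le_norm ε).trans_lt hε)).1
  rw [Complex.add_re, Complex.ofReal_re]
  linarith

/-- The outgoing boundary functional `f'(x) - i √(E + ε) f(x)`. -/
def outgoing (f f' : ℝ → ℝ) (E x : ℝ) (ε : ℂ) : ℂ :=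
  f' x - Complex.I * Complex.sqrt (E + ε) * f x

/-- The outgoing functional of `a φ + b ψ` at `M`, in units of its value on the growing solution `ψ`
at `ε = 0`. -/
def boundaryValue (φ φ' ψ ψ' : ℝ → ℝ) (E M : ℝ) (ε : ℂ) (y : ℂ × ℂ) : ℂ :=
  (y.1 * outgoing φ φ' E M ε + y.2 * outgoing ψ ψ' E M ε) / outgoing ψ ψ' E M 0

/-- The normalized outgoing functional at `M` of the solution of `u'' = (Q - ε) u` which agrees with
`y₀.1 φ + y₀.2 ψ` to first order at `0`. -/
def boundaryFun (φ φ' ψ ψ' : ℝ → ℝ) (E M : ℝ) (y₀ : ℂ × ℂ) (ε : ℂ) : ℂ :=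
  boundaryValue φ φ' ψ ψ' E M ε (paramCoeff φ ψ y₀ ε M)

/-- The constant in the bounds on `boundaryValue` for a dichotomy with constant `C`. -/
def boundaryConst (C E : ℝ) : ℝ := C ^ 2 * (1 + Real.sqrt (2 * E)) * (1 + 1 / Real.sqrt E)

section Boundary

variable {Q φ φ' ψ ψ' : ℝ → ℝ} {κ C E M P : ℝ} {ε : ℂ} {y : ℂ × ℂ}

theorem norm_outgoing_le {f f' : ℝ → ℝ} {x B : ℝ} (hE : 0 ≤ E) (hε : ‖ε‖ ≤ E) (h : |f x| ≤ B)
    (h' : |f' x| ≤ B) : ‖outgoing f f' E x ε‖ ≤ B * (1 + Real.sqrt (2 * E)) := by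
  have hs : ‖Complex.sqrt (E + ε)‖ ≤ Real.sqrt (2 * E) := by
    refine Real.le_sqrt_of_sq_le ?_
    rw [norm_sqrt_sq, two_mul]
    refine (norm_add_le _ _).trans ?_
    rw [Complex.norm_real, Real.norm_of_nonneg hE]
    gcongr
  calc _ ≤ ‖(f' x : ℂ)‖ + ‖Complex.I * Complex.sqrt (E + ε) * f x‖ := norm_sub_le _ _
    _ = |f' x| + ‖Complex.sqrt (E + ε)‖ * |f x| := by simp
    _ ≤ B + Real.sqrt (2 * E) * B := by gcongr
    _ = _ := by ring

theorem hasDerivAt_outgoing (f f' : ℝ → ℝ) (x : ℝ) (hε : ‖ε‖ < E) :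
    HasDerivAt (outgoing f f' E x) (-(Complex.I * deriv Complex.sqrt (E + ε) * f x)) ε := by
  have hsqrt : HasDerivAt (fun ε : ℂ => Complex.sqrt (E + ε)) (deriv Complex.sqrt (E + ε)) ε :=
    (Complex.differentiableAt_sqrt (add_mem_slitPlane hε)).hasDerivAt.comp_const_add (E : ℂ) ε
  exact ((hsqrt.const_mul Complex.I).mul_const (f x : ℂ)).const_sub (f' x : ℂ)

theorem IsDichotomy.exp_le_mul_norm_outgoing (h : IsDichotomy Q φ φ' ψ ψ' κ C) (hE : 0 < E)
    (hM : 0 ≤ M) :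
    Real.exp (κ * M) ≤ C * (1 + 1 / Real.sqrt E) * ‖outgoing ψ ψ' E M 0‖ := by
  have hs := Real.sqrt_pos.2 hE
  have hC := h.pos
  have hsqrt : Complex.sqrt (E : ℂ) = Real.sqrt E := by
    simpa using Complex.sqrt_of_nonneg (a := (E : ℂ)) (by exact_mod_cast hE.le)
  -- `ψ` is real, so the two terms of `ψ' - i √E ψ` cannot cancel.
  have hψ' : |ψ' M| ≤ ‖outgoing ψ ψ' E M 0‖ := by
    simpa [outgoing, hsqrt] using Complex.abs_re_le_norm (outgoing ψ ψ' E M 0)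
  have hψ : |ψ M| ≤ 1 / Real.sqrt E * ‖outgoing ψ ψ' E M 0‖ := by
    rw [one_div, inv_mul_eq_div, le_div_iff₀ hs, mul_comm]
    simpa [outgoing, hsqrt, abs_mul, abs_of_pos hs] using
      Complex.abs_im_le_norm (outgoing ψ ψ' E M 0)
  set t := ‖outgoing ψ ψ' E M 0‖
  have hexp : Real.exp (-(κ * M)) * Real.exp (κ * M) = 1 := by rw [← Real.exp_add]; simp
  have hone : 1 ≤ C * Real.exp (-(κ * M)) * t + C * Real.exp (-(κ * M)) * (1 / Real.sqrt E * t) :=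
    calc (1 : ℝ) = |φ M * ψ' M - φ' M * ψ M| := by rw [h.wronskian M, abs_one]
      _ ≤ |φ M| * |ψ' M| + |φ' M| * |ψ M| := by rw [← abs_mul, ← abs_mul]; exact abs_sub _ _
      _ ≤ _ := by gcongr; exacts [h.abs_fst_le M hM, h.abs_fst_deriv_le M hM]
  calc Real.exp (κ * M) ≤ (C * Real.exp (-(κ * M)) * t +
          C * Real.exp (-(κ * M)) * (1 / Real.sqrt E * t)) * Real.exp (κ * M) :=
        le_mul_of_one_le_left (Real.exp_pos _).le hone
    _ = C * (1 + 1 / Real.sqrt E) * t := by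
        linear_combination C * (1 + 1 / Real.sqrt E) * t * hexp

theorem IsDichotomy.outgoing_ne_zero (h : IsDichotomy Q φ φ' ψ ψ' κ C) (hE : 0 < E)
    (hM : 0 ≤ M) : outgoing ψ ψ' E M 0 ≠ 0 := fun h0 => by
  have := (Real.exp_pos _).trans_le (h.exp_le_mul_norm_outgoing hE hM)
  simp [h0] at this

theorem boundaryConst_pos (hC : 0 < C) (E : ℝ) : 0 < boundaryConst C E := by
  unfold boundaryConst; positivity

theorem IsDichotomy.norm_boundaryValue_le (h : IsDichotomy Q φ φ' ψ ψ' κ C) (hE : 0 < E)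
    (hM : 0 ≤ M) (hε : ‖ε‖ ≤ E) (hy : IsParamBound κ M P y) :
    ‖boundaryValue φ φ' ψ ψ' E M ε y‖ ≤ 2 * boundaryConst C E * P := by
  have hC := h.pos
  have hP : 0 ≤ P := (norm_nonneg _).trans hy.norm_snd_le
  have hexp : Real.exp (2 * κ * M) * Real.exp (-(κ * M)) = Real.exp (κ * M) := by
    rw [← Real.exp_add]; ring_nf
  rw [boundaryValue, norm_div, div_le_iff₀ (norm_pos_iff.2 (h.outgoing_ne_zero hE hM))]
  calc _ ≤ ‖y.1‖ * ‖outgoing φ φ' E M ε‖ + ‖y.2‖ * ‖outgoing ψ ψ' E M ε‖ := by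
        simpa only [norm_mul] using
          norm_add_le (y.1 * outgoing φ φ' E M ε) (y.2 * outgoing ψ ψ' E M ε)
    _ ≤ P * Real.exp (2 * κ * M) * (C * Real.exp (-(κ * M)) * (1 + Real.sqrt (2 * E))) +
          P * (C * Real.exp (κ * M) * (1 + Real.sqrt (2 * E))) := by
        gcongr
        · exact hy.norm_fst_le
        · exact norm_outgoing_le hE.le hε (h.abs_fst_le M hM) (h.abs_fst_deriv_le M hM)
        · exact hy.norm_snd_le
        · exact norm_outgoing_le hE.le hε (h.abs_snd_le M hM) (h.abs_snd_deriv_le M hM)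
    _ = 2 * P * C * (1 + Real.sqrt (2 * E)) * Real.exp (κ * M) := by
        linear_combination P * C * (1 + Real.sqrt (2 * E)) * hexp
    _ ≤ 2 * P * C * (1 + Real.sqrt (2 * E)) *
          (C * (1 + 1 / Real.sqrt E) * ‖outgoing ψ ψ' E M 0‖) := by
        gcongr; exact h.exp_le_mul_norm_outgoing hE hM
    _ = _ := by rw [boundaryConst]; ring

theorem isParamBound_fst {a : ℂ} {P : ℝ} (ha : ‖a‖ ≤ P) :
    IsParamBound κ M (P * Real.exp (-(2 * κ * M))) (a, 0) where
  norm_fst_le := by rw [mul_assoc, ← Real.exp_add]; simpa using ha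
  norm_snd_le := by
    have := (norm_nonneg a).trans ha
    simpa using by positivity

theorem boundaryFun_at_zero (y₀ : ℂ × ℂ) :
    boundaryFun φ φ' ψ ψ' E M y₀ 0 = boundaryValue φ φ' ψ ψ' E M 0 y₀ := by
  rw [boundaryFun, paramCoeff, dysonSeries_zero]

theorem IsDichotomy.norm_boundaryFun_at_zero_le (h : IsDichotomy Q φ φ' ψ ψ' κ C) (hE : 0 < E)
    (hM : 0 ≤ M) : ‖boundaryFun φ φ' ψ ψ' E M (1, 0) 0‖ ≤
      2 * boundaryConst C E * Real.exp (-(2 * κ * M)) := by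
  rw [boundaryFun_at_zero]
  refine h.norm_boundaryValue_le hE hM (by simpa using hE.le) ?_
  simpa using isParamBound_fst (a := 1) (P := 1) (by simp)

theorem IsDichotomy.norm_boundaryFun_sub_le (h : IsDichotomy Q φ φ' ψ ψ' κ C) (hκ : 0 < κ)
    (hE : 0 < E) (hM : 0 ≤ M) (hε : ‖ε‖ ≤ E) (hεM : ‖ε‖ * (2 * C ^ 2 * M) ≤ 1 / 2) :
    ‖boundaryFun φ φ' ψ ψ' E M (1, 0) ε - boundaryFun φ φ' ψ ψ' E M (1, 0) 0‖ ≤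
      2 * boundaryConst C E * (‖ε‖ * (C ^ 2 / κ) + 2 * Real.exp (-(2 * κ * M))) := by
  have hone : IsParamBound κ M (Real.exp (-(2 * κ * M))) ((1, 0) : ℂ × ℂ) := by
    simpa using isParamBound_fst (a := 1) (P := 1) (by simp)
  have hsplit : boundaryFun φ φ' ψ ψ' E M (1, 0) ε =
      boundaryValue φ φ' ψ ψ' E M ε (paramCoeff φ ψ (1, 0) ε M - (1, 0)) +
        boundaryValue φ φ' ψ ψ' E M ε (1, 0) := by
    simp only [boundaryFun, boundaryValue, Prod.fst_sub, Prod.snd_sub]; ring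
  have hvar := h.norm_boundaryValue_le hE hM hε (h.isParamBound_paramCoeff_sub hκ hM hεM)
  have hbase := h.norm_boundaryValue_le hE hM hε hone
  have hzero := h.norm_boundaryFun_at_zero_le hE hM
  rw [hsplit]
  refine (norm_sub_le_of_le (norm_add_le_of_le hvar hbase) hzero).trans_eq ?_
  ring

theorem IsDichotomy.norm_boundaryFun_snd_le (h : IsDichotomy Q φ φ' ψ ψ' κ C) (hκ : 0 ≤ κ)
    (hE : 0 < E) (hM : 0 ≤ M) (hε : ‖ε‖ ≤ E) (hεM : ‖ε‖ * (2 * C ^ 2 * M) ≤ 1 / 2) :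
    ‖boundaryFun φ φ' ψ ψ' E M (0, 1) ε‖ ≤ 4 * boundaryConst C E := by
  refine (h.norm_boundaryValue_le hE hM hε
    (h.isParamBound_paramCoeff hκ hM hεM (P := 1) (by simp))).trans_eq ?_
  ring

theorem IsDichotomy.boundaryFun_snd_at_zero (h : IsDichotomy Q φ φ' ψ ψ' κ C) (hE : 0 < E)
    (hM : 0 ≤ M) : boundaryFun φ φ' ψ ψ' E M (0, 1) 0 = 1 := by
  rw [boundaryFun_at_zero, boundaryValue]
  simpa using div_self (h.outgoing_ne_zero hE hM)

theorem IsFundamentalPair.differentiableAt_boundaryFun (h : IsFundamentalPair Q φ φ' ψ ψ')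
    (y₀ : ℂ × ℂ) (hε : ‖ε‖ < E) :
    DifferentiableAt ℂ (boundaryFun φ φ' ψ ψ' E M y₀) ε := by
  have hcoeff : DifferentiableAt ℂ (fun ε => paramCoeff φ ψ y₀ ε M) ε :=
    differentiable_dysonSeries h.continuous_paramGenerator y₀ M ε
  have hφ := (hasDerivAt_outgoing φ φ' M hε).differentiableAt
  have hψ := (hasDerivAt_outgoing ψ ψ' M hε).differentiableAt
  unfold boundaryFun boundaryValue
  fun_prop

theorem IsFundamentalPair.deriv_boundaryFun_at_zero (h : IsFundamentalPair Q φ φ' ψ ψ')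
    (hE : 0 < E) (hθ : outgoing ψ ψ' E M 0 ≠ 0) :
    deriv (boundaryFun φ φ' ψ ψ' E M (1, 0)) 0 =
      boundaryValue φ φ' ψ ψ' E M 0 ((dysonTerm (paramGenerator φ ψ) (1, 0) 1 M).1, 0) -
        Complex.I * deriv Complex.sqrt E * φ M / outgoing ψ ψ' E M 0 -
        (∫ t in (0 : ℝ)..M, φ t ^ 2 : ℝ) := by
  have hcoeff := hasDerivAt_dysonSeries_at_zero h.continuous_paramGenerator ((1 : ℂ), (0 : ℂ)) M
  have hcoeff₁ := (ContinuousLinearMap.fst ℂ ℂ ℂ).hasFDerivAt.comp_hasDerivAt 0 hcoeff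
  have hcoeff₂ := (ContinuousLinearMap.snd ℂ ℂ ℂ).hasFDerivAt.comp_hasDerivAt 0 hcoeff
  have hE' : ‖(0 : ℂ)‖ < E := by simpa using hE
  have hφ := hasDerivAt_outgoing φ φ' M hE'
  have hψ := hasDerivAt_outgoing ψ ψ' M hE'
  have hderiv := ((hcoeff₁.mul hφ).add (hcoeff₂.mul hψ)).div_const (outgoing ψ ψ' E M 0)
  refine (HasDerivAt.deriv hderiv).trans ?_
  simp only [Function.comp_apply, ContinuousLinearMap.coe_fst', ContinuousLinearMap.coe_snd',
    dysonSeries_zero, h.dysonTerm_one_snd, boundaryValue, add_zero]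
  field_simp
  ring

theorem IsDichotomy.norm_deriv_boundaryFun_add_le (h : IsDichotomy Q φ φ' ψ ψ' κ C) (hE : 0 < E)
    (hM : 0 ≤ M) :
    ‖deriv (boundaryFun φ φ' ψ ψ' E M (1, 0)) 0 + (∫ t in (0 : ℝ)..M, φ t ^ 2 : ℝ)‖ ≤
      boundaryConst C E * (2 * C ^ 2 * M + ‖deriv Complex.sqrt E‖) * Real.exp (-(2 * κ * M)) := by
  have hθ := h.outgoing_ne_zero hE hM
  have hvalue := h.norm_boundaryValue_le (ε := 0) hE hM (by simpa using hE.le)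
    (isParamBound_fst (h.norm_dysonTerm_one_fst_le hM))
  have hφ : |φ M| / ‖outgoing ψ ψ' E M 0‖ ≤ boundaryConst C E * Real.exp (-(2 * κ * M)) := by
    have hC := h.pos
    have hexp : Real.exp (-(κ * M)) = Real.exp (-(2 * κ * M)) * Real.exp (κ * M) := by
      rw [← Real.exp_add]; ring_nf
    rw [div_le_iff₀ (norm_pos_iff.2 hθ)]
    calc |φ M| ≤ C * (Real.exp (-(2 * κ * M)) * Real.exp (κ * M)) :=
          hexp ▸ h.abs_fst_le M hM
      _ ≤ C * (Real.exp (-(2 * κ * M)) *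
            (C * (1 + 1 / Real.sqrt E) * ‖outgoing ψ ψ' E M 0‖)) := by
          gcongr; exact h.exp_le_mul_norm_outgoing hE hM
      _ = C ^ 2 * 1 * (1 + 1 / Real.sqrt E) * Real.exp (-(2 * κ * M)) *
            ‖outgoing ψ ψ' E M 0‖ := by ring
      _ ≤ _ := by
          rw [boundaryConst]
          gcongr
          linarith [Real.sqrt_nonneg (2 * E)]
  rw [h.deriv_boundaryFun_at_zero hE hθ, sub_add_cancel]
  refine (norm_sub_le_of_le hvalue (?_ : _ ≤ ‖deriv Complex.sqrt E‖ *
    (boundaryConst C E * Real.exp (-(2 * κ * M))))).trans_eq (by ring)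
  calc _ = ‖deriv Complex.sqrt E‖ * (|φ M| / ‖outgoing ψ ψ' E M 0‖) := by simp [mul_div_assoc]
    _ ≤ _ := by gcongr

theorem IsFundamentalPair.outgoing_eq_boundaryFun {u v : ℝ → ℂ} {s : ℂ}
    (h : IsFundamentalPair Q φ φ' ψ ψ') (hQ : Continuous Q) (hθ : outgoing ψ ψ' E M 0 ≠ 0)
    (hu : IsSolOn Set.univ (fun x => (Q x : ℂ) - ε) u v) (hu₀ : u 0 = φ 0 + s * ψ 0)
    (hv₀ : v 0 = φ' 0 + s * ψ' 0) :
    v M - Complex.I * Complex.sqrt (E + ε) * u M = outgoing ψ ψ' E M 0 *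
      (boundaryFun φ φ' ψ ψ' E M (1, 0) ε + s * boundaryFun φ φ' ψ ψ' E M (0, 1) ε) := by
  have hat (y₀ : ℂ × ℂ) : paramCoeff φ ψ y₀ ε 0 = y₀ := dysonSeries_at_zero ε
  obtain ⟨huM, hvM⟩ := hu.eq_of_eq_at (x₀ := 0) (x := M) (by fun_prop)
    ((h.isSolOn_paramCoeff (1, 0) ε).linearCombination (h.isSolOn_paramCoeff (0, 1) ε) 1 s)
    isOpen_univ isPreconnected_univ trivial (by simp [hat, hu₀]) (by simp [hat, hv₀]) trivial
  rw [huM, hvM, boundaryFun, boundaryFun, boundaryValue, boundaryValue]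
  generalize outgoing ψ ψ' E M 0 = θ at hθ
  field_simp
  unfold outgoing
  ring

end Boundary

/-! ### Expansions with constants uniform in the truncation -/

/-- The function `(s, ε) ↦ g₀ ε + s g₁ ε` on `ℂ²`. -/
def affineInFst (g₀ g₁ : ℂ → ℂ) (x : C2) : ℂ := g₀ (x 1) + x 0 * g₁ (x 1)

/-- Control of `(s, ε) ↦ g₀ ε + s g₁ ε` on the ball `‖ε‖ < δ / M` by a constant `K` which does not
depend on `M`: the value at the origin is `O(e^{-2κM})`, and the linearization there is `s - P ε` up
to `O(M e^{-2κM}) ε`. -/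
structure IsExpansion (δ K κ M P : ℝ) (g₀ g₁ : ℂ → ℂ) : Prop where
  differentiableOn_fst : DifferentiableOn ℂ g₀ (Metric.ball 0 (δ / M))
  differentiableOn_snd : DifferentiableOn ℂ g₁ (Metric.ball 0 (δ / M))
  norm_fst_sub_le : ∀ ε ∈ Metric.ball (0 : ℂ) (δ / M), ‖g₀ ε - g₀ 0‖ ≤ K / M
  norm_snd_le : ∀ ε ∈ Metric.ball (0 : ℂ) (δ / M), ‖g₁ ε‖ ≤ K
  norm_fst_zero_le : ‖g₀ 0‖ ≤ K * Real.exp (-(2 * κ * M))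
  snd_zero : g₁ 0 = 1
  norm_deriv_fst_add_le : ‖deriv g₀ 0 + P‖ ≤ K * M * Real.exp (-(2 * κ * M))

section Expansion

variable {δ K κ M P : ℝ} {g₀ g₁ : ℂ → ℂ}

theorem IsExpansion.neg_fst (h : IsExpansion δ K κ M P g₀ g₁) :
    IsExpansion δ K κ M (-P) (fun ε => -g₀ ε) g₁ where
  differentiableOn_fst := h.differentiableOn_fst.neg
  differentiableOn_snd := h.differentiableOn_snd
  norm_fst_sub_le ε hε := by rw [← neg_sub', norm_neg]; exact h.norm_fst_sub_le ε hε
  norm_snd_le := h.norm_snd_le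
  norm_fst_zero_le := by rw [norm_neg]; exact h.norm_fst_zero_le
  snd_zero := h.snd_zero
  norm_deriv_fst_add_le := by
    rw [deriv.fun_neg, Complex.ofReal_neg, ← neg_add, norm_neg]; exact h.norm_deriv_fst_add_le

theorem mul_exp_neg_le {a : ℝ} (ha : 0 < a) (x : ℝ) : x * Real.exp (-(a * x)) ≤ 1 / a := by
  rw [Real.exp_neg, ← div_eq_mul_inv, div_le_div_iff₀ (Real.exp_pos _) ha]
  linarith [Real.add_one_le_exp (a * x)]

end Expansion

section Dichotomy

variable {Q φ φ' ψ ψ' : ℝ → ℝ} {κ C E : ℝ}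

/-- The constant `K` of the expansion of `boundaryFun` on balls of radius `δ / M`. -/
def expansionConst (C E κ δ : ℝ) : ℝ :=
  boundaryConst C E * (2 * ((δ * C ^ 2 + 1) / κ) + 4 + 2 * C ^ 2 + ‖deriv Complex.sqrt E‖)

theorem expansionConst_pos {δ : ℝ} (hC : 0 < C) (hκ : 0 ≤ κ) (hδ : 0 ≤ δ) (E : ℝ) :
    0 < expansionConst C E κ δ := by
  have := boundaryConst_pos hC E
  unfold expansionConst
  positivity

theorem le_expansionConst {δ : ℝ} (hC : 0 < C) (hκ : 0 ≤ κ) (hδ : 0 ≤ δ) (E : ℝ) :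
    boundaryConst C E * (2 * ((δ * C ^ 2 + 1) / κ)) ≤ expansionConst C E κ δ ∧
      4 * boundaryConst C E ≤ expansionConst C E κ δ ∧
      boundaryConst C E * (2 * C ^ 2 + ‖deriv Complex.sqrt E‖) ≤ expansionConst C E κ δ := by
  have hB := (boundaryConst_pos hC E).le
  have hfst : 0 ≤ (δ * C ^ 2 + 1) / κ := by positivity
  have hsqrt := norm_nonneg (deriv Complex.sqrt E)
  rw [mul_comm 4, expansionConst]
  refine ⟨?_, ?_, ?_⟩ <;> exact mul_le_mul_of_nonneg_left (by linarith [sq_nonneg C]) hB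

theorem norm_bounds_of_mem_ball {δ M : ℝ} (hδE : δ ≤ E) (hδC : δ * (2 * C ^ 2) ≤ 1 / 2)
    (hM : 1 ≤ M) {ε : ℂ} (hε : ε ∈ Metric.ball (0 : ℂ) (δ / M)) :
    ‖ε‖ < E ∧ ‖ε‖ ≤ δ / M ∧ ‖ε‖ * (2 * C ^ 2 * M) ≤ 1 / 2 := by
  have hM₀ : 0 < M := by linarith
  rw [mem_ball_zero_iff, lt_div_iff₀ hM₀] at hε
  have hle : ‖ε‖ ≤ ‖ε‖ * M := le_mul_of_one_le_right (norm_nonneg ε) hM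
  refine ⟨by linarith, (le_div_iff₀ hM₀).2 hε.le, ?_⟩
  calc ‖ε‖ * (2 * C ^ 2 * M) = ‖ε‖ * M * (2 * C ^ 2) := by ring
    _ ≤ δ * (2 * C ^ 2) := by gcongr
    _ ≤ 1 / 2 := hδC

theorem IsDichotomy.isExpansion_boundaryFun {δ M : ℝ} (h : IsDichotomy Q φ φ' ψ ψ' κ C)
    (hκ : 0 < κ) (hE : 0 < E) (hδ : 0 ≤ δ) (hδE : δ ≤ E) (hδC : δ * (2 * C ^ 2) ≤ 1 / 2)
    (hM : 1 ≤ M) :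
    IsExpansion δ (expansionConst C E κ δ) κ M (∫ t in (0 : ℝ)..M, φ t ^ 2)
      (boundaryFun φ φ' ψ ψ' E M (1, 0)) (boundaryFun φ φ' ψ ψ' E M (0, 1)) := by
  have hM₀ : 0 < M := by linarith
  have hB := boundaryConst_pos h.pos E
  obtain ⟨hK₁, hK₂, hK₃⟩ := le_expansionConst h.pos hκ.le hδ E
  have hball := fun ε (hε : ε ∈ Metric.ball (0 : ℂ) (δ / M)) =>
    norm_bounds_of_mem_ball hδE hδC hM hε
  have hexp : Real.exp (-(2 * κ * M)) ≤ 1 / (2 * κ) / M := by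
    rw [le_div_iff₀ hM₀, mul_comm]
    exact mul_exp_neg_le (by positivity) M
  refine ⟨fun ε hε => (h.differentiableAt_boundaryFun _ (hball ε hε).1).differentiableWithinAt,
    fun ε hε => (h.differentiableAt_boundaryFun _ (hball ε hε).1).differentiableWithinAt,
    fun ε hε => ?_, fun ε hε => ?_, ?_, h.boundaryFun_snd_at_zero hE hM₀.le, ?_⟩
  · obtain ⟨hεE, hεδ, hεC⟩ := hball ε hε
    calc _ ≤ 2 * boundaryConst C E * (‖ε‖ * (C ^ 2 / κ) + 2 * Real.exp (-(2 * κ * M))) :=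
          h.norm_boundaryFun_sub_le hκ hE hM₀.le hεE.le hεC
      _ ≤ 2 * boundaryConst C E * (δ / M * (C ^ 2 / κ) + 2 * (1 / (2 * κ) / M)) := by gcongr
      _ = boundaryConst C E * (2 * ((δ * C ^ 2 + 1) / κ)) / M := by field_simp
      _ ≤ _ := by gcongr
  · obtain ⟨hεE, -, hεC⟩ := hball ε hε
    exact (h.norm_boundaryFun_snd_le hκ.le hE hM₀.le hεE.le hεC).trans hK₂
  · refine (h.norm_boundaryFun_at_zero_le hE hM₀.le).trans ?_
    gcongr
    linarith
  · calc _ ≤ boundaryConst C E * (2 * C ^ 2 * M + ‖deriv Complex.sqrt E‖) *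
            Real.exp (-(2 * κ * M)) := h.norm_deriv_boundaryFun_add_le hE hM₀.le
      _ ≤ boundaryConst C E * (2 * C ^ 2 * M + ‖deriv Complex.sqrt E‖ * M) *
            Real.exp (-(2 * κ * M)) := by
        gcongr; exact le_mul_of_one_le_right (norm_nonneg _) hM
      _ = boundaryConst C E * (2 * C ^ 2 + ‖deriv Complex.sqrt E‖) * M *
            Real.exp (-(2 * κ * M)) := by ring
      _ ≤ _ := by gcongr

theorem IsFundamentalPair.integral_sq_pos (h : IsFundamentalPair Q φ φ' ψ ψ') :
    0 < ∫ t in (0 : ℝ)..1, φ t ^ 2 := by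
  obtain ⟨x, hx, hφx⟩ := (h.fst.mono (Set.subset_univ (Set.Ioo 0 1))).exists_ne_zero isOpen_Ioo
    (x₀ := 1 / 2) (by norm_num) (h.fst_ne_zero _)
  exact intervalIntegral.integral_pos one_pos (h.fst.continuous_fst.pow 2).continuousOn
    (fun x _ => sq_nonneg _) ⟨x, Set.Ioo_subset_Icc_self hx, by positivity⟩

end Dichotomy

section Jacobian

variable {F : C2 → ℂ} {η : C2} {θ : ℂ} {a b : ℂ → ℂ}

theorem dw_eq_of_affineInFst (hF : ∀ ζ, F ζ = θ * affineInFst a b (ζ - η)) :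
    dw F η = θ * b 0 := by
  have haffine : (fun w : ℂ => F !₂[w, η 1]) = fun w => θ * (a 0 + (w - η 0) * b 0) := by
    ext w
    simp [hF, affineInFst]
  have hderiv : HasDerivAt (fun w : ℂ => θ * (a 0 + (w - η 0) * b 0)) (θ * (1 * b 0)) (η 0) :=
    ((((hasDerivAt_id (η 0)).sub_const (η 0)).mul_const (b 0)).const_add (a 0)).const_mul θ
  rw [dw, haffine, hderiv.deriv, one_mul]

theorem dz_eq_of_affineInFst (hF : ∀ ζ, F ζ = θ * affineInFst a b (ζ - η))
    (ha : DifferentiableAt ℂ a 0) : dz F η = θ * deriv a 0 := by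
  have hrestrict : (fun z : ℂ => F !₂[η 0, z]) = fun z => θ * a (z - η 1) := by
    ext z
    simp [hF, affineInFst]
  have hderiv : HasDerivAt a (deriv a 0) (η 1 - η 1) := by rw [sub_self]; exact ha.hasDerivAt
  rw [dz, hrestrict]
  exact ((hderiv.comp_sub_const (η 1) (η 1)).const_mul θ).deriv

theorem differentiableAt_of_affineInFst (hF : ∀ ζ, F ζ = θ * affineInFst a b (ζ - η))
    (ha : DifferentiableAt ℂ a 0) (hb : DifferentiableAt ℂ b 0) : DifferentiableAt ℂ F η := by
  have hcoord (i : Fin 2) : DifferentiableAt ℂ (fun ζ : C2 => (ζ - η) i) η := by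
    simp only [PiLp.sub_apply]; fun_prop
  have ha' : DifferentiableAt ℂ (fun ζ : C2 => a ((ζ - η) 1)) η :=
    DifferentiableAt.comp η (by simpa using ha) (hcoord 1)
  have hb' : DifferentiableAt ℂ (fun ζ : C2 => b ((ζ - η) 1)) η :=
    DifferentiableAt.comp η (by simpa using hb) (hcoord 1)
  rw [funext hF]
  exact (ha'.add ((hcoord 0).mul hb')).const_mul θ

end Jacobian

/-- Two expansions whose masses `P`, `P'` differ by at least `2 c`, which makes the linearized
system `s = P ε`, `s = P' ε` uniquely solvable. -/
structure ExpansionPair (δ K κ c M : ℝ) where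
  (g₀ g₁ h₀ h₁ : ℂ → ℂ)
  (P P' : ℝ)
  fst : IsExpansion δ K κ M P g₀ g₁
  snd : IsExpansion δ K κ M P' h₀ h₁
  le_sub : 2 * c ≤ P - P'

/-- An expansion of `Θ⁺` and `Θ⁻` about `η`, up to nonzero factors. -/
structure ThetaExpansion (V : ℝ → ℝ) (Φ : ℝ → ℂ) (η : C2) (δ K κ c M : ℝ) extends
    ExpansionPair δ K κ c M where
  (θ θ' : ℂ)
  θ_ne_zero : θ ≠ 0
  θ'_ne_zero : θ' ≠ 0
  thetaPlus_eq : ∀ ζ, ThetaPlus V Φ M ζ = θ * affineInFst g₀ g₁ (ζ - η)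
  thetaMinus_eq : ∀ ζ, ThetaMinus V Φ M ζ = θ' * affineInFst h₀ h₁ (ζ - η)

section Theta

variable {V Vper φ φ' ψ ψ' : ℝ → ℝ} {Φ : ℝ → ℂ} {ρ E κ C δ M : ℝ} {η : C2}

theorem eta_one (Φ : ℝ → ℂ) (E : ℝ) : eta Φ E 1 = E := by simp [eta]

theorem isSolOn_uSol {a b : ℂ} (hV : Continuous V) (E : ℝ) {ζ : C2}
    (hu : uSol V Φ ζ = ivp V (ζ 1) a b) :
    IsSolOn Set.univ (fun x => ((V x - E : ℝ) : ℂ) - (ζ 1 - E)) (uSol V Φ ζ)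
      (deriv (uSol V Φ ζ)) ∧ uSol V Φ ζ 0 = a ∧ deriv (uSol V Φ ζ) 0 = b := by
  rw [hu]
  exact ⟨(isSolOn_ivp hV (ζ 1) a b).congr fun x _ => by push_cast; ring,
    (ivp_spec hV (ζ 1) a b).2⟩

theorem thetaPlus_eq_affineInFst (hV : Continuous V)
    (h : IsFundamentalPair (fun x => V x - E) φ φ' ψ ψ') (hη : η 1 = E) (ζ : C2)
    (hu : uSol V Φ ζ = ivp V (ζ 1) (φ 0 + (ζ 0 - η 0) * ψ 0) (φ' 0 + (ζ 0 - η 0) * ψ' 0))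
    (hθ : outgoing ψ ψ' E M 0 ≠ 0) :
    ThetaPlus V Φ M ζ = outgoing ψ ψ' E M 0 *
      affineInFst (boundaryFun φ φ' ψ ψ' E M (1, 0)) (boundaryFun φ φ' ψ ψ' E M (0, 1))
        (ζ - η) := by
  obtain ⟨hsol, hu₀, hv₀⟩ := isSolOn_uSol hV E hu
  have hmain := h.outgoing_eq_boundaryFun (by fun_prop) hθ hsol hu₀ hv₀
  rw [add_sub_cancel] at hmain
  rw [ThetaPlus, hmain, affineInFst, PiLp.sub_apply, PiLp.sub_apply, hη]

theorem thetaMinus_eq_affineInFst (hV : Continuous V)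
    (h : IsFundamentalPair (fun x => V (-x) - E) (fun x => φ (-x)) (fun x => -φ' (-x))
      (fun x => -ψ (-x)) (fun x => ψ' (-x))) (hη : η 1 = E) (ζ : C2)
    (hu : uSol V Φ ζ = ivp V (ζ 1) (φ 0 + (ζ 0 - η 0) * ψ 0) (φ' 0 + (ζ 0 - η 0) * ψ' 0))
    (hθ : outgoing (fun x => -ψ (-x)) (fun x => ψ' (-x)) E M 0 ≠ 0) :
    ThetaMinus V Φ M ζ = outgoing (fun x => -ψ (-x)) (fun x => ψ' (-x)) E M 0 * affineInFst
      (fun ε => -boundaryFun (fun x => φ (-x)) (fun x => -φ' (-x)) (fun x => -ψ (-x))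
        (fun x => ψ' (-x)) E M (1, 0) ε)
      (boundaryFun (fun x => φ (-x)) (fun x => -φ' (-x)) (fun x => -ψ (-x))
        (fun x => ψ' (-x)) E M (0, 1)) (ζ - η) := by
  obtain ⟨hsol, hu₀, hv₀⟩ := isSolOn_uSol hV E hu
  have hmain := h.outgoing_eq_boundaryFun (s := -(ζ 0 - η 0)) (by fun_prop) hθ hsol.comp_neg
    (by rw [neg_zero, hu₀]; push_cast; ring) (by rw [neg_zero, hv₀]; push_cast; ring)
  rw [add_sub_cancel] at hmain
  rw [ThetaMinus, affineInFst, PiLp.sub_apply, PiLp.sub_apply, hη]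
  linear_combination -hmain

theorem IsBoundState.exists_thetaExpansion (hV : IsAsymptoticallyPeriodic V Vper ρ) (hE : 0 < E)
    (hΦ : IsBoundState V E Φ) :
    ∃ κ, IsFloquetExponent Vper E κ ∧ ∃ δ K c : ℝ, 0 < δ ∧ δ < E ∧ 0 < K ∧ 0 < c ∧
      ∀ M, 1 ≤ M → Nonempty (ThetaExpansion V Φ (eta Φ E) δ K κ c M) := by
  have hcont := hV.continuous
  obtain ⟨φ, φ', ψ, ψ', h, hi, hu⟩ := hΦ.exists_isFundamentalPair hV
  obtain ⟨κ, C, hκ, hR, hL⟩ := h.exists_isFloquetExponent hV hi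
  have hC := hR.pos
  set δ := min (E / 2) (1 / (4 * C ^ 2))
  have hδ : 0 < δ := by positivity
  have hδE : δ < E := (min_le_left _ _).trans_lt (half_lt_self hE)
  have hδC : δ * (2 * C ^ 2) ≤ 1 / 2 := by
    calc _ ≤ 1 / (4 * C ^ 2) * (2 * C ^ 2) := by gcongr; exact min_le_right _ _
      _ = 1 / 2 := by field_simp; norm_num
  refine ⟨κ, hκ, δ, expansionConst C E κ δ, (∫ t in (0 : ℝ)..1, φ t ^ 2) / 2, hδ, hδE,
    expansionConst_pos hC hκ.1.le hδ.le E, half_pos h.integral_sq_pos, fun M hM => ⟨?_⟩⟩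
  have hM₀ : 0 ≤ M := by linarith
  have hθ := hR.outgoing_ne_zero hE hM₀
  have hθ' := hL.outgoing_ne_zero hE hM₀
  have hright : ∫ t in (0 : ℝ)..1, φ t ^ 2 ≤ ∫ t in (0 : ℝ)..M, φ t ^ 2 :=
    intervalIntegral.integral_mono_interval le_rfl zero_le_one hM
      (.of_forall fun t => sq_nonneg (φ t)) ((h.fst.continuous_fst.pow 2).intervalIntegrable 0 M)
  have hleft : 0 ≤ ∫ t in (0 : ℝ)..M, φ (-t) ^ 2 :=
    intervalIntegral.integral_nonneg hM₀ fun t _ => sq_nonneg _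
  exact ⟨⟨_, _, _, _, _, _, hR.isExpansion_boundaryFun hκ.1 hE hδ.le hδE.le hδC hM,
      (hL.isExpansion_boundaryFun hκ.1 hE hδ.le hδE.le hδC hM).neg_fst, by linarith⟩, _, _, hθ, hθ',
    fun ζ => thetaPlus_eq_affineInFst hcont h (eta_one Φ E) ζ (hu ζ) hθ, fun ζ =>
      thetaMinus_eq_affineInFst hcont hL.toIsFundamentalPair (eta_one Φ E) ζ (hu ζ) hθ'⟩

end Theta

/-! ### Cauchy estimates and a fixed point theorem -/

section FixedPoint

variable {X : Type*} [NormedAddCommGroup X] {N : X} {P : X → X} {L r : ℝ}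

/-- `P` vanishes at `0` and is Lipschitz on `‖x‖ ≤ r` with a constant proportional to the distance
from the origin. -/
structure IsQuadraticOn (P : X → X) (L r : ℝ) : Prop where
  nonneg : 0 ≤ L
  map_zero : P 0 = 0
  norm_sub_le : ∀ x y, ‖x‖ ≤ r → ‖y‖ ≤ r → ‖P x - P y‖ ≤ L * max ‖x‖ ‖y‖ * ‖x - y‖

theorem IsQuadraticOn.norm_sub_le_half (h : IsQuadraticOn P L r) (hLr : L * r ≤ 1 / 2) {x y : X}
    (hx : ‖x‖ ≤ r) (hy : ‖y‖ ≤ r) : ‖P x - P y‖ ≤ 1 / 2 * ‖x - y‖ :=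
  (h.norm_sub_le x y hx hy).trans <| mul_le_mul_of_nonneg_right
    ((mul_le_mul_of_nonneg_left (max_le hx hy) h.nonneg).trans hLr) (norm_nonneg _)

theorem IsQuadraticOn.norm_le_half (h : IsQuadraticOn P L r) (hLr : L * r ≤ 1 / 2) {x : X}
    (hx : ‖x‖ ≤ r) : ‖P x‖ ≤ 1 / 2 * ‖x‖ := by
  simpa [h.map_zero] using
    h.norm_sub_le_half hLr hx (y := 0) (by simpa using (norm_nonneg x).trans hx)

theorem IsQuadraticOn.norm_le (h : IsQuadraticOn P L r) {x : X} (hx : ‖x‖ ≤ r) :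
    ‖P x‖ ≤ L * ‖x‖ ^ 2 := by
  simpa [h.map_zero, pow_two, mul_assoc] using
    h.norm_sub_le x 0 hx (by simpa using (norm_nonneg x).trans hx)

theorem IsQuadraticOn.exists_fixedPoint [CompleteSpace X] (h : IsQuadraticOn P L r)
    (hLr : L * r ≤ 1 / 2) (hN : ‖N‖ ≤ r / 2) : ∃ x, ‖x‖ ≤ r ∧ x = N + P x := by
  have hmaps : Set.MapsTo (fun x => N + P x) (Metric.closedBall 0 r) (Metric.closedBall 0 r) := by
    intro x hx
    rw [mem_closedBall_zero_iff] at hx ⊢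
    linarith [norm_add_le N (P x), h.norm_le_half hLr hx]
  have hcontr : ContractingWith (1 / 2) (hmaps.restrict _ _ _) := by
    refine ⟨by norm_num, LipschitzWith.of_dist_le_mul fun x y => ?_⟩
    simpa [Subtype.dist_eq, dist_eq_norm] using
      h.norm_sub_le_half hLr (mem_closedBall_zero_iff.1 x.2) (mem_closedBall_zero_iff.1 y.2)
  obtain ⟨x, hx, hfix, -⟩ := hcontr.exists_fixedPoint' Metric.isClosed_closedBall.isComplete hmaps
    (Metric.mem_closedBall_self (by linarith [norm_nonneg N])) (edist_ne_top _ _)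
  exact ⟨x, mem_closedBall_zero_iff.1 hx, hfix.symm⟩

theorem IsQuadraticOn.fixedPoint_unique (h : IsQuadraticOn P L r) (hLr : L * r ≤ 1 / 2) {x y : X}
    (hx : ‖x‖ ≤ r) (hy : ‖y‖ ≤ r) (hfx : x = N + P x) (hfy : y = N + P y) : x = y := by
  have hsub : P x - P y = x - y := by
    nth_rewrite 2 [hfx, hfy]
    abel
  have hlip := h.norm_sub_le_half hLr hx hy
  rw [hsub] at hlip
  exact sub_eq_zero.1 (norm_le_zero_iff.1 (by linarith))

theorem IsQuadraticOn.norm_fixedPoint_sub_le (h : IsQuadraticOn P L r) (hLr : L * r ≤ 1 / 2)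
    {x : X} (hx : ‖x‖ ≤ r) (hfx : x = N + P x) : ‖x - N‖ ≤ 4 * L * ‖N‖ ^ 2 := by
  have hP : P x = x - N := eq_sub_of_add_eq' hfx.symm
  have hxN : ‖x‖ ≤ 2 * ‖N‖ := by
    linarith [norm_add_le N (P x), h.norm_le_half hLr hx, congrArg norm hfx]
  calc ‖x - N‖ ≤ L * ‖x‖ ^ 2 := hP ▸ h.norm_le hx
    _ ≤ L * (2 * ‖N‖) ^ 2 := by gcongr; exact h.nonneg
    _ = 4 * L * ‖N‖ ^ 2 := by ring

end FixedPoint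

section Cauchy

variable {F : Type*} [NormedAddCommGroup F] [NormedSpace ℂ F] {g : ℂ → F} {R B : ℝ} {c : F}

theorem norm_deriv_le_of_forall_mem_ball (hR : 0 < R)
    (hg : DifferentiableOn ℂ g (Metric.ball 0 R)) (hB : ∀ ε ∈ Metric.ball 0 R, ‖g ε - c‖ ≤ B)
    {ε : ℂ} (hε : ‖ε‖ < R / 2) : ‖deriv g ε‖ ≤ 4 * B / R := by
  have hsub : Metric.closedBall ε (R / 4) ⊆ Metric.ball 0 R :=
    Metric.closedBall_subset_ball' (by rw [dist_zero_right]; linarith)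
  have hd : DifferentiableOn ℂ (fun ε => g ε - c) (Metric.closedBall ε (R / 4)) :=
    (hg.sub_const c).mono hsub
  have hderiv := Complex.norm_deriv_le_of_forall_mem_sphere_norm_le (by positivity : 0 < R / 4)
    (hd.diffContOnCl_ball subset_rfl) fun z hz => hB z (hsub (Metric.sphere_subset_closedBall hz))
  rw [deriv_sub_const] at hderiv
  exact hderiv.trans_eq (by field_simp)

theorem norm_sub_le_of_forall_mem_ball (hR : 0 < R)
    (hg : DifferentiableOn ℂ g (Metric.ball 0 R)) (hB : ∀ ε ∈ Metric.ball 0 R, ‖g ε - c‖ ≤ B)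
    {x y : ℂ} (hx : ‖x‖ < R / 2) (hy : ‖y‖ < R / 2) : ‖g x - g y‖ ≤ 4 * B / R * ‖x - y‖ := by
  have hsub : Metric.ball (0 : ℂ) (R / 2) ⊆ Metric.ball 0 R := Metric.ball_subset_ball (by linarith)
  exact (convex_ball (0 : ℂ) (R / 2)).norm_image_sub_le_of_norm_deriv_le
    (fun z hz => hg.differentiableAt (Metric.isOpen_ball.mem_nhds (hsub hz)))
    (fun z hz => norm_deriv_le_of_forall_mem_ball hR hg hB (mem_ball_zero_iff.1 hz))
    (mem_ball_zero_iff.2 hy) (mem_ball_zero_iff.2 hx)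

theorem norm_deriv_sub_deriv_zero_le [CompleteSpace F] (hR : 0 < R)
    (hg : DifferentiableOn ℂ g (Metric.ball 0 R)) (hB : ∀ ε ∈ Metric.ball 0 R, ‖g ε - c‖ ≤ B)
    {z : ℂ} (hz : ‖z‖ < R / 4) : ‖deriv g z - deriv g 0‖ ≤ 32 * B / R ^ 2 * ‖z‖ := by
  have hg' : DifferentiableOn ℂ (deriv g) (Metric.ball 0 (R / 2)) :=
    (hg.mono (Metric.ball_subset_ball (by linarith))).deriv Metric.isOpen_ball
  have hlip := norm_sub_le_of_forall_mem_ball (half_pos hR) hg' (c := 0) (B := 4 * B / R)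
    (fun ε hε => by
      rw [sub_zero]
      exact norm_deriv_le_of_forall_mem_ball hR hg hB (mem_ball_zero_iff.1 hε))
    (x := z) (y := 0) (by linarith) (by rw [norm_zero]; positivity)
  rw [sub_zero] at hlip
  exact hlip.trans_eq (by field_simp; ring)

theorem norm_sub_sub_smul_deriv_le [CompleteSpace F] (hR : 0 < R)
    (hg : DifferentiableOn ℂ g (Metric.ball 0 R)) (hB : ∀ ε ∈ Metric.ball 0 R, ‖g ε - c‖ ≤ B)
    {x y : ℂ} {m : ℝ} (hx : ‖x‖ ≤ m) (hy : ‖y‖ ≤ m) (hm : m < R / 4) :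
    ‖g x - g y - (x - y) • deriv g 0‖ ≤ 32 * B / R ^ 2 * m * ‖x - y‖ := by
  have hB₀ : 0 ≤ B := (norm_nonneg _).trans (hB 0 (Metric.mem_ball_self hR))
  have hd (z : ℂ) (hz : z ∈ Metric.closedBall 0 m) :
      HasDerivWithinAt (fun z => g z - z • deriv g 0) (deriv g z - deriv g 0)
        (Metric.closedBall 0 m) z := by
    rw [mem_closedBall_zero_iff] at hz
    have hgz : HasDerivAt g (deriv g z) z := (hg.differentiableAt
      (Metric.isOpen_ball.mem_nhds (by rw [mem_ball_zero_iff]; linarith))).hasDerivAt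
    simpa using (hgz.fun_sub ((hasDerivAt_id z).smul_const (deriv g 0))).hasDerivWithinAt
  have hbound (z : ℂ) (hz : z ∈ Metric.closedBall 0 m) :
      ‖deriv g z - deriv g 0‖ ≤ 32 * B / R ^ 2 * m := by
    rw [mem_closedBall_zero_iff] at hz
    exact (norm_deriv_sub_deriv_zero_le hR hg hB (hz.trans_lt hm)).trans (by gcongr)
  refine le_of_eq_of_le (congrArg norm ?_) ((convex_closedBall (0 : ℂ)
    m).norm_image_sub_le_of_norm_hasDerivWithin_le hd hbound (mem_closedBall_zero_iff.2 hy)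
      (mem_closedBall_zero_iff.2 hx))
  rw [sub_smul]
  abel

end Cauchy

/-! ### Newton's method for a pair of expansions -/

section SolveLinear

variable {p q y₁ y₂ : ℂ}

/-- The solution `(s, ε)` of `s + p ε = y₁`, `s + q ε = y₂`. -/
def solveLinear (p q y₁ y₂ : ℂ) : C2 := !₂[(q - p)⁻¹ * (q * y₁ - p * y₂), (q - p)⁻¹ * (y₂ - y₁)]

theorem norm_solveLinear_le {c H : ℝ} (hc : 0 < c) (hpq : c ≤ ‖q - p‖) (hp : ‖p‖ ≤ H)
    (hq : ‖q‖ ≤ H) : ‖solveLinear p q y₁ y₂‖ ≤ (H + 1) / c * (‖y₁‖ + ‖y₂‖) := by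
  have hinv : ‖(q - p)⁻¹‖ ≤ 1 / c := by rw [norm_inv, ← one_div]; gcongr
  have hfst : ‖q * y₁ - p * y₂‖ ≤ H * ‖y₁‖ + H * ‖y₂‖ :=
    (norm_sub_le _ _).trans (by rw [norm_mul, norm_mul]; gcongr)
  have hsplit : solveLinear p q y₁ y₂ =
      EuclideanSpace.single 0 ((q - p)⁻¹ * (q * y₁ - p * y₂)) +
        EuclideanSpace.single 1 ((q - p)⁻¹ * (y₂ - y₁)) := by
    ext i; fin_cases i <;> simp [solveLinear]
  calc ‖solveLinear p q y₁ y₂‖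
      ≤ ‖(q - p)⁻¹‖ * ‖q * y₁ - p * y₂‖ + ‖(q - p)⁻¹‖ * ‖y₂ - y₁‖ := by
        rw [hsplit]
        simpa using norm_add_le (EuclideanSpace.single (0 : Fin 2) ((q - p)⁻¹ * (q * y₁ - p * y₂)))
          (EuclideanSpace.single 1 ((q - p)⁻¹ * (y₂ - y₁)))
    _ ≤ 1 / c * (H * ‖y₁‖ + H * ‖y₂‖) + 1 / c * (‖y₂‖ + ‖y₁‖) := by
      gcongr; exact norm_sub_le _ _
    _ = (H + 1) / c * (‖y₁‖ + ‖y₂‖) := by ring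

theorem eq_solveLinear_iff (hpq : q - p ≠ 0) (x : C2) :
    x = solveLinear p q y₁ y₂ ↔ x 0 + p * x 1 = y₁ ∧ x 0 + q * x 1 = y₂ := by
  constructor
  · rintro rfl
    simp only [solveLinear, PiLp.toLp_apply, Matrix.cons_val_zero, Matrix.cons_val_one]
    constructor <;> field_simp <;> ring
  · rintro ⟨rfl, rfl⟩
    ext i
    fin_cases i <;>
    simp only [solveLinear, PiLp.toLp_apply, Matrix.cons_val_zero, Matrix.cons_val_one,
      Fin.zero_eta, Fin.mk_one] <;> field_simp <;> ring

theorem solveLinear_add (p q y₁ y₂ z₁ z₂ : ℂ) :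
    solveLinear p q y₁ y₂ + solveLinear p q z₁ z₂ = solveLinear p q (y₁ + z₁) (y₂ + z₂) := by
  ext i
  fin_cases i <;> simp [solveLinear] <;> ring

theorem solveLinear_sub (p q y₁ y₂ z₁ z₂ : ℂ) :
    solveLinear p q y₁ y₂ - solveLinear p q z₁ z₂ = solveLinear p q (y₁ - z₁) (y₂ - z₂) := by
  ext i
  fin_cases i <;> simp [solveLinear] <;> ring

end SolveLinear

/-- The value at `x = (s, ε)` of `g₀ ε + s g₁ ε` minus its affine approximation
`g₀ 0 + s + g₀'(0) ε` at the origin, for `g₁ 0 = 1`. -/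
def remainder (g₀ g₁ : ℂ → ℂ) (x : C2) : ℂ :=
  g₀ (x 1) - g₀ 0 - deriv g₀ 0 * x 1 + x 0 * (g₁ (x 1) - 1)

/-- The Lipschitz constant of `remainder` is this multiple of `M` times the radius. -/
def remainderConst (δ K : ℝ) : ℝ := 32 * K / δ ^ 2 + 8 * K / δ

/-- Bounds the inverse of the linearization of an `ExpansionPair`. -/
def inverseConst (δ K c : ℝ) : ℝ := (4 * K / δ + 1) / c

/-- `newtonErrorConst δ K c * M * e^{-4 κ M}` bounds the distance from the first Newton step to the
root. -/
def newtonErrorConst (δ K c : ℝ) : ℝ :=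
  4 * (2 * inverseConst δ K c * remainderConst δ K) * (2 * inverseConst δ K c * K) ^ 2

section Expansion

variable {δ K κ M P r : ℝ} {g₀ g₁ : ℂ → ℂ}

theorem IsExpansion.nonneg (h : IsExpansion δ K κ M P g₀ g₁) (hδ : 0 < δ) (hM : 0 < M) : 0 ≤ K :=
  (norm_nonneg _).trans (h.norm_snd_le 0 (Metric.mem_ball_self (by positivity)))

theorem IsExpansion.differentiableAt_zero (h : IsExpansion δ K κ M P g₀ g₁) (hδ : 0 < δ)
    (hM : 0 < M) : DifferentiableAt ℂ g₀ 0 ∧ DifferentiableAt ℂ g₁ 0 :=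
  have hball : Metric.ball (0 : ℂ) (δ / M) ∈ nhds 0 := Metric.ball_mem_nhds 0 (by positivity)
  ⟨h.differentiableOn_fst.differentiableAt hball, h.differentiableOn_snd.differentiableAt hball⟩

theorem IsExpansion.norm_deriv_le (h : IsExpansion δ K κ M P g₀ g₁) (hδ : 0 < δ) (hM : 0 < M) :
    ‖deriv g₀ 0‖ ≤ 4 * K / δ :=
  (norm_deriv_le_of_forall_mem_ball (by positivity) h.differentiableOn_fst h.norm_fst_sub_le
    (by rw [norm_zero]; positivity)).trans_eq (by field_simp)

theorem IsExpansion.norm_snd_sub_le (h : IsExpansion δ K κ M P g₀ g₁) (hR : 0 < δ / M) {z z' : ℂ}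
    (hz : ‖z‖ < δ / M / 2) (hz' : ‖z'‖ < δ / M / 2) :
    ‖g₁ z - g₁ z'‖ ≤ 4 * K / (δ / M) * ‖z - z'‖ :=
  norm_sub_le_of_forall_mem_ball hR h.differentiableOn_snd (c := 0)
    (by simpa only [sub_zero] using h.norm_snd_le) hz hz'

theorem IsExpansion.norm_remainder_sub_le (h : IsExpansion δ K κ M P g₀ g₁) (hδ : 0 < δ)
    (hM : 0 < M) (hr : r < δ / M / 4) {x y : C2} (hx : ‖x‖ ≤ r) (hy : ‖y‖ ≤ r) :
    ‖remainder g₀ g₁ x - remainder g₀ g₁ y‖ ≤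
      remainderConst δ K * M * max ‖x‖ ‖y‖ * ‖x - y‖ := by
  have hR : 0 < δ / M := by positivity
  have hK := h.nonneg hδ hM
  have hmr : max ‖x‖ ‖y‖ ≤ r := max_le hx hy
  have hx₁ := (PiLp.norm_apply_le x 1).trans (le_max_left ‖x‖ ‖y‖)
  have hy₀ := (PiLp.norm_apply_le y 0).trans (le_max_right ‖x‖ ‖y‖)
  have hy₁ := (PiLp.norm_apply_le y 1).trans (le_max_right ‖x‖ ‖y‖)
  have hsub₀ : ‖x 0 - y 0‖ ≤ ‖x - y‖ := PiLp.norm_apply_le (x - y) 0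
  have hsub₁ : ‖x 1 - y 1‖ ≤ ‖x - y‖ := PiLp.norm_apply_le (x - y) 1
  have hg₀ := norm_sub_sub_smul_deriv_le hR h.differentiableOn_fst h.norm_fst_sub_le hx₁ hy₁
    (hmr.trans_lt hr)
  have hg₁ {z z' : ℂ} (hz : ‖z‖ ≤ max ‖x‖ ‖y‖) (hz' : ‖z'‖ ≤ max ‖x‖ ‖y‖) :
      ‖g₁ z - g₁ z'‖ ≤ 4 * K / (δ / M) * ‖z - z'‖ :=
    h.norm_snd_sub_le hR (by linarith) (by linarith)
  have hg₁_one : ‖g₁ (x 1) - 1‖ ≤ 4 * K / (δ / M) * max ‖x‖ ‖y‖ := by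
    have := hg₁ hx₁ (z' := 0) (by rw [norm_zero]; positivity)
    rw [h.snd_zero, sub_zero] at this
    exact this.trans (by gcongr)
  have hsplit : remainder g₀ g₁ x - remainder g₀ g₁ y =
      (g₀ (x 1) - g₀ (y 1) - (x 1 - y 1) • deriv g₀ 0) +
        (x 0 - y 0) * (g₁ (x 1) - 1) + y 0 * (g₁ (x 1) - g₁ (y 1)) := by
    simp only [remainder, smul_eq_mul]; ring
  calc _ ≤ 32 * (K / M) / (δ / M) ^ 2 * max ‖x‖ ‖y‖ * ‖x 1 - y 1‖ +
          ‖x 0 - y 0‖ * (4 * K / (δ / M) * max ‖x‖ ‖y‖) +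
          ‖y 0‖ * (4 * K / (δ / M) * ‖x 1 - y 1‖) := by
        rw [hsplit]
        refine (norm_add₃_le ..).trans ?_
        rw [norm_mul, norm_mul]
        gcongr
        exact hg₁ hx₁ hy₁
    _ ≤ 32 * (K / M) / (δ / M) ^ 2 * max ‖x‖ ‖y‖ * ‖x - y‖ +
          ‖x - y‖ * (4 * K / (δ / M) * max ‖x‖ ‖y‖) +
          max ‖x‖ ‖y‖ * (4 * K / (δ / M) * ‖x - y‖) := by gcongr
    _ = _ := by unfold remainderConst; field_simp; ring

end Expansion

/-- The conditions on `M` and `r` under which Newton's method for an `ExpansionPair` converges in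
the ball of radius `r`: the linearization is invertible, the ball is well inside the domain, the
nonlinear part is a contraction there and the first Newton step has length at most `r / 2`. -/
structure NewtonCondition (δ K κ c M r : ℝ) : Prop where
  pos : 0 < M
  mul_exp_le : 2 * K * M * Real.exp (-(2 * κ * M)) ≤ c
  lt_div : r < δ / M / 4
  lipschitz_le : 2 * inverseConst δ K c * remainderConst δ K * M * r ≤ 1 / 2
  step_le : 2 * inverseConst δ K c * K * Real.exp (-(2 * κ * M)) ≤ r / 2

theorem NewtonCondition.lt {δ K κ c M r : ℝ} (h : NewtonCondition δ K κ c M r) (hδ : 0 < δ)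
    (hM : 1 ≤ M) : r < δ := by
  have hdiv : δ / M ≤ δ := div_le_self hδ.le hM
  linarith [h.lt_div, div_pos hδ h.pos]

namespace ExpansionPair

variable {δ K κ c M r : ℝ} (S : ExpansionPair δ K κ c M)

/-- The first Newton iterate, starting at the origin, for the pair of equations
`g₀ ε + s g₁ ε = 0`, `h₀ ε + s h₁ ε = 0`. -/
def newtonStep : C2 := solveLinear (deriv S.g₀ 0) (deriv S.h₀ 0) (-S.g₀ 0) (-S.h₀ 0)

/-- The map whose fixed points, translated by `newtonStep`, are the common zeros. -/
def correction (x : C2) : C2 :=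
  solveLinear (deriv S.g₀ 0) (deriv S.h₀ 0) (-remainder S.g₀ S.g₁ x) (-remainder S.h₀ S.h₁ x)

/-- The common zeros `(s, ε)` of `g₀ ε + s g₁ ε` and `h₀ ε + s h₁ ε`. -/
def IsRoot (x : C2) : Prop := affineInFst S.g₀ S.g₁ x = 0 ∧ affineInFst S.h₀ S.h₁ x = 0

theorem le_norm_deriv_sub (hM : 2 * K * M * Real.exp (-(2 * κ * M)) ≤ c) :
    c ≤ ‖deriv S.h₀ 0 - deriv S.g₀ 0‖ := by
  have hsplit : ((S.P - S.P' : ℝ) : ℂ) =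
      (deriv S.h₀ 0 - deriv S.g₀ 0) + ((deriv S.g₀ 0 + S.P) - (deriv S.h₀ 0 + S.P')) := by
    push_cast; ring
  have hnorm : S.P - S.P' ≤ ‖deriv S.h₀ 0 - deriv S.g₀ 0‖ +
      (K * M * Real.exp (-(2 * κ * M)) + K * M * Real.exp (-(2 * κ * M))) := by
    calc S.P - S.P' ≤ ‖((S.P - S.P' : ℝ) : ℂ)‖ := by
          rw [Complex.norm_real]; exact le_abs_self _
      _ ≤ ‖deriv S.h₀ 0 - deriv S.g₀ 0‖ +
          (‖deriv S.g₀ 0 + S.P‖ + ‖deriv S.h₀ 0 + S.P'‖) := by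
        rw [hsplit]
        exact (norm_add_le _ _).trans (by gcongr; exact norm_sub_le _ _)
      _ ≤ _ := by gcongr; exacts [S.fst.norm_deriv_fst_add_le, S.snd.norm_deriv_fst_add_le]
  linarith [S.le_sub]

variable {S}

theorem norm_solveLinear_deriv_le (hδ : 0 < δ) (hc : 0 < c) (h : NewtonCondition δ K κ c M r)
    (y₁ y₂ : ℂ) : ‖solveLinear (deriv S.g₀ 0) (deriv S.h₀ 0) y₁ y₂‖ ≤
      inverseConst δ K c * (‖y₁‖ + ‖y₂‖) :=
  norm_solveLinear_le hc (S.le_norm_deriv_sub h.mul_exp_le) (S.fst.norm_deriv_le hδ h.pos)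
    (S.snd.norm_deriv_le hδ h.pos)

theorem norm_newtonStep_le (hδ : 0 < δ) (hc : 0 < c) (h : NewtonCondition δ K κ c M r) :
    ‖S.newtonStep‖ ≤ 2 * inverseConst δ K c * K * Real.exp (-(2 * κ * M)) := by
  have hK := S.fst.nonneg hδ h.pos
  have hΓ : 0 ≤ inverseConst δ K c := by unfold inverseConst; positivity
  calc ‖S.newtonStep‖ ≤ inverseConst δ K c * (‖-S.g₀ 0‖ + ‖-S.h₀ 0‖) :=
        norm_solveLinear_deriv_le hδ hc h _ _
    _ ≤ inverseConst δ K c *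
          (K * Real.exp (-(2 * κ * M)) + K * Real.exp (-(2 * κ * M))) := by
      rw [norm_neg, norm_neg]
      gcongr
      exacts [S.fst.norm_fst_zero_le, S.snd.norm_fst_zero_le]
    _ = _ := by ring

theorem isQuadraticOn_correction (hδ : 0 < δ) (hc : 0 < c) (h : NewtonCondition δ K κ c M r) :
    IsQuadraticOn S.correction (2 * inverseConst δ K c * remainderConst δ K * M) r := by
  have hM := h.pos
  have hK := S.fst.nonneg hδ hM
  have hΓ : 0 ≤ inverseConst δ K c := by unfold inverseConst; positivity
  have hΛ : 0 ≤ remainderConst δ K := by unfold remainderConst; positivity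
  refine ⟨by positivity, ?_, fun x y hx hy => ?_⟩
  · ext i; fin_cases i <;> simp [correction, solveLinear, remainder]
  · rw [correction, correction, solveLinear_sub, neg_sub_neg, neg_sub_neg]
    refine (norm_solveLinear_deriv_le hδ hc h _ _).trans ?_
    rw [norm_sub_rev, norm_sub_rev (remainder S.h₀ S.h₁ y)]
    calc _ ≤ inverseConst δ K c * (remainderConst δ K * M * max ‖x‖ ‖y‖ * ‖x - y‖ +
            remainderConst δ K * M * max ‖x‖ ‖y‖ * ‖x - y‖) := by
          gcongr
          exacts [S.fst.norm_remainder_sub_le hδ hM h.lt_div hx hy,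
            S.snd.norm_remainder_sub_le hδ hM h.lt_div hx hy]
      _ = _ := by ring

theorem eq_newtonStep_add_correction_iff (h : deriv S.h₀ 0 - deriv S.g₀ 0 ≠ 0) (x : C2) :
    x = S.newtonStep + S.correction x ↔ S.IsRoot x := by
  rw [newtonStep, correction, solveLinear_add, eq_solveLinear_iff h]
  have hiff (g₀ g₁ : ℂ → ℂ) : x 0 + deriv g₀ 0 * x 1 = -g₀ 0 + -remainder g₀ g₁ x ↔
      affineInFst g₀ g₁ x = 0 := by
    rw [← sub_eq_zero, affineInFst, remainder]
    ring_nf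
  exact and_congr (hiff S.g₀ S.g₁) (hiff S.h₀ S.h₁)

/-- `e^{-4 κ M}` is the square of the size of the Newton step. -/
theorem exists_isRoot (hδ : 0 < δ) (hc : 0 < c) (h : NewtonCondition δ K κ c M r) :
    ∃ x, ‖x‖ ≤ r ∧ S.IsRoot x ∧ (∀ y, ‖y‖ ≤ r → S.IsRoot y → y = x) ∧
      ‖x - S.newtonStep‖ ≤ newtonErrorConst δ K c * M * Real.exp (-(4 * κ * M)) := by
  have hiff := S.eq_newtonStep_add_correction_iff
    (norm_pos_iff.1 (hc.trans_le (S.le_norm_deriv_sub h.mul_exp_le)))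
  have hquad := isQuadraticOn_correction (S := S) hδ hc h
  have hstep := norm_newtonStep_le (S := S) hδ hc h
  have hL := hquad.nonneg
  obtain ⟨x, hx, hfix⟩ := hquad.exists_fixedPoint h.lipschitz_le (hstep.trans h.step_le)
  refine ⟨x, hx, (hiff x).1 hfix,
    fun y hy hroot => hquad.fixedPoint_unique h.lipschitz_le hy hx ((hiff y).2 hroot) hfix, ?_⟩
  calc ‖x - S.newtonStep‖ ≤ 4 * (2 * inverseConst δ K c * remainderConst δ K * M) *
          (2 * inverseConst δ K c * K * Real.exp (-(2 * κ * M))) ^ 2 :=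
        (hquad.norm_fixedPoint_sub_le h.lipschitz_le hx hfix).trans (by gcongr)
    _ = newtonErrorConst δ K c * M * Real.exp (-(2 * κ * M)) ^ 2 := by
      unfold newtonErrorConst; ring
    _ = _ := by rw [← Real.exp_nat_mul]; congr 2; push_cast; ring

end ExpansionPair

theorem theta_eq_zero_iff {V : ℝ → ℝ} {Φ : ℝ → ℂ} {M : ℝ} {ζ : C2} :
    Theta V Φ M ζ = 0 ↔ ThetaPlus V Φ M ζ = 0 ∧ ThetaMinus V Φ M ζ = 0 := by
  rw [WithLp.ext_iff, funext_iff, Fin.forall_fin_two]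
  rfl

namespace ThetaExpansion

variable {V : ℝ → ℝ} {Φ : ℝ → ℂ} {η : C2} {δ K κ c M : ℝ} (T : ThetaExpansion V Φ η δ K κ c M)

include T

theorem differentiableAt_theta (hδ : 0 < δ) (hM : 0 < M) : DifferentiableAt ℂ (Theta V Φ M) η := by
  obtain ⟨hg₀, hg₁⟩ := T.fst.differentiableAt_zero hδ hM
  obtain ⟨hh₀, hh₁⟩ := T.snd.differentiableAt_zero hδ hM
  refine differentiableAt_euclidean.2 (Fin.forall_fin_two.2 ⟨?_, ?_⟩)
  · exact differentiableAt_of_affineInFst T.thetaPlus_eq hg₀ hg₁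
  · exact differentiableAt_of_affineInFst T.thetaMinus_eq hh₀ hh₁

theorem theta_eq_zero_iff_isRoot (ζ : C2) : Theta V Φ M ζ = 0 ↔ T.IsRoot (ζ - η) := by
  rw [theta_eq_zero_iff, T.thetaPlus_eq, T.thetaMinus_eq, mul_eq_zero_iff_left T.θ_ne_zero,
    mul_eq_zero_iff_left T.θ'_ne_zero, ExpansionPair.IsRoot]

theorem dw_thetaPlus : dw (ThetaPlus V Φ M) η = T.θ := by
  rw [dw_eq_of_affineInFst T.thetaPlus_eq, T.fst.snd_zero, mul_one]

theorem dw_thetaMinus : dw (ThetaMinus V Φ M) η = T.θ' := by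
  rw [dw_eq_of_affineInFst T.thetaMinus_eq, T.snd.snd_zero, mul_one]

theorem dz_thetaPlus (hδ : 0 < δ) (hM : 0 < M) :
    dz (ThetaPlus V Φ M) η = T.θ * deriv T.g₀ 0 :=
  dz_eq_of_affineInFst T.thetaPlus_eq (T.fst.differentiableAt_zero hδ hM).1

theorem dz_thetaMinus (hδ : 0 < δ) (hM : 0 < M) :
    dz (ThetaMinus V Φ M) η = T.θ' * deriv T.h₀ 0 :=
  dz_eq_of_affineInFst T.thetaMinus_eq (T.snd.differentiableAt_zero hδ hM).1

theorem theta_base : Theta V Φ M η = !₂[T.θ * T.g₀ 0, T.θ' * T.h₀ 0] := by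
  simp [Theta, T.thetaPlus_eq η, T.thetaMinus_eq η, affineInFst]

theorem jacDet_eq (hδ : 0 < δ) (hM : 0 < M) :
    jacDet V Φ M η = T.θ * T.θ' * (deriv T.h₀ 0 - deriv T.g₀ 0) := by
  rw [jacDet, T.dw_thetaPlus, T.dw_thetaMinus, T.dz_thetaPlus hδ hM, T.dz_thetaMinus hδ hM]
  ring

theorem newtonPoint_eq (hδ : 0 < δ) (hM : 0 < M) (h : deriv T.h₀ 0 - deriv T.g₀ 0 ≠ 0) :
    newtonPoint V Φ M η = η + T.newtonStep := by
  have hθ := T.θ_ne_zero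
  have hθ' := T.θ'_ne_zero
  rw [newtonPoint, sub_eq_add_neg, Xi, T.jacDet_eq hδ hM, T.dw_thetaPlus, T.dw_thetaMinus,
    T.dz_thetaPlus hδ hM, T.dz_thetaMinus hδ hM, T.theta_base, ExpansionPair.newtonStep]
  congr 1
  refine (eq_solveLinear_iff h _).2 ?_
  simp only [Matrix.smul_of, Matrix.smul_cons, Matrix.smul_empty, smul_eq_mul, mul_neg,
    Matrix.mulVec_cons, Matrix.mulVec_empty, add_zero, WithLp.toLp_add, WithLp.toLp_smul,
    PiLp.add_apply, PiLp.neg_apply, PiLp.smul_apply, Function.comp_apply, Matrix.cons_val_zero,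
    Matrix.tail_cons, Matrix.head_cons, Matrix.cons_val_one]
  constructor <;> field_simp <;> ring

theorem exists_root (hδ : 0 < δ) (hc : 0 < c) {k : ℝ}
    (h : NewtonCondition δ K κ c M (1 / M ^ 2 * Real.exp (-(k * M)))) :
    jacDet V Φ M η ≠ 0 ∧ ∃ ζ ∈ Omega k M η, Theta V Φ M ζ = 0 ∧
      (∀ ζ' ∈ Omega k M η, Theta V Φ M ζ' = 0 → ζ' = ζ) ∧
      ‖ζ - newtonPoint V Φ M η‖ ≤ newtonErrorConst δ K c * M * Real.exp (-(4 * κ * M)) := by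
  have hne : deriv T.h₀ 0 - deriv T.g₀ 0 ≠ 0 :=
    norm_pos_iff.1 (hc.trans_le (T.le_norm_deriv_sub h.mul_exp_le))
  obtain ⟨x, hx, hroot, hunique, herr⟩ := T.exists_isRoot hδ hc h
  refine ⟨?_, η + x, ?_, ?_, fun ζ' hζ' hΘ => ?_, ?_⟩
  · rw [T.jacDet_eq hδ h.pos]
    exact mul_ne_zero (mul_ne_zero T.θ_ne_zero T.θ'_ne_zero) hne
  · rwa [Omega, mem_closedBall_iff_norm, add_sub_cancel_left]
  · rwa [T.theta_eq_zero_iff_isRoot, add_sub_cancel_left]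
  · rw [← hunique (ζ' - η) (mem_closedBall_iff_norm.1 hζ') ((T.theta_eq_zero_iff_isRoot ζ').1 hΘ),
      add_sub_cancel]
  · rwa [T.newtonPoint_eq hδ h.pos hne, add_sub_add_left_eq_sub]

end ThetaExpansion

/-! ### Resonant states -/

/-- `u` is `C¹` with derivative `v`, and `v' = W u` off a countable set: the form of the equation
`u'' = W u` for a potential `W` with jumps. -/
structure IsPiecewiseSol (W u v : ℝ → ℂ) : Prop where
  hasDerivAt_fst : ∀ x, HasDerivAt u (v x) x
  continuous_snd : Continuous v
  hasDerivAt_snd : ∀ᶠ x in Filter.cocountable, HasDerivAt v (W x * u x) x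

theorem eventually_cocountable_ne (c : ℝ) : ∀ᶠ x in Filter.cocountable, x ≠ c :=
  Filter.mem_cocountable.2 (by simp)

theorem hasDerivAt_ite_of_ne {f g f' g' : ℝ → ℂ} {c x : ℝ} (hx : x ≠ c)
    (hf : HasDerivAt f (f' x) x) (hg : HasDerivAt g (g' x) x) :
    HasDerivAt (fun x => if x ≤ c then f x else g x) (if x ≤ c then f' x else g' x) x := by
  rcases lt_or_gt_of_ne hx with hx | hx
  · rw [if_pos hx.le]
    refine hf.congr_of_eventuallyEq ?_
    filter_upwards [Iio_mem_nhds hx] with y hy using if_pos hy.le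
  · rw [if_neg hx.not_ge]
    refine hg.congr_of_eventuallyEq ?_
    filter_upwards [Ioi_mem_nhds hx] with y hy using if_neg hy.not_ge

theorem hasDerivAt_ite {f g f' g' : ℝ → ℂ} {c : ℝ} (hf : ∀ x, HasDerivAt f (f' x) x)
    (hg : ∀ x, HasDerivAt g (g' x) x) (h : f c = g c) (h' : f' c = g' c) (x : ℝ) :
    HasDerivAt (fun x => if x ≤ c then f x else g x) (if x ≤ c then f' x else g' x) x := by
  rcases eq_or_ne x c with rfl | hx
  · have hleft : HasDerivWithinAt (fun y => if y ≤ x then f y else g y) (f' x) (Set.Iic x) x :=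
      (hf x).hasDerivWithinAt.congr (fun y hy => if_pos hy) (if_pos le_rfl)
    have hright : HasDerivWithinAt (fun y => if y ≤ x then f y else g y) (f' x) (Set.Ici x) x := by
      rw [h']
      refine (hg x).hasDerivWithinAt.congr (fun y hy => ?_) ((if_pos le_rfl).trans h)
      rcases eq_or_lt_of_le (Set.mem_Ici.1 hy) with rfl | hy
      · exact (if_pos le_rfl).trans h
      · exact if_neg hy.not_ge
    have hunion := hleft.union hright
    rw [Set.Iic_union_Ici, hasDerivWithinAt_univ] at hunion
    rwa [if_pos le_rfl]
  · exact hasDerivAt_ite_of_ne hx (hf x) (hg x)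

section PiecewiseSol

variable {W W' u v f g : ℝ → ℂ}

theorem IsSolOn.isPiecewiseSol (h : IsSolOn Set.univ W u v) : IsPiecewiseSol W u v :=
  ⟨fun x => (h x trivial).1, h.continuous_snd, .of_forall fun x => (h x trivial).2⟩

theorem IsPiecewiseSol.congr (h : IsPiecewiseSol W u v)
    (hW : ∀ᶠ x in Filter.cocountable, W x = W' x) : IsPiecewiseSol W' u v where
  hasDerivAt_fst := h.hasDerivAt_fst
  continuous_snd := h.continuous_snd
  hasDerivAt_snd := by filter_upwards [h.hasDerivAt_snd, hW] with x hx hWx using hWx ▸ hx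

theorem IsPiecewiseSol.ite (h : IsPiecewiseSol W u v) (h' : IsPiecewiseSol W' f g) (c : ℝ)
    (hu : u c = f c) (hv : v c = g c) :
    IsPiecewiseSol (fun x => if x ≤ c then W x else W' x) (fun x => if x ≤ c then u x else f x)
      (fun x => if x ≤ c then v x else g x) where
  hasDerivAt_fst := hasDerivAt_ite h.hasDerivAt_fst h'.hasDerivAt_fst hu hv
  continuous_snd := h.continuous_snd.if_le h'.continuous_snd continuous_id continuous_const
    fun x hx => by rw [show x = c from hx, hv]
  hasDerivAt_snd := by
    filter_upwards [h.hasDerivAt_snd, h'.hasDerivAt_snd, eventually_cocountable_ne c]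
      with x hx hx' hc
    convert hasDerivAt_ite_of_ne (f' := fun x => W x * u x) (g' := fun x => W' x * f x) hc hx hx'
      using 1
    split_ifs <;> rfl

theorem IsPiecewiseSol.eq_add_integral (h : IsPiecewiseSol W u v) {a b : ℝ}
    (hi : IntervalIntegrable (fun x => W x * u x) volume a b) :
    v b = v a + ∫ x in a..b, W x * u x := by
  rw [integral_eq_of_hasDerivAt_off_countable v _ (Filter.mem_cocountable.1 h.hasDerivAt_snd)
    h.continuous_snd.continuousOn (fun x hx => not_not.1 hx.2) hi, add_sub_cancel]

theorem isSolOn_exp (a c : ℂ) (d : ℝ) : IsSolOn Set.univ (fun _ => c ^ 2)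
    (fun x : ℝ => a * Complex.exp (c * ((x : ℂ) - d)))
    (fun x : ℝ => c * (a * Complex.exp (c * ((x : ℂ) - d)))) := by
  have hd (x : ℝ) : HasDerivAt (fun x : ℝ => a * Complex.exp (c * ((x : ℂ) - d)))
      (c * (a * Complex.exp (c * ((x : ℂ) - d)))) x := by
    have harg : HasDerivAt (fun x : ℝ => c * ((x : ℂ) - d)) (c * 1) x :=
      ((hasDerivAt_id x).ofReal_comp.sub_const (d : ℂ)).const_mul c
    exact (harg.cexp.const_mul a).congr_deriv (by ring)
  exact fun x _ => ⟨hd x, ((hd x).const_mul c).congr_deriv (by ring)⟩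

end PiecewiseSol

section Resonance

variable {V : ℝ → ℝ} {z σ : ℂ} {u v : ℝ → ℂ} {M : ℝ}

/-- The flux `Im (u' ū)` is monotone when `Im z ≥ 0`, while the outgoing conditions give it opposite
signs at the two ends. -/
theorem im_neg_of_outgoing (hσ : 0 < σ.re) (hM : 0 ≤ M)
    (hu : IsSolOn Set.univ (fun x => (V x : ℂ) - z) u v) (huM : u M ≠ 0)
    (hp : v M = Complex.I * σ * u M) (hm : v (-M) = -(Complex.I * σ * u (-M))) : z.im < 0 := by
  by_contra! hz
  set flux : ℝ → ℝ := fun x => (v x).im * (u x).re - (v x).re * (u x).im with hflux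
  have hderiv (x : ℝ) : HasDerivAt flux (-(z.im * Complex.normSq (u x))) x := by
    obtain ⟨hux, hvx⟩ := hu x trivial
    refine (((Complex.imCLM.hasFDerivAt.comp_hasDerivAt x hvx).mul
      (Complex.reCLM.hasFDerivAt.comp_hasDerivAt x hux)).sub
      ((Complex.reCLM.hasFDerivAt.comp_hasDerivAt x hvx).mul
        (Complex.imCLM.hasFDerivAt.comp_hasDerivAt x hux))).congr_deriv ?_
    simp only [Complex.imCLM_apply, Complex.mul_im, Complex.sub_re, Complex.ofReal_re,
      Complex.sub_im, Complex.ofReal_im, zero_sub, neg_mul, Function.comp_apply,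
      Complex.reCLM_apply, Complex.mul_re, sub_neg_eq_add, Complex.normSq_apply]
    ring
  have hanti : Antitone flux := antitone_of_hasDerivAt_nonpos hderiv fun x =>
    neg_nonpos.2 (mul_nonneg hz (Complex.normSq_nonneg _))
  have hright : flux M = σ.re * Complex.normSq (u M) := by
    simp only [hflux, hp, Complex.mul_im, Complex.mul_re, Complex.I_re, Complex.I_im,
      Complex.normSq_apply]
    ring
  have hleft : flux (-M) = -(σ.re * Complex.normSq (u (-M))) := by
    simp only [hflux, hm, Complex.neg_im, Complex.neg_re, Complex.mul_im, Complex.mul_re,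
      Complex.I_re, Complex.I_im, Complex.normSq_apply]
    ring
  have hle := hanti (neg_le_self hM)
  rw [hright, hleft] at hle
  have hright_pos := mul_pos hσ (Complex.normSq_pos.2 huM)
  have hleft_nonneg := mul_nonneg hσ.le (Complex.normSq_nonneg (u (-M)))
  linarith

theorem intervalIntegrable_Vtrunc_sub_mul (hV : Continuous V) {f : ℝ → ℂ} (hf : Continuous f)
    (M : ℝ) (z : ℂ) (a b : ℝ) :
    IntervalIntegrable (fun t => ((Vtrunc V M t : ℂ) - z) * f t) volume a b := by
  have hVf : IntervalIntegrable (Set.indicator {t : ℝ | |t| ≤ M} fun t => (V t : ℂ) * f t)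
      volume a b := by
    have hcont : IntervalIntegrable (fun t => (V t : ℂ) * f t) volume a b :=
      Continuous.intervalIntegrable (by fun_prop) a b
    rw [intervalIntegrable_iff] at hcont ⊢
    exact hcont.indicator (measurableSet_le (by fun_prop) (by fun_prop))
  convert hVf.sub (Continuous.intervalIntegrable (by fun_prop : Continuous fun t => z * f t) a b)
    using 2 with t
  by_cases ht : |t| ≤ M <;> simp [Vtrunc, ht, sub_mul]

theorem IsSolOn.exists_outgoing_extension (hM : 0 < M)
    (hu : IsSolOn Set.univ (fun x => (V x : ℂ) - z) u v) (hσ : σ ^ 2 = -z) (hp : v M = σ * u M)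
    (hm : v (-M) = -(σ * u (-M))) :
    ∃ ψ ψ', IsPiecewiseSol (fun x => (Vtrunc V M x : ℂ) - z) ψ ψ' ∧ ψ M = u M ∧
      (∀ x, M < x → ψ x = u M * Complex.exp (σ * (x - M))) ∧
      ∀ x, x < -M → ψ x = u (-M) * Complex.exp (-σ * (x - (-M : ℝ))) := by
  have hMM : -M < M := by linarith
  have hmid := hu.isPiecewiseSol.ite (isSolOn_exp (u M) σ M).isPiecewiseSol M (by simp)
    (by simp [hp])
  have hψ := (isSolOn_exp (u (-M)) (-σ) (-M)).isPiecewiseSol.ite hmid (-M) (by simp [hMM.le])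
    (by simp [hMM.le, hm])
  refine ⟨_, _, hψ.congr ?_, by simp [hMM.not_ge], fun x hx => ?_, fun x hx => if_pos hx.le⟩
  · filter_upwards [eventually_cocountable_ne (-M)] with x hx
    rcases lt_or_gt_of_ne hx with hx | hx
    · rw [if_pos hx.le, Vtrunc, if_neg (by rw [not_le, lt_abs]; right; linarith), neg_sq, hσ]
      simp
    · by_cases hxM : x ≤ M
      · rw [if_neg hx.not_ge, if_pos hxM, Vtrunc, if_pos (abs_le.2 ⟨hx.le, hxM⟩)]
      · rw [if_neg hx.not_ge, if_neg hxM, Vtrunc,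
          if_neg (by rw [not_le, lt_abs]; left; linarith), hσ]
        simp
  · rw [if_neg (hMM.trans hx).not_ge, if_neg hx.not_ge]

theorem IsSolOn.isResonance (hV : Continuous V) (hz : 0 < z.re) (hM : 0 < M)
    (hu : IsSolOn Set.univ (fun x => (V x : ℂ) - z) u v) (hne : u ≠ 0)
    (hp : v M = Complex.I * Complex.sqrt z * u M)
    (hm : v (-M) = -(Complex.I * Complex.sqrt z * u (-M))) : IsResonance (Vtrunc V M) z := by
  have huM : u M ≠ 0 := fun hc => hne <| by
    ext x
    simpa using (hu.eq_of_eq_at (x₀ := M) (x := x) (by fun_prop) (hu.const_mul 0) isOpen_univ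
      isPreconnected_univ trivial (by simp [hc]) (by simp [hp, hc]) trivial).1
  have hsqrt : 0 < (Complex.sqrt z).re := by
    rw [Complex.sqrt, Complex.cpow_inv_two_re]
    positivity
  have hσ : (Complex.I * Complex.sqrt z) ^ 2 = -z := by
    rw [mul_pow, Complex.I_sq, Complex.sqrt, Complex.cpow_ofNat_inv_pow, neg_one_mul]
  obtain ⟨ψ, ψ', hψ, hψM, hright, hleft⟩ := hu.exists_outgoing_extension hM hσ hp hm
  have hcont : Continuous ψ :=
    continuous_iff_continuousAt.2 fun x => (hψ.hasDerivAt_fst x).continuousAt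
  have hderiv : deriv ψ = ψ' := funext fun x => (hψ.hasDerivAt_fst x).deriv
  refine ⟨hz, im_neg_of_outgoing hsqrt hM.le hu huM hp hm, ψ, ?_, fun hc => ?_, fun x => ?_, M,
    u M * Complex.exp (-(Complex.I * Complex.sqrt z * M)),
    u (-M) * Complex.exp (-(Complex.I * Complex.sqrt z * M)), fun x hx => ?_, fun x hx => ?_⟩
  · rw [contDiff_one_iff_deriv, hderiv]
    exact ⟨fun x => (hψ.hasDerivAt_fst x).differentiableAt, hψ.continuous_snd⟩
  · exact huM (by rw [← hψM, hc, Pi.zero_apply])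
  · rw [hderiv]
    exact hψ.eq_add_integral (intervalIntegrable_Vtrunc_sub_mul hV hcont M z 0 x)
  · rw [hright x hx, mul_assoc (u M), ← Complex.exp_add]
    ring_nf
  · rw [hleft x hx, mul_assoc (u (-M)), ← Complex.exp_add]
    push_cast
    ring_nf

end Resonance

/-! ### Large truncations -/

section LargeTruncation

variable {V : ℝ → ℝ} {Φ : ℝ → ℂ} {E M κ k δ K c : ℝ} {ζ : C2}

theorem isSolOn_univ_uSol (hV : Continuous V) (Φ : ℝ → ℂ) (ζ : C2) :
    IsSolOn Set.univ (fun x => (V x : ℂ) - ζ 1) (uSol V Φ ζ) (deriv (uSol V Φ ζ)) := by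
  rw [uSol]
  split_ifs
  exacts [isSolOn_ivp hV _ _ _, isSolOn_ivp hV _ _ _]

theorem uSol_ne_zero (hV : Continuous V) (Φ : ℝ → ℂ) (ζ : C2) : uSol V Φ ζ ≠ 0 := by
  intro h
  by_cases h0 : Φ 0 = 0
  · have hu : ivp V (ζ 1) (-(ζ 0)) 1 = 0 := by rwa [uSol, if_neg (not_not.2 h0)] at h
    simpa [hu] using (ivp_spec hV (ζ 1) (-(ζ 0)) 1).2.2
  · have hu : ivp V (ζ 1) 1 (ζ 0) = 0 := by rwa [uSol, if_pos h0] at h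
    simpa [hu] using (ivp_spec hV (ζ 1) 1 (ζ 0)).2.1

theorem isResonance_of_theta_eq_zero (hV : Continuous V) (hM : 0 < M) (hz : 0 < (ζ 1).re)
    (h : Theta V Φ M ζ = 0) : IsResonance (Vtrunc V M) (ζ 1) := by
  obtain ⟨hp, hm⟩ := theta_eq_zero_iff.1 h
  exact (isSolOn_univ_uSol hV Φ ζ).isResonance hV hz hM (uSol_ne_zero hV Φ ζ) (sub_eq_zero.1 hp)
    (eq_neg_of_add_eq_zero_left hm)

theorem re_pos_of_norm_sub_eta_lt (h : ‖ζ - eta Φ E‖ < E) : 0 < (ζ 1).re := by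
  have hre : |(ζ 1 - E).re| ≤ ‖ζ - eta Φ E‖ := by
    refine (Complex.abs_re_le_norm _).trans ?_
    rw [← eta_one Φ E]
    exact PiLp.norm_apply_le (ζ - eta Φ E) 1
  rw [Complex.sub_re, Complex.ofReal_re] at hre
  linarith [neg_abs_le ((ζ 1).re - E)]

theorem eventually_mul_pow_mul_exp_neg_le (n : ℕ) {a b c : ℝ} (ha : 0 < a) (hc : 0 < c) :
    ∀ᶠ M : ℝ in Filter.atTop, b * (M ^ n * Real.exp (-(a * M))) ≤ c := by
  have hlim := (tendsto_rpow_mul_exp_neg_mul_atTop_nhds_zero n a ha).const_mul b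
  simp only [Real.rpow_natCast, neg_mul, mul_zero] at hlim
  exact hlim.eventually_le_const hc

theorem eventually_newtonCondition (hk : 0 < k) (hkκ : k ≤ κ) (hδ : 0 < δ) (hK : 0 ≤ K)
    (hc : 0 < c) :
    ∀ᶠ M in Filter.atTop, NewtonCondition δ K κ c M (1 / M ^ 2 * Real.exp (-(k * M))) := by
  have hκ := hk.trans_le hkκ
  set Γ := inverseConst δ K c
  set Λ := remainderConst δ K
  have hΓ : 0 ≤ Γ := by unfold Γ inverseConst; positivity
  have hΛ : 0 ≤ Λ := by unfold Λ remainderConst; positivity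
  filter_upwards [Filter.eventually_gt_atTop 0, Filter.eventually_gt_atTop (4 / δ),
    Filter.eventually_ge_atTop (4 * Γ * Λ),
    eventually_mul_pow_mul_exp_neg_le 1 (b := 2 * K) (show 0 < 2 * κ by positivity) hc,
    eventually_mul_pow_mul_exp_neg_le 2 (b := 4 * Γ * K) hκ one_pos] with M hM hMδ hMΓ hexp hexp₂
  have hexp_le : Real.exp (-(k * M)) ≤ 1 := Real.exp_le_one_iff.2 (neg_nonpos.2 (by positivity))
  refine ⟨hM, ?_, ?_, ?_, ?_⟩
  · rwa [pow_one, ← mul_assoc] at hexp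
  · calc _ ≤ 1 / M ^ 2 * 1 := by gcongr
      _ < δ / M / 4 := by
        rw [div_lt_iff₀ hδ] at hMδ
        rw [mul_one, div_div, div_lt_div_iff₀ (by positivity) (by positivity)]
        nlinarith
  · calc _ ≤ 2 * Γ * Λ * M * (1 / M ^ 2 * 1) := by gcongr
      _ = 4 * Γ * Λ / M / 2 := by field_simp; ring
      _ ≤ M / M / 2 := by gcongr
      _ = 1 / 2 := by rw [div_self hM.ne']
  · have hsq : Real.exp (-(2 * κ * M)) = Real.exp (-(κ * M)) * Real.exp (-(κ * M)) := by
      rw [← Real.exp_add]; ring_nf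
    calc _ = 4 * Γ * K * (M ^ 2 * Real.exp (-(κ * M))) *
          (1 / M ^ 2 * Real.exp (-(κ * M))) / 2 := by rw [hsq]; field_simp; ring
      _ ≤ 1 * (1 / M ^ 2 * Real.exp (-(k * M))) / 2 := by gcongr
      _ = _ := by rw [one_mul]

theorem mul_exp_neg_four_le (hkκ : k < κ) (M : ℝ) :
    M * Real.exp (-(4 * κ * M)) ≤ 1 / (4 * (κ - k)) * Real.exp (-(4 * k * M)) := by
  have hsplit : Real.exp (-(4 * κ * M)) =
      Real.exp (-(4 * (κ - k) * M)) * Real.exp (-(4 * k * M)) := by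
    rw [← Real.exp_add]; ring_nf
  rw [hsplit, ← mul_assoc]
  gcongr
  exact mul_exp_neg_le (by linarith) M

theorem exists_pos_error_bounds (C : ℝ) (hkκ : k ≤ κ) :
    ∃ C' > 0, ∀ M ≥ 0, C * M * Real.exp (-(4 * κ * M)) ≤ C' * M * Real.exp (-(4 * κ * M)) ∧
      (k < κ → C * M * Real.exp (-(4 * κ * M)) ≤ C' * Real.exp (-(4 * k * M))) := by
  have hinv : 0 ≤ 1 / (4 * (κ - k)) := one_div_nonneg.2 (by linarith)
  have hC := le_abs_self C
  refine ⟨|C| * (1 / (4 * (κ - k))) + |C| + 1, by positivity, fun M hM => ⟨?_, fun hlt => ?_⟩⟩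
  · gcongr
    linarith [mul_nonneg (abs_nonneg C) hinv]
  · calc _ ≤ |C| * (M * Real.exp (-(4 * κ * M))) := by rw [mul_assoc]; gcongr
      _ ≤ |C| * (1 / (4 * (κ - k)) * Real.exp (-(4 * k * M))) :=
        mul_le_mul_of_nonneg_left (mul_exp_neg_four_le hlt M) (abs_nonneg C)
      _ ≤ _ := by
        rw [← mul_assoc]
        gcongr
        linarith [abs_nonneg C]

end LargeTruncation

end TruncatedDefect

end

theorem mainTheorem4_general (V Vper : ℝ → ℝ) (ρ E : ℝ) (Φ : ℝ → ℂ)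
    (hV : TruncatedDefect.IsAsymptoticallyPeriodic V Vper ρ)
    (hE : 0 < E) (hΦ : TruncatedDefect.IsBoundState V E Φ) :
    ∃ κ : ℝ, TruncatedDefect.IsFloquetExponent Vper E κ ∧
      ∀ k : ℝ, 0 < k → k ≤ κ →
        ∃ M₀ : ℝ, ρ < M₀ ∧ ∃ C : ℝ, 0 < C ∧ ∀ M : ℝ, M₀ ≤ M →
          DifferentiableAt ℂ (TruncatedDefect.Theta V Φ M) (TruncatedDefect.eta Φ E) ∧
          TruncatedDefect.jacDet V Φ M (TruncatedDefect.eta Φ E) ≠ 0 ∧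
          ∃ ζ : TruncatedDefect.C2,
            (ζ ∈ TruncatedDefect.Omega k M (TruncatedDefect.eta Φ E) ∧
              TruncatedDefect.Theta V Φ M ζ = 0) ∧
            (∀ ζ' ∈ TruncatedDefect.Omega k M (TruncatedDefect.eta Φ E),
              TruncatedDefect.Theta V Φ M ζ' = 0 → ζ' = ζ) ∧
            (k < κ → ‖ζ - TruncatedDefect.newtonPoint V Φ M (TruncatedDefect.eta Φ E)‖
              ≤ C * Real.exp (-(4 * k * M))) ∧
            ‖ζ - TruncatedDefect.newtonPoint V Φ M (TruncatedDefect.eta Φ E)‖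
              ≤ C * M * Real.exp (-(4 * κ * M)) ∧
            TruncatedDefect.IsResonance (TruncatedDefect.Vtrunc V M) (ζ 1) := by
  open TruncatedDefect in
  obtain ⟨κ, hκ, δ, K, c, hδ, hδE, hK, hc, hT⟩ := hΦ.exists_thetaExpansion hV hE
  refine ⟨κ, hκ, fun k hk hkκ => ?_⟩
  obtain ⟨M₀, hM₀⟩ := Filter.eventually_atTop.1 <|
    (Filter.eventually_ge_atTop 1).and <| (Filter.eventually_gt_atTop ρ).and <|
      eventually_newtonCondition hk hkκ hδ hK.le hc
  obtain ⟨C, hC, hbounds⟩ := exists_pos_error_bounds (newtonErrorConst δ K c) hkκ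
  refine ⟨M₀, (hM₀ M₀ le_rfl).2.1, C, hC, fun M hM => ?_⟩
  obtain ⟨hM1, -, hN⟩ := hM₀ M hM
  obtain ⟨T⟩ := hT M hM1
  obtain ⟨hJ, ζ, hζ, hroot, hunique, herr⟩ := T.exists_root hδ hc hN
  obtain ⟨hle, hlt⟩ := hbounds M hN.pos.le
  have hnear : ‖ζ - eta Φ E‖ < E :=
    (mem_closedBall_iff_norm.1 hζ).trans_lt ((hN.lt hδ hM1).trans hδE)
  exact ⟨T.differentiableAt_theta hδ hN.pos, hJ, ζ, ⟨hζ, hroot⟩, hunique,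
    fun hk => herr.trans (hlt hk), herr.trans hle,
    isResonance_of_theta_eq_zero hV.continuous hN.pos (re_pos_of_norm_sub_eta_lt hnear) hroot⟩

theorem mainTheorem4 (V Vper Vdef : ℝ → ℝ) (ρ E : ℝ) (Φ : ℝ → ℂ)
    (hρ : 0 ≤ ρ) (hV : TruncatedDefect.IsEventuallyPeriodic V Vper Vdef ρ)
    (hE : 0 < E) (hΦ : TruncatedDefect.IsBoundState V E Φ) :
    ∃ κ : ℝ, TruncatedDefect.IsFloquetExponent Vper E κ ∧
      ∀ k : ℝ, 0 < k → k ≤ κ →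
        ∃ M₀ : ℝ, ρ < M₀ ∧ ∃ C : ℝ, 0 < C ∧ ∀ M : ℝ, M₀ ≤ M →
          DifferentiableAt ℂ (TruncatedDefect.Theta V Φ M) (TruncatedDefect.eta Φ E) ∧
          TruncatedDefect.jacDet V Φ M (TruncatedDefect.eta Φ E) ≠ 0 ∧
          ∃ ζ : TruncatedDefect.C2,
            (ζ ∈ TruncatedDefect.Omega k M (TruncatedDefect.eta Φ E) ∧
              TruncatedDefect.Theta V Φ M ζ = 0) ∧
            (∀ ζ' ∈ TruncatedDefect.Omega k M (TruncatedDefect.eta Φ E),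
              TruncatedDefect.Theta V Φ M ζ' = 0 → ζ' = ζ) ∧
            (k < κ → ‖ζ - TruncatedDefect.newtonPoint V Φ M (TruncatedDefect.eta Φ E)‖
              ≤ C * Real.exp (-(4 * k * M))) ∧
            ‖ζ - TruncatedDefect.newtonPoint V Φ M (TruncatedDefect.eta Φ E)‖
              ≤ C * M * Real.exp (-(4 * κ * M)) ∧
            TruncatedDefect.IsResonance (TruncatedDefect.Vtrunc V M) (ζ 1) :=
  mainTheorem4_general V Vper ρ E Φ hV.isAsymptoticallyPeriodic hE hΦ
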